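/- Let $n\ge 1$ and equip $\mathbb R^n$ with its standard orientation. Let $V$ be a smooth vector field on $\mathbb R^n$ which is an Euler vector field with respect to $0$, i.e. for every $f\in C^\infty(\mathbb R^n)$ with $f(0)=0$ the function $Vf-f$ vanishes to second order at $0$ (for instance $V=\sum_i \xi^i\partial_{\xi^i}$). Currents are complex valued; a current $T$ of degree $n-p$ on an open set $\Omega$ is a continuous linear form $\alpha\mapsto\langle\alpha,T\rangle=\int_\Omega\alpha\wedge T$ on the compactly supported smooth $p$-forms on $\Omega$. Vector fields act on currents by Lie derivative and $\iota_V$ denotes contraction with $V$; thus $\langle\alpha,\iota_Vu\rangle=\langle\alpha(V),u\rangle$ and $\langle\varphi,Vu\rangle=-\langle V\varphi,u\rangle$ for $u$ of degree $n$, a test $1$-form $\alpha$ and a test function $\varphi$. Let $u\in\mathcal D'^{,n}(\mathbb R^n\setminus\{0\})$ be a current of top degree with $Vu=0$ on $\mathbb R^n\setminus\{0\}$. Then: 1. The current $\iota_Vu$ is closed on $\mathbb R^n\setminus\{0\}$, and for $\chi\in C_c^\infty(\mathbb R^n)$ with $\chi=1$ near $0$ the pairing of the exact form $d\chi$ with $\iota_Vu$,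 $$\langle d\chi,\iota_Vu\rangle=\int_{\mathbb R^n}d\chi\wedge\iota_Vu ,$$ does not depend on the choice of $\chi$. 2. Suppose that $\mathrm{WF}(u)\subset\{(\xi,\tau\,dQ(\xi)) : Q(\xi)=0,\ \tau<0\}$ for some nondegenerate quadratic form $Q$ on $\mathbb R^n$. Then $\mathrm{WF}(\iota_Vu)$ does not meet the conormal bundle of the unit sphere $\mathbb S^{n-1}$, so that $\int_{\mathbb S^{n-1}}\iota_Vu$ is defined (as the limit of $\int_{\mathbb S^{n-1}}\theta_j$ for smooth $(n-1)$-forms $\theta_j\to\iota_Vu$ in Hörmander's spaces $\mathcal D'_\Gamma$, where $\Gamma\supset\mathrm{WF}(\iota_Vu)$ is any closed conic set not meeting this conormal bundle), and $$\int_{\mathbb S^{n-1}}\iota_Vu=-\langle d\chi,\iota_Vu\rangle$$ when $\mathbb S^{n-1}$ is oriented as the boundary of the unit ball (outward normal first). Equivalently, $\langle d\chi,\iota_Vu\rangle$ is the integral of $\iota_Vu$ over $\mathbb S^{n-1}$ with the opposite orientation, as boundary of the exterior of the ball. 3. There is an extension $\overline u\in\mathcal D'^{,n}(\mathbb R^n)$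 of $u$ with $V\overline u=0$ on $\mathbb R^n$ if and only if $\langle d\chi,\iota_Vu\rangle=0$; equivalently, there is an extension $\overline u$ of $u$ such that $\iota_V\overline u$ is closed on $\mathbb R^n$ if and only if $\langle d\chi,\iota_Vu\rangle=0$. For every extension $\overline u$ of $u$ to $\mathbb R^n$, $V\overline u=0$ if and only if $\iota_V\overline u$ is closed on $\mathbb R^n$. -/

import Mathlib

open Set Filter Topology MeasureTheory TopologicalSpace
open scoped Distributions ContDiff

noncomputable section

namespace Residue

/-- The space `ℝⁿ` with `n = m + 1 ≥ 1`. -/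
abbrev Space (m : ℕ) : Type := EuclideanSpace ℝ (Fin (m + 1))

/-- Real covectors on `ℝⁿ` (the fibre of the cotangent bundle). -/
abbrev Covector (m : ℕ) : Type := Space m →L[ℝ] ℝ

/-- The open set `ℝⁿ ∖ {0}`. -/
def punctured (m : ℕ) : Opens (Space m) := ⟨{0}ᶜ, isOpen_compl_singleton⟩

/-! ### Currents

`ℝⁿ` carries its standard orientation. A (complex) current of degree `n - p` on an open set `Ω` is
a continuous linear form `α ↦ ⟨α, T⟩ = ∫ α ∧ T` on the space of compactly supported smooth
complex `p`-forms on `Ω`. Only the degrees `n` (tested against functions) and `n - 1` (tested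
against `1`-forms) occur. -/

/-- Compactly supported smooth complex functions on `Ω`. -/
abbrev TestFun {m : ℕ} (Ω : Opens (Space m)) : Type := 𝓓(Ω, ℂ)

/-- Compactly supported smooth complex `1`-forms on `Ω`. -/
abbrev TestOneForm {m : ℕ} (Ω : Opens (Space m)) : Type := 𝓓(Ω, Space m →L[ℝ] ℂ)

/-- Currents of top degree `n` on `Ω`. -/
abbrev TopCurrent {m : ℕ} (Ω : Opens (Space m)) : Type := TestFun Ω →L[ℂ] ℂ

/-- Currents of degree `n - 1` on `Ω`. -/
abbrev SubtopCurrent {m : ℕ} (Ω : Opens (Space m)) : Type := TestOneForm Ω →L[ℂ] ℂ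

/-- The exterior derivative of test functions, `φ ↦ dφ`. -/
def dTest {m : ℕ} (Ω : Opens (Space m)) : TestFun Ω →L[ℂ] TestOneForm Ω :=
  TestFunction.fderivCLM ℂ ⊤ ⊤

/-- The contraction of test `1`-forms with a smooth vector field, `α ↦ ι_V α = α(V)`. -/
def contractTest {m : ℕ} (Ω : Opens (Space m)) {V : Space m → Space m} (hV : ContDiff ℝ ∞ V) :
    TestOneForm Ω →L[ℂ] TestFun Ω :=
  TestFunction.mkCLM ℂ
    (fun α ↦ ⟨fun x ↦ α x (V x), α.contDiff.clm_apply hV,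
      α.hasCompactSupport.mono' (fun x hx ↦ subset_tsupport _ (fun h ↦ hx (by simp [h]))),
      (closure_mono (Function.support_subset_iff'.2 fun x hx ↦ by
        simp [Function.notMem_support.1 hx])).trans α.tsupport_subset⟩)
    (fun _ _ ↦ by ext; simp; rfl)
    (fun _ _ ↦ by ext; simp; left; rfl)
    (fun K hK ↦ (TestFunction.continuous_ofSupportedIn hK).comp
      (ContDiffMapSupportedIn.bilinLeftCLM (ContinuousLinearMap.id ℝ (Space m →L[ℝ] ℂ))
        (K := K) hV).continuous)

@[simp]
theorem contractTest_apply {m : ℕ} {Ω : Opens (Space m)} {V : Space m → Space m}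
    (hV : ContDiff ℝ ∞ V) (α : TestOneForm Ω) (x : Space m) :
    contractTest Ω hV α x = α x (V x) := rfl

@[simp]
theorem dTest_apply {m : ℕ} {Ω : Opens (Space m)} (φ : TestFun Ω) (x : Space m) :
    dTest Ω φ x = fderiv ℝ φ x := by
  simp [dTest]

/-- The contraction `ι_V u` of a current of top degree:
`⟨α, ι_V u⟩ = ∫ α ∧ ι_V u = ∫ α(V) u = ⟨α(V), u⟩`, as `0 = ι_V (α ∧ u) = α(V) u - α ∧ ι_V u`. -/
def contract {m : ℕ} {Ω : Opens (Space m)} {V : Space m → Space m} (hV : ContDiff ℝ ∞ V)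
    (u : TopCurrent Ω) : SubtopCurrent Ω :=
  u ∘L contractTest Ω hV

/-- The exterior derivative of a current of degree `n - 1`:
`⟨φ, dT⟩ = ∫ φ dT = - ∫ dφ ∧ T = - ⟨dφ, T⟩`. -/
def extDer {m : ℕ} {Ω : Opens (Space m)} (T : SubtopCurrent Ω) : TopCurrent Ω :=
  -(T ∘L dTest Ω)

/-- The Lie derivative `V u` of a current of top degree: `⟨φ, V u⟩ = - ⟨V φ, u⟩`, where
`V φ = dφ(V)`. -/
def lieDer {m : ℕ} {Ω : Opens (Space m)} {V : Space m → Space m} (hV : ContDiff ℝ ∞ V)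
    (u : TopCurrent Ω) : TopCurrent Ω :=
  -(u ∘L contractTest Ω hV ∘L dTest Ω)

/-- `w`, a current on `ℝⁿ`, extends `u`, a current on `ℝⁿ ∖ {0}`: they agree on the test functions
supported in `ℝⁿ ∖ {0}`. -/
def Extends {m : ℕ} (w : TopCurrent (⊤ : Opens (Space m))) (u : TopCurrent (punctured m)) : Prop :=
  ∀ φ : TestFun (punctured m), w (TestFunction.monoCLM ℂ φ) = u φ

/-- `V` is an Euler vector field with respect to `0`: it is smooth, and `V f - f` vanishes to second
order at `0` for every smooth function `f` which vanishes at `0`. -/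
structure IsEulerField {m : ℕ} (V : Space m → Space m) : Prop where
  smooth : ContDiff ℝ ∞ V
  euler : ∀ f : Space m → ℝ, ContDiff ℝ ∞ f → f 0 = 0 →
    (fun x ↦ fderiv ℝ f x (V x) - f x) =O[𝓝 0] fun x ↦ ‖x‖ ^ 2

/-- The differential `dχ` of a cutoff `χ ∈ C_c^∞(ℝⁿ)` with `χ = 1` near `0`, as a compactly
supported `1`-form on `ℝⁿ ∖ {0}`. -/
def dCutoff {m : ℕ} (χ : TestFun (⊤ : Opens (Space m))) (hχ : ∀ᶠ x in 𝓝 0, χ x = 1) :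
    TestOneForm (punctured m) where
  toFun := fderiv ℝ χ
  contDiff' := χ.contDiff.fderiv_right (by simp)
  hasCompactSupport' := χ.hasCompactSupport.fderiv ℝ
  tsupport_subset' := by
    intro x hx hx0
    have h0 : x = 0 := hx0
    subst h0
    refine (notMem_tsupport_iff_eventuallyEq.2 ?_) hx
    filter_upwards [hχ.eventually_nhds] with y hy
    have : (χ : Space m → ℂ) =ᶠ[𝓝 y] fun _ ↦ 1 := hy
    simp [this.fderiv_eq]

/-- The residue pairing `⟨dχ, ι_V u⟩ = ∫ dχ ∧ ι_V u`. -/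
def residuePairing {m : ℕ} {V : Space m → Space m} (hV : ContDiff ℝ ∞ V)
    (u : TopCurrent (punctured m)) (χ : TestFun (⊤ : Opens (Space m)))
    (hχ : ∀ᶠ x in 𝓝 0, χ x = 1) : ℂ :=
  contract hV u (dCutoff χ hχ)

/-! ### Wavefront sets

These are defined for continuous linear forms on `F`-valued test functions, which covers currents of
degree `n` (`F = ℂ`) and `n - 1` (`F` = complex covectors); the wavefront set of a current is the
union of the wavefront sets of its coefficients. -/

section Wavefront

variable {m : ℕ} {Ω : Opens (Space m)} {F : Type} [NormedAddCommGroup F] [NormedSpace ℝ F]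
  [NormedSpace ℂ F] [IsScalarTower ℝ ℂ F]

/-- The test function `x ↦ e^{-i η(x)} φ(x) v`. -/
def oscTest (φ : TestFun Ω) (v : F) (η : Covector m) : 𝓓(Ω, F) where
  toFun x := (Complex.exp (-Complex.I * (η x : ℂ)) * φ x) • v
  contDiff' := by
    have h1 : ContDiff ℝ ∞ fun x : Space m ↦ Complex.exp (-Complex.I * (η x : ℂ)) :=
      (contDiff_const.mul (Complex.ofRealCLM.contDiff.comp η.contDiff)).cexp
    exact (h1.mul φ.contDiff).smul contDiff_const
  hasCompactSupport' :=
    φ.hasCompactSupport.mono' (fun x hx ↦ subset_tsupport _ (fun h ↦ hx (by simp [h])))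
  tsupport_subset' :=
    (closure_mono (Function.support_subset_iff'.2 fun x hx ↦ by
      simp [Function.notMem_support.1 hx])).trans φ.tsupport_subset

/-- The Fourier transform at `η` of the `v`-component of the compactly supported current `φ T`. -/
def localFourier (T : 𝓓(Ω, F) →L[ℂ] ℂ) (φ : TestFun Ω) (v : F) (η : Covector m) : ℂ :=
  T (oscTest φ v η)

/-- A set of covectors is conic if it is stable under multiplication by positive numbers. -/
def IsCone (C : Set (Covector m)) : Prop :=
  ∀ η ∈ C, ∀ t : ℝ, 0 < t → t • η ∈ C

/-- `T` is microlocally smooth at `(x, ξ)`: for some `φ` with `φ(x) ≠ 0`, the Fourier transform of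
`φ T` decays rapidly in an open conic neighbourhood of `ξ`. -/
def MicroSmoothAt (T : 𝓓(Ω, F) →L[ℂ] ℂ) (x : Space m) (ξ : Covector m) : Prop :=
  ∃ φ : TestFun Ω, φ x ≠ 0 ∧ ∃ C : Set (Covector m), IsOpen C ∧ IsCone C ∧ ξ ∈ C ∧
    ∀ (v : F) (N : ℕ), ∃ B : ℝ, ∀ η ∈ C, ‖η‖ ^ N * ‖localFourier T φ v η‖ ≤ B

/-- The wavefront set, a subset of `T*Ω ∖ 0`. -/
def wavefront (T : 𝓓(Ω, F) →L[ℂ] ℂ) : Set (Space m × Covector m) :=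
  {p | p.1 ∈ Ω ∧ p.2 ≠ 0 ∧ ¬ MicroSmoothAt T p.1 p.2}

/-- `Γ` is a closed conic subset of `T*Ω ∖ 0`. -/
def IsClosedConic (Ω : Opens (Space m)) (Γ : Set (Space m × Covector m)) : Prop :=
  (∃ A : Set (Space m × Covector m), IsClosed A ∧ Γ = A ∩ {p | p.1 ∈ Ω ∧ p.2 ≠ 0}) ∧
    ∀ p ∈ Γ, ∀ t : ℝ, 0 < t → (p.1, t • p.2) ∈ Γ

/-- Convergence of a sequence in Hörmander's space `𝓓'_Γ(Ω)`: weak convergence, together with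
`sup_{η ∈ C} |η|^N |F(φ T_j)(η) - F(φ T)(η)| → 0` for all `N`, all test functions `φ` and all
closed cones `C` such that `supp φ × C` does not meet `Γ`. -/
structure TendstoHormander (Γ : Set (Space m × Covector m)) (Tseq : ℕ → 𝓓(Ω, F) →L[ℂ] ℂ)
    (T : 𝓓(Ω, F) →L[ℂ] ℂ) : Prop where
  weak : ∀ α : 𝓓(Ω, F), Tendsto (fun j ↦ Tseq j α) atTop (𝓝 (T α))
  decay : ∀ (φ : TestFun Ω) (C : Set (Covector m)), IsClosed C → IsCone C →
    (∀ x ∈ tsupport φ, ∀ η ∈ C, (x, η) ∉ Γ) → ∀ (v : F) (N : ℕ),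
      TendstoUniformlyOn (fun j η ↦ ((‖η‖ : ℂ) ^ N) * localFourier (Tseq j) φ v η)
        (fun η ↦ ((‖η‖ : ℂ) ^ N) * localFourier T φ v η) atTop C

end Wavefront

/-! ### Integration of currents of degree `n - 1` over the unit sphere -/

/-- Complex alternating `(n - 1)`-forms on `ℝⁿ`. -/
abbrev AltForm (m : ℕ) : Type := Space m [⋀^Fin m]→L[ℝ] ℂ

/-- The standard basis vector `e_i` of `ℝⁿ`. -/
def stdBasis {m : ℕ} (i : Fin (m + 1)) : Space m := EuclideanSpace.single i 1

/-- For a covector `α` and an alternating `(n - 1)`-form `β`, the number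
`(α ∧ β)(e_0, …, e_{n-1})`, i.e. the coefficient of `α ∧ β` with respect to the volume form. -/
def topWedge (m : ℕ) : (Space m →L[ℝ] ℂ) →L[ℂ] AltForm m →L[ℂ] ℂ :=
  LinearMap.mkContinuous₂
    (LinearMap.mk₂ ℂ
      (fun (α : Space m →L[ℝ] ℂ) (β : AltForm m) ↦ ∑ i : Fin (m + 1),
        (-1) ^ (i : ℕ) * α (stdBasis i) * β (fun j ↦ stdBasis (i.succAbove j)))
      (fun _ _ _ ↦ by simp [mul_add, add_mul, Finset.sum_add_distrib])
      (fun _ _ _ ↦ by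
        simp only [smul_apply, smul_eq_mul, Finset.mul_sum]
        exact Finset.sum_congr rfl fun _ _ ↦ by ring)
      (fun _ _ _ ↦ by simp [mul_add, Finset.sum_add_distrib])
      (fun _ _ _ ↦ by
        simp only [ContinuousAlternatingMap.smul_apply, smul_eq_mul, Finset.mul_sum]
        exact Finset.sum_congr rfl fun _ _ ↦ by ring))
    (m + 1)
    (fun α β ↦ by
      have key : ∀ i : Fin (m + 1), ‖(-1 : ℂ) ^ (i : ℕ) * α (stdBasis i) *
          β (fun j ↦ stdBasis (i.succAbove j))‖ ≤ ‖α‖ * ‖β‖ := fun i ↦ by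
        have h1 : ‖α (stdBasis i)‖ ≤ ‖α‖ := by
          simpa [stdBasis] using α.le_opNorm (stdBasis i)
        have h2 : ‖β (fun j ↦ stdBasis (i.succAbove j))‖ ≤ ‖β‖ := by
          simpa [stdBasis] using β.le_opNorm (fun j ↦ stdBasis (i.succAbove j))
        simp only [norm_mul, norm_pow, norm_neg, norm_one, one_pow, one_mul]
        gcongr
      calc _ ≤ ∑ _i : Fin (m + 1), ‖α‖ * ‖β‖ := norm_sum_le_of_le _ fun i _ ↦ key i
        _ = _ := by simp [mul_assoc])

theorem topWedge_apply {m : ℕ} (α : Space m →L[ℝ] ℂ) (β : AltForm m) :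
    topWedge m α β = ∑ i : Fin (m + 1),
      (-1) ^ (i : ℕ) * α (stdBasis i) * β (fun j ↦ stdBasis (i.succAbove j)) := rfl

/-- The current `α ↦ ∫ α ∧ θ` defined by a smooth `(n - 1)`-form `θ` on `Ω`. -/
def currentOfForm {m : ℕ} (Ω : Opens (Space m)) (θ : Space m → AltForm m) : SubtopCurrent Ω :=
  TestFunction.integralAgainstBilinCLM (topWedge m) volume θ

/-- The outward unit conormal of the unit sphere at `x`, i.e. `w ↦ ⟨x, w⟩`, with complex values. -/
def unitConormal {m : ℕ} (x : Space m) : Space m →L[ℝ] ℂ :=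
  Complex.ofRealCLM ∘L innerSL ℝ x

/-- The integral `∫_{S^{n-1}} θ` of an `(n - 1)`-form, smooth near the unit sphere, over the unit
sphere oriented as the boundary of the unit ball (outward normal first): the restriction of `θ` to
the sphere is `f dσ`, where `dσ` is the surface measure and `f` is the coefficient of
`ν ∧ θ` with respect to the volume form, `ν` being the outward unit conormal. -/
def sphereIntegral {m : ℕ} (θ : Space m → AltForm m) : ℂ :=
  ∫ x : Metric.sphere (0 : Space m) 1, topWedge m (unitConormal (x : Space m)) (θ x)
    ∂(volume : Measure (Space m)).toSphere

/-- The conormal bundle of the unit sphere, without its zero section. -/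
def conormalSphere (m : ℕ) : Set (Space m × Covector m) :=
  {p | ‖p.1‖ = 1 ∧ p.2 ≠ 0 ∧ ∀ w : Space m, inner ℝ p.1 w = 0 → p.2 w = 0}

/-- `∫_{S^{n-1}} T` is defined and equal to `I`, for a current `T` of degree `n - 1` on `ℝⁿ ∖ {0}`.
The wavefront set of `T` must not meet the conormal bundle of the sphere, and the integral is then
the sequentially continuous extension of the integral of smooth forms to the spaces `𝓓'_Γ`, for
all closed conic sets `Γ ⊇ WF(T)` which do not meet this conormal bundle: `T` is a limit of smooth
forms in `𝓓'_Γ`, and `∫_{S^{n-1}} θ_j → I` for all smooth forms `θ_j` converging to `T` in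
`𝓓'_Γ`. -/
def HasSphereIntegral {m : ℕ} (T : SubtopCurrent (punctured m)) (I : ℂ) : Prop :=
  Disjoint (wavefront T) (conormalSphere m) ∧
  ∀ Γ : Set (Space m × Covector m), IsClosedConic (punctured m) Γ → wavefront T ⊆ Γ →
    Disjoint Γ (conormalSphere m) →
    (∃ θ : ℕ → Space m → AltForm m, (∀ j, ContDiffOn ℝ ∞ (θ j) (punctured m)) ∧
      TendstoHormander Γ (fun j ↦ currentOfForm (punctured m) (θ j)) T) ∧
    ∀ θ : ℕ → Space m → AltForm m, (∀ j, ContDiffOn ℝ ∞ (θ j) (punctured m)) →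
      TendstoHormander Γ (fun j ↦ currentOfForm (punctured m) (θ j)) T →
      Tendsto (fun j ↦ sphereIntegral (θ j)) atTop (𝓝 I)

end Residue

end

/-! By duality `d(ι_V u)` and `V u` are the same functional `φ ↦ -u(dφ(V))`, so closedness of the
contraction is invariance of the current. Two cutoffs differ by a test function which vanishes near
`0`, and an invariant current kills the `V`-derivative of such a function; hence the pairing does
not depend on the cutoff (`residuePairing_eq_of_eventually`).

Extension. If `w` is an invariant extension, the pairing is `w(Vχ) = 0`. For the converse one solves
`V(Pf) = f - f(0)` near `0` with `Pf` smooth: `Pf(x)` is the integral of `(f(c(t)) - f(0)) dt/t`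
over the trajectory `c` of `V` from `0` to `x`, where `t c' = V(c)`. Since `χ f = f(0) χ + V(χ Pf) -
(Vχ) Pf`, an invariant extension with `w(χ) = 0` has to be `w(f) = u((1 - χ) f - (Vχ) Pf)`. This
formula does extend `u`, and `w(Vψ)` equals `ψ(0)` times the pairing (`exists_invariant_extension`).
To see that trajectories depend smoothly on their end point, write `V(x) = x + Q(x)(x, x)` and `c(t)
= t y(t)`. The singular equation becomes `y' = Q(ty)(y, y)`, an equation in the Banach space of
curves which the inverse function theorem solves (`exists_isTrajectoryFamily`). Continuity of `w`
needs no estimate of high derivatives of `Pf`: `u` is a weak limit of continuous functions, and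
Banach–Steinhaus passes to the limit (`exists_topCurrent_comp`).

Sphere. Contraction does not enlarge the wavefront set, and `τ dQ(x)` vanishes on `x` when `Q(x) =
0`, whereas a nonzero conormal of the sphere at `x` does not. For smooth forms, pairings with the
differentials of radial cutoffs `χ_k` which approach the indicator function of the ball tend to
minus the integral over the sphere; for the contraction of `u` all these pairings are equal. The
limits in `k` and along a sequence converging in `𝓓'_Γ` can be exchanged because of
`exists_shell_estimate`: the pairings with `d(χ_k - χ_l)` are bounded by the volume of a thin shell,
uniformly along the sequence. On the Fourier side, near the normal direction the currents decay
uniformly since `Γ` avoids the conormals; in the other directions the radial function decays, by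
integration by parts along rotations (`exists_oscillatory_bound`), and the currents grow at most
polynomially, uniformly by Banach–Steinhaus. Approximating smooth forms exist by mollification
(`exists_tendstoHormander`). -/

noncomputable section

namespace Residue

/-! ### Smooth functions supported in a compact set form a barrelled space -/

section Barrelled

variable {E F : Type*} [NormedAddCommGroup E] [NormedSpace ℝ E] [NormedAddCommGroup F]
  [NormedSpace ℝ F] {K : Compacts E}

-- Recording all derivatives embeds the space uniformly in a countable product of Banach spaces of
-- bounded continuous functions. The range is closed, because uniform limits of the derivatives form
-- a Taylor series of the limit function.
open ContDiffMapSupportedIn in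
instance instCompleteSpaceContDiffMapSupportedIn [CompleteSpace F] :
    CompleteSpace 𝓓_{K}(E, F) := by
  have hemb := isUniformEmbedding_pi_structureMapCLM (E := E) (F := F) (n := ⊤) (K := K) ℝ
  rw [completeSpace_iff_isComplete_range hemb.isUniformInducing]
  refine IsClosed.isComplete (isClosed_of_closure_subset fun g hg ↦ ?_)
  obtain ⟨x, hx, hlim⟩ := mem_closure_iff_seq_limit.1 hg
  choose f hf using hx
  have hunif : ∀ i, TendstoUniformly (fun n y ↦ iteratedFDeriv ℝ i (f n) y) (g i) atTop := by
    intro i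
    have h1 := BoundedContinuousFunction.tendsto_iff_tendstoUniformly.1
      ((continuous_apply i).continuousAt.tendsto.comp hlim)
    have h2 : (fun n y ↦ iteratedFDeriv ℝ i (f n) y) =
        fun n ↦ ⇑(((fun p : (i : ℕ) → BoundedContinuousFunction E (E [×i]→L[ℝ] F) ↦ p i) ∘ x) n) := by
      funext n
      rw [Function.comp_apply, ← hf n]
      exact (structureMapCLM_top_apply ℝ (f n)).symm
    rw [h2]
    exact h1
  set G : E → F := fun y ↦ (g 0 y).curry0
  have hT : HasFTaylorSeriesUpTo ∞ G (fun y i ↦ g i y) := by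
    refine ⟨fun y ↦ rfl, fun i _ y ↦ ?_, fun i _ ↦ (g i).continuous⟩
    have hL : UniformContinuous (continuousMultilinearCurryLeftEquiv ℝ (fun _ : Fin (i + 1) ↦ E) F) :=
      (continuousMultilinearCurryLeftEquiv ℝ (fun _ : Fin (i + 1) ↦ E) F).isometry.uniformContinuous
    refine hasFDerivAt_of_tendstoUniformly
      (f := fun n y ↦ iteratedFDeriv ℝ i (f n) y)
      (f' := fun n y ↦ (iteratedFDeriv ℝ (i + 1) (f n) y).curryLeft) (l := atTop)
      (hL.comp_tendstoUniformly (hunif (i + 1))) (fun n y ↦ ?_)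
      (fun y ↦ (hunif i).tendsto_at y) y
    exact ((f n).contDiff.ftaylorSeries.fderiv i (by exact_mod_cast WithTop.coe_lt_top _) y)
  have hG : ContDiff ℝ ∞ G := hT.contDiff
  have hz : EqOn G 0 (K : Set E)ᶜ := by
    intro y hy
    have h1 := (hunif 0).tendsto_at y
    have h2 : ∀ n, iteratedFDeriv ℝ 0 (f n) y = 0 := fun n ↦
      (f n).iteratedFDeriv_zero_on_compl hy
    simp only [h2] at h1
    have h3 := tendsto_nhds_unique h1 tendsto_const_nhds
    simp [G, h3]
  refine ⟨⟨G, hG, hz⟩, ?_⟩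
  ext i y : 2
  have h4 := hT.eq_iteratedFDeriv (m := i) (by exact_mod_cast le_top) y
  simp only [ContinuousLinearMap.coe_pi', structureMapCLM_top_apply]
  exact h4.symm

/-- A complete space with countably generated uniformity is a Baire space, hence barrelled. This is
what makes Banach–Steinhaus available for currents. -/
instance instBarrelledContDiffMapSupportedIn [CompleteSpace F] [NormedSpace ℂ F]
    [IsScalarTower ℝ ℂ F] : BarrelledSpace ℂ 𝓓_{K}(E, F) := by
  have : (uniformity 𝓓_{K}(E, F)).IsCountablyGenerated := by
    have hemb := ContDiffMapSupportedIn.isUniformEmbedding_pi_structureMapCLM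
      (E := E) (F := F) (n := ⊤) (K := K) ℝ
    rw [← hemb.isUniformInducing.comap_uniformity]
    infer_instance
  infer_instance

open ContDiffMapSupportedIn in
/-- The uniform boundedness principle for functionals on smooth functions supported in `K`. -/
theorem exists_seminorm_bound_of_pointwise_bounded [CompleteSpace F] [NormedSpace ℂ F]
    [IsScalarTower ℝ ℂ F] {ι : Type*} (T : ι → 𝓓_{K}(E, F) →L[ℂ] ℂ)
    (hT : ∀ f, ∃ C, ∀ j, ‖T j f‖ ≤ C) :
    ∃ (N : ℕ) (C : ℝ), 0 ≤ C ∧ ∀ j (f : 𝓓_{K}(E, F)) (B : ℝ), 0 ≤ B →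
      (∀ k ≤ N, ∀ x ∈ K, ‖iteratedFDeriv ℝ k f x‖ ≤ B) → ‖T j f‖ ≤ C * B := by
  have hequi : UniformEquicontinuous (DFunLike.coe ∘ T) := by
    refine (norm_withSeminorms ℂ ℂ).banach_steinhaus fun _ f ↦ ?_
    obtain ⟨C, hC⟩ := hT f
    exact ⟨C, by rintro _ ⟨j, rfl⟩; exact hC j⟩
  have h := (WithSeminorms.uniformEquicontinuous_iff_exists_continuous_seminorm
    (norm_withSeminorms ℂ ℂ) (fun j ↦ (T j : 𝓓_{K}(E, F) →ₗ[ℂ] ℂ))).1 hequi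
  obtain ⟨p, hp, hle⟩ := h 0
  obtain ⟨s, C, -, hC⟩ := Seminorm.bound_of_continuous
    (ContDiffMapSupportedIn.withSeminorms ℂ E F ⊤ K) p hp
  -- The dominating continuous seminorm involves only the finitely many orders in `s`; `N` is the
  -- largest of them.
  refine ⟨s.sup id, C, C.2, fun j f B hB hf ↦ ?_⟩
  calc ‖T j f‖ ≤ p f := hle j f
    _ ≤ (C • s.sup (ContDiffMapSupportedIn.seminorm ℂ E F ⊤ K)) f := hC f
    _ = C * (s.sup (ContDiffMapSupportedIn.seminorm ℂ E F ⊤ K)) f := rfl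
    _ ≤ C * B := by
        gcongr
        refine Seminorm.finset_sup_apply_le hB fun i hi ↦ ?_
        rw [ContDiffMapSupportedIn.seminorm_top_le_iff ℂ hB]
        exact fun x hx ↦ hf i (Finset.le_sup (f := id) hi) x hx

end Barrelled

/-! ### Products of test functions with smooth functions -/

/-- The complex vector space of smooth functions on `ℝⁿ`. -/
def SmoothFun (m : ℕ) : Submodule ℂ (Space m → ℂ) where
  carrier := {f | ContDiff ℝ ∞ f}
  add_mem' {f g} (hf : ContDiff ℝ ∞ f) (hg : ContDiff ℝ ∞ g) := hf.add hg
  zero_mem' := (contDiff_const : ContDiff ℝ ∞ fun _ : Space m ↦ (0 : ℂ))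
  smul_mem' _ f (hf : ContDiff ℝ ∞ f) := contDiff_const.mul hf

theorem SmoothFun.contDiff {m : ℕ} (f : SmoothFun m) : ContDiff ℝ ∞ (f : Space m → ℂ) := f.2

section Multiplication

variable {m : ℕ} {Ω : Opens (Space m)} {F : Type} [NormedAddCommGroup F] [NormedSpace ℝ F]
  [NormedSpace ℂ F] [IsScalarTower ℝ ℂ F]

/-- The test function `x ↦ f(x) φ(x) v`, as a linear function of the smooth function `f`. -/
def smulTest (φ : TestFun Ω) (v : F) : SmoothFun m →ₗ[ℂ] 𝓓(Ω, F) where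
  toFun f :=
    { toFun := fun x ↦ ((f : Space m → ℂ) x * φ x) • v
      contDiff' := ((SmoothFun.contDiff f).mul φ.contDiff).smul contDiff_const
      hasCompactSupport' :=
        φ.hasCompactSupport.mono' (fun x hx ↦ subset_tsupport _ (fun h ↦ hx (by simp [h])))
      tsupport_subset' :=
        (closure_mono (Function.support_subset_iff'.2 fun x hx ↦ by
          simp [Function.notMem_support.1 hx])).trans φ.tsupport_subset }
  map_add' f g := by
    ext x
    exact (congrArg (· • v) (add_mul _ _ _)).trans (add_smul _ _ _)
  map_smul' c f := by
    ext x
    exact (congrArg (· • v) (mul_assoc _ _ _)).trans (mul_smul _ _ _)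

@[simp]
theorem smulTest_apply (φ : TestFun Ω) (v : F) (f : SmoothFun m) (x : Space m) :
    smulTest φ v f x = ((f : Space m → ℂ) x * φ x) • v := rfl

/-- A pointwise bounded family of distributions is bounded, on the multiples of a test function `φ`,
by finitely many derivatives on the support of `φ`, uniformly in the family. -/
theorem exists_bound_smulTest [CompleteSpace F] {ι : Type*} (T : ι → 𝓓(Ω, F) →L[ℂ] ℂ)
    (hT : ∀ α, ∃ C, ∀ j, ‖T j α‖ ≤ C) (φ : TestFun Ω) (v : F) :
    ∃ (N : ℕ) (C : ℝ), 0 ≤ C ∧ ∀ j (f : SmoothFun m) (B : ℝ), 0 ≤ B →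
      (∀ k ≤ N, ∀ x ∈ tsupport φ, ‖iteratedFDeriv ℝ k (f : Space m → ℂ) x‖ ≤ B) →
        ‖T j (smulTest φ v f)‖ ≤ C * B := by
  set K : Compacts (Space m) := ⟨tsupport φ, φ.hasCompactSupport⟩
  have hK : (K : Set (Space m)) ⊆ Ω := φ.tsupport_subset
  obtain ⟨N, C, hC, h⟩ := exists_seminorm_bound_of_pointwise_bounded
    (fun j ↦ (T j).comp (TestFunction.ofSupportedInCLM ℂ hK : 𝓓_{K}(Space m, F) →L[ℂ] 𝓓(Ω, F)))
    (fun f ↦ hT _)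
  set g : Space m → F := fun x ↦ φ x • v
  have hg : ContDiff ℝ ∞ g := φ.contDiff.smul contDiff_const
  have hgc : ∀ k, ∃ D, ∀ x ∈ tsupport φ, ‖iteratedFDeriv ℝ k g x‖ ≤ D := fun k ↦
    φ.hasCompactSupport.exists_bound_of_continuousOn
      (hg.continuous_iteratedFDeriv (by exact_mod_cast le_top)).continuousOn
  choose D hD using hgc
  have hD0 : ∀ k, ∀ x ∈ tsupport φ, ‖iteratedFDeriv ℝ k g x‖ ≤ |D k| := fun k x hx ↦
    (hD k x hx).trans (le_abs_self _)
  -- The Leibniz constants of all orders up to `N` together, so that one constant serves every `k`.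
  set D' : ℝ := ∑ k ∈ Finset.range (N + 1), ∑ i ∈ Finset.range (k + 1), (k.choose i : ℝ) * |D (k - i)|
  have hD' : 0 ≤ D' := by positivity
  refine ⟨N, C * D', by positivity, fun j f B hB hf ↦ ?_⟩
  set fK : 𝓓_{K}(Space m, F) := .of_support_subset (smulTest φ v f).contDiff
    (fun x hx ↦ subset_tsupport _ (fun h ↦ hx (by simp [h])))
  have h1 := h j fK (D' * B) (by positivity) (fun k hk x hx ↦ ?_)
  · rw [mul_assoc]; exact h1
  · have hco : (fK : Space m → F) = fun x ↦ (f : Space m → ℂ) x • g x := by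
      funext y
      exact mul_smul _ _ _
    rw [hco]
    refine (norm_iteratedFDeriv_smul_le (N := ∞) (SmoothFun.contDiff f) hg x (by exact_mod_cast le_top)).trans ?_
    calc _ ≤ ∑ i ∈ Finset.range (k + 1), (k.choose i : ℝ) * |D (k - i)| * B := by
          refine Finset.sum_le_sum fun i hi ↦ ?_
          have h2 := hf i ((Finset.mem_range_succ_iff.1 hi).trans hk) x hx
          have h3 := hD0 (k - i) x hx
          calc _ ≤ (k.choose i : ℝ) * B * |D (k - i)| := by gcongr
            _ = _ := by ring
      _ = (∑ i ∈ Finset.range (k + 1), (k.choose i : ℝ) * |D (k - i)|) * B := by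
          rw [Finset.sum_mul]
      _ ≤ D' * B := by
          gcongr
          exact Finset.single_le_sum
            (f := fun k ↦ ∑ i ∈ Finset.range (k + 1), (k.choose i : ℝ) * |D (k - i)|)
            (fun _ _ ↦ by positivity) (Finset.mem_range_succ_iff.2 hk)

end Multiplication

/-! ### Fourier representation of the pairing with a distribution -/

/-- The covector `2π ⟨ξ, ·⟩`. -/
def cov {m : ℕ} (ξ : Space m) : Covector m := (2 * Real.pi) • innerSL ℝ ξ

theorem cov_apply {m : ℕ} (ξ x : Space m) : cov ξ x = 2 * Real.pi * inner ℝ ξ x := by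
  simp [cov]

/-- The exponential `x ↦ e^{-2πi ⟨ξ, x⟩}`. -/
def osc {m : ℕ} (ξ : Space m) : SmoothFun m :=
  ⟨fun x ↦ Complex.exp (-Complex.I * (cov ξ x : ℂ)), by
    have h : ContDiff ℝ ∞ fun x : Space m ↦ -Complex.I * (cov ξ x : ℂ) :=
      contDiff_const.mul (Complex.ofRealCLM.contDiff.comp (cov ξ).contDiff)
    exact h.cexp⟩

theorem osc_apply {m : ℕ} (ξ x : Space m) :
    (osc ξ : Space m → ℂ) x = Complex.exp (-Complex.I * (cov ξ x : ℂ)) := rfl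

theorem osc_eq_fourierChar {m : ℕ} (ξ x : Space m) :
    (osc ξ : Space m → ℂ) x = (Real.fourierChar (-inner ℝ ξ x) : ℂ) := by
  rw [osc_apply, cov_apply, Real.fourierChar_apply]
  push_cast
  ring_nf

theorem norm_osc {m : ℕ} (ξ x : Space m) : ‖(osc ξ : Space m → ℂ) x‖ = 1 := by
  rw [osc_eq_fourierChar]
  exact Circle.norm_coe _

/-- The factor `2π` in `cov` reconciles the exponential `e^{-iη(x)}` of wavefront sets with the
exponential `e^{-2πi⟨ξ, x⟩}` of Mathlib's Fourier transform. -/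
theorem localFourier_cov {m : ℕ} {Ω : Opens (Space m)} {F : Type} [NormedAddCommGroup F]
    [NormedSpace ℝ F] [NormedSpace ℂ F] [IsScalarTower ℝ ℂ F] (T : 𝓓(Ω, F) →L[ℂ] ℂ)
    (φ : TestFun Ω) (v : F) (ξ : Space m) :
    localFourier T φ v (cov ξ) = T (smulTest φ v (osc ξ)) := rfl

/-- Each differentiation of an exponential multiplies it by a constant linear form. The multilinear
form is written as in the formula for the derivatives of a Fourier transform, with which it is
compared below. -/
theorem iteratedFDeriv_osc {m : ℕ} (ξ : Space m) (k : ℕ) :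
    iteratedFDeriv ℝ k (osc ξ : Space m → ℂ) = fun x ↦ (osc ξ : Space m → ℂ) x •
      VectorFourier.fourierPowSMulRight (innerSL ℝ) (fun _ ↦ (1 : ℂ)) ξ k := by
  induction k with
  | zero =>
    ext x w
    simp [VectorFourier.fourierPowSMulRight_apply]
  | succ k ih =>
    ext x w
    rw [iteratedFDeriv_succ_apply_left, ih]
    have hd : HasFDerivAt (osc ξ : Space m → ℂ)
        ((osc ξ : Space m → ℂ) x • (-Complex.I • (Complex.ofRealCLM.comp (cov ξ)))) x := by
      have := ((Complex.ofRealCLM.comp (cov ξ)).hasFDerivAt (x := x)).const_mul (-Complex.I)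
      exact this.cexp
    rw [(hd.smul_const _).fderiv]
    simp only [VectorFourier.fourierPowSMulRight_apply, smul_apply,
      ContinuousLinearMap.smulRight_apply, ContinuousLinearMap.comp_apply, cov_apply, Complex.ofRealCLM_apply, smul_eq_mul,
      Fin.prod_univ_succ, Fin.tail_def]
    have h0 : innerSL ℝ ξ (w 0) = inner ℝ ξ (w 0) := rfl
    simp [h0]
    ring

/-- A linear functional bounded by the norm of a linear map factors through it. -/
theorem exists_dual_factorization {X Y : Type*} [AddCommGroup X] [Module ℂ X]
    [NormedAddCommGroup Y] [NormedSpace ℂ Y] (J : X →ₗ[ℂ] Y) (A : X →ₗ[ℂ] ℂ) (C : ℝ)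
    (h : ∀ f, ‖A f‖ ≤ C * ‖J f‖) : ∃ ℓ : Y →L[ℂ] ℂ, ∀ f, ℓ (J f) = A f := by
  -- The bound forces `A` to vanish where `J` does, so `A` descends to a bounded functional on the
  -- range of `J`, and Hahn–Banach extends that functional.
  have hker : LinearMap.ker J ≤ LinearMap.ker A := fun f hf ↦ by
    have := h f
    rw [LinearMap.mem_ker.1 hf, norm_zero, mul_zero, norm_le_zero_iff] at this
    exact this
  set ℓ₀ : LinearMap.range J →ₗ[ℂ] ℂ :=
    ((LinearMap.ker J).liftQ A hker).comp J.quotKerEquivRange.symm.toLinearMap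
  have hℓ₀ : ∀ f, ℓ₀ ⟨J f, LinearMap.mem_range_self J f⟩ = A f := fun f ↦ by
    simp [ℓ₀, LinearMap.quotKerEquivRange_symm_apply_image J f (LinearMap.mem_range_self J f)]
  obtain ⟨ℓ, hℓ, -⟩ := exists_extension_norm_eq (LinearMap.range J) (ℓ₀.mkContinuous C (by
    rintro ⟨_, f, rfl⟩
    rw [hℓ₀]
    exact h f))
  exact ⟨ℓ, fun f ↦ by rw [← hℓ₀ f]; exact hℓ ⟨J f, LinearMap.mem_range_self J f⟩⟩

/-! ### Jets along a compact set: a Banach space in which Fourier inversion converges. -/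

section Jets

set_option synthInstance.maxHeartbeats 200000

variable {m : ℕ} (K : Set (Space m)) [CompactSpace K] (N : ℕ)

/-- The jets of order `N` along `K`. -/
def JetSpace : Type := (k : Fin (N + 1)) → C(K, Space m [×(k : ℕ)]→L[ℝ] ℂ)

instance : NormedAddCommGroup (JetSpace K N) :=
  inferInstanceAs (NormedAddCommGroup ((k : Fin (N + 1)) → C(K, Space m [×(k : ℕ)]→L[ℝ] ℂ)))

instance : NormedSpace ℂ (JetSpace K N) :=
  inferInstanceAs (NormedSpace ℂ ((k : Fin (N + 1)) → C(K, Space m [×(k : ℕ)]→L[ℝ] ℂ)))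

instance : CompleteSpace (JetSpace K N) :=
  inferInstanceAs (CompleteSpace ((k : Fin (N + 1)) → C(K, Space m [×(k : ℕ)]→L[ℝ] ℂ)))

/-- The derivative of order `k` of a jet at a point. -/
def JetSpace.eval {K : Set (Space m)} [CompactSpace K] {N : ℕ} (k : Fin (N + 1)) (x : K) :
    JetSpace K N →L[ℂ] Space m [×(k : ℕ)]→L[ℝ] ℂ :=
  (ContinuousMap.evalCLM ℂ x).comp (ContinuousLinearMap.proj (R := ℂ)
    (φ := fun k : Fin (N + 1) ↦ C(K, Space m [×(k : ℕ)]→L[ℝ] ℂ)) k)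

variable {K N} in
theorem JetSpace.ext {a b : JetSpace K N} (h : ∀ k x, eval k x a = eval k x b) : a = b :=
  funext fun k ↦ ContinuousMap.ext fun x ↦ h k x

variable {K N} in
theorem JetSpace.norm_le {a : JetSpace K N} {C : ℝ} (hC : 0 ≤ C) :
    ‖a‖ ≤ C ↔ ∀ k x, ‖eval k x a‖ ≤ C :=
  (pi_norm_le_iff_of_nonneg hC).trans
    (forall_congr' fun k ↦ ContinuousMap.norm_le (a k) hC)

/-- The jet of order `N` of a smooth function along `K`. -/
def jet : SmoothFun m →ₗ[ℂ] JetSpace K N where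
  toFun f k := ⟨fun x ↦ iteratedFDeriv ℝ k (f : Space m → ℂ) x,
    ((SmoothFun.contDiff f).continuous_iteratedFDeriv
      (by exact_mod_cast le_top)).comp continuous_subtype_val⟩
  map_add' f g := JetSpace.ext fun k x ↦
    iteratedFDeriv_add_apply ((SmoothFun.contDiff f).of_le (by exact_mod_cast le_top)).contDiffAt
      ((SmoothFun.contDiff g).of_le (by exact_mod_cast le_top)).contDiffAt
  map_smul' c f := JetSpace.ext fun k x ↦
    iteratedFDeriv_const_smul_apply
      ((SmoothFun.contDiff f).of_le (by exact_mod_cast le_top)).contDiffAt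

theorem eval_jet (f : SmoothFun m) (k : Fin (N + 1)) (x : K) :
    JetSpace.eval k x (jet K N f) = iteratedFDeriv ℝ k (f : Space m → ℂ) x := rfl

theorem norm_iteratedFDeriv_le_norm_jet (f : SmoothFun m) {k : ℕ} (hk : k ≤ N) {x : Space m}
    (hx : x ∈ K) : ‖iteratedFDeriv ℝ k (f : Space m → ℂ) x‖ ≤ ‖jet K N f‖ := by
  have h := (JetSpace.norm_le (norm_nonneg (jet K N f))).1 le_rfl ⟨k, Nat.lt_succ_iff.2 hk⟩ ⟨x, hx⟩
  rwa [eval_jet] at h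

/-- Joint continuity of the derivatives in `(ξ, x)` is enough, by currying into the uniform topology
over the compact set. -/
theorem continuous_jet_osc : Continuous fun ξ : Space m ↦ jet K N (osc ξ) := by
  refine continuous_pi (A := fun k : Fin (N + 1) ↦ C(K, Space m [×(k : ℕ)]→L[ℝ] ℂ)) fun k ↦ ?_
  have h : Continuous fun p : Space m × K ↦ iteratedFDeriv ℝ k (osc p.1 : Space m → ℂ) p.2 := by
    simp only [iteratedFDeriv_osc]
    have h1 : Continuous fun _ : Space m ↦ (1 : ℂ) := continuous_const
    have h2 : Continuous fun p : Space m × K ↦ (osc p.1 : Space m → ℂ) p.2 := by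
      simp only [osc_apply, cov_apply]
      exact Complex.continuous_exp.comp (continuous_const.mul (Complex.continuous_ofReal.comp
        (continuous_const.mul (continuous_fst.inner (continuous_subtype_val.comp continuous_snd)))))
    exact h2.smul ((h1.fourierPowSMulRight (innerSL ℝ) k).comp continuous_fst)
  exact (ContinuousMap.curry ⟨_, h⟩).continuous

theorem norm_jet_osc_le (ξ : Space m) :
    ‖jet K N (osc ξ)‖ ≤ (2 * Real.pi) ^ N * (1 + ‖ξ‖) ^ N := by
  refine (JetSpace.norm_le (by positivity)).2 fun k x ↦ ?_
  rw [eval_jet, iteratedFDeriv_osc, norm_smul, norm_osc, one_mul]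
  refine (VectorFourier.norm_fourierPowSMulRight_le (innerSL ℝ) _ ξ k).trans ?_
  have h1 : ‖(innerSL ℝ : Space m →L[ℝ] Space m →L[ℝ] ℝ)‖ ≤ 1 := norm_innerSL_le ℝ
  have hk : (k : ℕ) ≤ N := Nat.lt_succ_iff.1 k.2
  have hpi : 1 ≤ 2 * Real.pi := by linarith [Real.pi_gt_three]
  calc _ ≤ (2 * Real.pi * 1) ^ (k : ℕ) * ‖ξ‖ ^ (k : ℕ) * ‖(1 : ℂ)‖ := by gcongr
    _ ≤ (2 * Real.pi) ^ (k : ℕ) * (1 + ‖ξ‖) ^ (k : ℕ) := by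
      rw [norm_one, mul_one, mul_one]
      gcongr
      linarith
    _ ≤ _ := by
      gcongr
      · linarith [norm_nonneg ξ]

open FourierTransform in
/-- Fourier inversion for the jets of a compactly supported smooth function. -/
theorem hasIntegral_fourierInv_smul_jet_osc (f : SmoothFun m)
    (hf : HasCompactSupport (f : Space m → ℂ)) :
    (Integrable fun ξ ↦ 𝓕⁻ (f : Space m → ℂ) ξ • jet K N (osc ξ)) ∧
      ∫ ξ, 𝓕⁻ (f : Space m → ℂ) ξ • jet K N (osc ξ) = jet K N f := by
  set s : SchwartzMap (Space m) ℂ := hf.toSchwartzMap (SmoothFun.contDiff f)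
  set g : SchwartzMap (Space m) ℂ := 𝓕⁻ s
  have hg : (𝓕⁻ (f : Space m → ℂ)) = g := (SchwartzMap.fourierInv_coe s).symm
  have hfg : 𝓕 (g : Space m → ℂ) = f := by
    rw [← SchwartzMap.fourier_coe]
    simp [g, s]
    rfl
  -- The jets grow like `(1 + ‖ξ‖)^N`, and the Schwartz function `g` absorbs this growth.
  have hint : Integrable fun ξ ↦ g ξ • jet K N (osc ξ) := by
    refine Integrable.mono' (g := fun ξ ↦ (2 * Real.pi) ^ N * (2 ^ N * (‖g ξ‖ + ‖ξ‖ ^ N * ‖g ξ‖)))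
      (((g.integrable.norm.add (g.integrable_pow_mul volume N)).const_mul _).const_mul _)
      (g.continuous.smul (continuous_jet_osc K N)).aestronglyMeasurable
      (Eventually.of_forall fun ξ ↦ ?_)
    rw [norm_smul]
    have h2 : (1 + ‖ξ‖) ^ N ≤ 2 ^ N * (1 + ‖ξ‖ ^ N) := by
      refine (add_pow_le zero_le_one (norm_nonneg ξ) N).trans ?_
      rw [one_pow]
      gcongr
      · norm_num
      · omega
    calc ‖g ξ‖ * ‖jet K N (osc ξ)‖ ≤ ‖g ξ‖ * ((2 * Real.pi) ^ N * (2 ^ N * (1 + ‖ξ‖ ^ N))) := by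
          gcongr
          exact (norm_jet_osc_le K N ξ).trans (by gcongr)
      _ = _ := by ring
  rw [hg]
  refine ⟨hint, ?_⟩
  -- Evaluation at one derivative and one point commutes with the Bochner integral, which leaves the
  -- formula for differentiation under the Fourier integral.
  refine JetSpace.ext fun k x ↦ ?_
  rw [← (JetSpace.eval k x).integral_comp_comm hint, eval_jet, ← hfg,
    Real.iteratedFDeriv_fourier (N := ⊤) (fun n _ ↦ g.integrable_pow_mul volume n)
      g.continuous.aestronglyMeasurable le_top, Real.fourier_eq]
  refine integral_congr_ae (Eventually.of_forall fun ξ ↦ ?_)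
  simp only [map_smul, eval_jet, iteratedFDeriv_osc, osc_eq_fourierChar]
  ext w
  simp only [VectorFourier.fourierPowSMulRight_apply, smul_apply, smul_eq_mul, Circle.smul_def,
    Complex.real_smul, mul_one]
  ring

end Jets

open FourierTransform in
/-- The pairing of a distribution with `φ f v` as a superposition of pairings with exponentials. -/
theorem apply_smulTest_eq_integral {m : ℕ} {Ω : Opens (Space m)} {F : Type} [NormedAddCommGroup F]
    [NormedSpace ℝ F] [NormedSpace ℂ F] [IsScalarTower ℝ ℂ F] [CompleteSpace F]
    (T : 𝓓(Ω, F) →L[ℂ] ℂ) (φ : TestFun Ω) (v : F) :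
    (Continuous fun ξ ↦ localFourier T φ v (cov ξ)) ∧
      ∀ f : SmoothFun m, HasCompactSupport (f : Space m → ℂ) →
        T (smulTest φ v f) = ∫ ξ, 𝓕⁻ (f : Space m → ℂ) ξ * localFourier T φ v (cov ξ) := by
  obtain ⟨N, C, hC, h⟩ := exists_bound_smulTest (fun _ : Unit ↦ T) (fun α ↦ ⟨‖T α‖, fun _ ↦ le_rfl⟩)
    φ v
  have : CompactSpace (tsupport φ) := isCompact_iff_compactSpace.1 φ.hasCompactSupport
  -- Having finite order on the support of `φ`, the distribution factors through a bounded
  -- functional of jets. Such a functional commutes with the Fourier integral.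
  obtain ⟨ℓ, hℓ⟩ := exists_dual_factorization (jet (tsupport φ) N)
    ((T : 𝓓(Ω, F) →ₗ[ℂ] ℂ).comp (smulTest φ v)) C (fun f ↦
      h () f _ (norm_nonneg _) fun k hk x hx ↦
        norm_iteratedFDeriv_le_norm_jet (tsupport φ) N f hk hx)
  have hosc : ∀ ξ, localFourier T φ v (cov ξ) = ℓ (jet (tsupport φ) N (osc ξ)) := fun ξ ↦
    (hℓ (osc ξ)).symm
  refine ⟨?_, fun f hf ↦ ?_⟩
  · simp only [hosc]
    exact ℓ.continuous.comp (continuous_jet_osc _ N)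
  · obtain ⟨hint, heq⟩ := hasIntegral_fourierInv_smul_jet_osc (tsupport φ) N f hf
    rw [show T (smulTest φ v f) = ℓ (jet (tsupport φ) N f) from (hℓ f).symm, ← heq,
      ← ℓ.integral_comp_comm hint]
    simp only [hosc, map_smul, smul_eq_mul]

/-- The local Fourier transforms of a pointwise bounded family of distributions have polynomial
growth, uniformly in the family. -/
theorem exists_polynomial_bound_localFourier {m : ℕ} {Ω : Opens (Space m)} {F : Type}
    [NormedAddCommGroup F] [NormedSpace ℝ F] [NormedSpace ℂ F] [IsScalarTower ℝ ℂ F]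
    [CompleteSpace F] {ι : Type*} (T : ι → 𝓓(Ω, F) →L[ℂ] ℂ) (hT : ∀ α, ∃ C, ∀ j, ‖T j α‖ ≤ C)
    (φ : TestFun Ω) (v : F) :
    ∃ (N : ℕ) (C : ℝ), 0 ≤ C ∧ ∀ j ξ, ‖localFourier (T j) φ v (cov ξ)‖ ≤ C * (1 + ‖ξ‖) ^ N := by
  obtain ⟨N, C, hC, h⟩ := exists_bound_smulTest T hT φ v
  have : CompactSpace (tsupport φ) := isCompact_iff_compactSpace.1 φ.hasCompactSupport
  refine ⟨N, C * (2 * Real.pi) ^ N, by positivity, fun j ξ ↦ ?_⟩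
  rw [localFourier_cov, mul_assoc]
  refine h j (osc ξ) _ (by positivity) fun k hk x hx ↦ ?_
  exact (norm_iteratedFDeriv_le_norm_jet (tsupport φ) N (osc ξ) hk hx).trans
    (norm_jet_osc_le (tsupport φ) N ξ)

/-! ### Cutoffs and localization -/

/-- Smooth cutoff functions for a compact subset of an open set. -/
theorem exists_cutoff {m : ℕ} (Ω : Opens (Space m)) {K U : Set (Space m)} (hK : IsCompact K)
    (hU : IsOpen U) (hKU : K ⊆ U) (hUΩ : U ⊆ Ω) :
    ∃ φ : TestFun Ω, tsupport φ ⊆ U ∧ ∀ᶠ x in 𝓝ˢ K, φ x = 1 := by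
  obtain ⟨L, hL, hKL, hLU⟩ := exists_compact_between hK hU hKU
  obtain ⟨f, hf1, hf0, -⟩ := exists_contMDiffMap_one_nhds_of_subset_interior
    (n := (⊤ : ℕ∞)) (modelWithCornersSelf ℝ (Space m)) hK.isClosed hKL
  have hsupp : tsupport (fun x ↦ (f x : ℂ)) ⊆ L := by
    refine closure_minimal (fun x hx ↦ ?_) hL.isClosed
    by_contra h
    exact hx (by simp [hf0 x h])
  refine ⟨⟨fun x ↦ (f x : ℂ), Complex.ofRealCLM.contDiff.comp f.contMDiff.contDiff,
    hL.of_isClosed_subset (isClosed_tsupport _) hsupp, hsupp.trans (hLU.trans hUΩ)⟩,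
    hsupp.trans hLU, ?_⟩
  filter_upwards [hf1] with x hx
  change (f x : ℂ) = 1
  simp [hx]

/-- A property of test functions which is stable under addition and holds locally holds globally. -/
theorem testFun_induction {m : ℕ} {Ω : Opens (Space m)} {P : TestFun Ω → Prop} (φ : TestFun Ω)
    (h0 : P 0) (hadd : ∀ f g, P f → P g → P (f + g))
    (hloc : ∀ x ∈ tsupport φ, ∃ U ∈ 𝓝 x, ∀ φ' : TestFun Ω, tsupport φ' ⊆ U →
      tsupport φ' ⊆ tsupport φ → P φ') : P φ := by
  choose! U hU hP using hloc
  obtain ⟨t, ht, hcov⟩ := φ.hasCompactSupport.elim_nhds_subcover (fun x ↦ interior (U x))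
    (fun x hx ↦ interior_mem_nhds.2 (hU x hx))
  obtain ⟨f, hf⟩ := SmoothPartitionOfUnity.exists_isSubordinate (modelWithCornersSelf ℝ (Space m))
    (s := tsupport φ) (isClosed_tsupport _) (fun i : t ↦ interior (U i)) (fun _ ↦ isOpen_interior)
    (fun x hx ↦ by
      obtain ⟨i, hi, hxi⟩ := mem_iUnion₂.1 (hcov hx)
      exact mem_iUnion.2 ⟨⟨i, hi⟩, hxi⟩)
  set ψ : t → TestFun Ω := fun i ↦
    { toFun := fun x ↦ (f i x : ℂ) * φ x
      contDiff' := (Complex.ofRealCLM.contDiff.comp (f i).contMDiff.contDiff).mul φ.contDiff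
      hasCompactSupport' := φ.hasCompactSupport.mul_left
      tsupport_subset' := tsupport_mul_subset_right.trans φ.tsupport_subset }
  have hψ : ∀ i, P (ψ i) := fun i ↦ by
    refine hP i (ht i i.2) (ψ i) ?_ tsupport_mul_subset_right
    refine (tsupport_mul_subset_left (f := fun x ↦ (f i x : ℂ)) (g := φ)).trans ?_
    have h1 : tsupport (fun x ↦ (f i x : ℂ)) ⊆ tsupport (f i) :=
      closure_mono fun x hx h ↦ hx (by simp [h])
    exact h1.trans ((hf i).trans interior_subset)
  have hsum : φ = ∑ i, ψ i := by
    ext x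
    have hs : (∑ i, ψ i : TestFun Ω) x = ∑ i, ψ i x := by
      induction (Finset.univ : Finset t) using Finset.induction_on with
      | empty => simp
      | insert a s ha ih => rw [Finset.sum_insert ha, Finset.sum_insert ha, ← ih]; rfl
    rw [hs]
    change φ x = ∑ i, (f i x : ℂ) * φ x
    rw [← Finset.sum_mul]
    by_cases hx : x ∈ tsupport φ
    · have h1 := f.sum_eq_one hx
      rw [finsum_eq_sum_of_fintype] at h1
      rw [← Complex.ofReal_sum, h1]
      simp
    · simp [image_eq_zero_of_notMem_tsupport hx]
  rw [hsum]
  exact Finset.sum_induction _ P hadd h0 fun i _ ↦ hψ i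

/-! ### Rapid decay -/

/-- `g` decays rapidly on `S`. -/
def DecaysOn {m : ℕ} (g : Space m → ℂ) (S : Set (Space m)) : Prop :=
  ∀ N : ℕ, ∃ B, 0 ≤ B ∧ ∀ ξ ∈ S, (1 + ‖ξ‖) ^ N * ‖g ξ‖ ≤ B

theorem DecaysOn.mono {m : ℕ} {g : Space m → ℂ} {S S' : Set (Space m)} (h : DecaysOn g S)
    (hS : S' ⊆ S) : DecaysOn g S' := fun N ↦ by
  obtain ⟨B, hB, h⟩ := h N
  exact ⟨B, hB, fun ξ hξ ↦ h ξ (hS hξ)⟩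

theorem DecaysOn.union {m : ℕ} {g : Space m → ℂ} {S S' : Set (Space m)} (h : DecaysOn g S)
    (h' : DecaysOn g S') : DecaysOn g (S ∪ S') := fun N ↦ by
  obtain ⟨B, hB, h⟩ := h N
  obtain ⟨B', hB', h'⟩ := h' N
  exact ⟨max B B', hB.trans (le_max_left _ _), fun ξ hξ ↦ hξ.elim
    (fun hξ ↦ (h ξ hξ).trans (le_max_left _ _)) (fun hξ ↦ (h' ξ hξ).trans (le_max_right _ _))⟩

theorem DecaysOn.add {m : ℕ} {g g' : Space m → ℂ} {S : Set (Space m)} (h : DecaysOn g S)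
    (h' : DecaysOn g' S) : DecaysOn (fun ξ ↦ g ξ + g' ξ) S := fun N ↦ by
  obtain ⟨B, hB, h⟩ := h N
  obtain ⟨B', hB', h'⟩ := h' N
  refine ⟨B + B', by positivity, fun ξ hξ ↦ ?_⟩
  calc _ ≤ (1 + ‖ξ‖) ^ N * (‖g ξ‖ + ‖g' ξ‖) := by gcongr; exact norm_add_le _ _
    _ ≤ _ := by rw [mul_add]; exact add_le_add (h ξ hξ) (h' ξ hξ)

theorem DecaysOn.of_pow {m : ℕ} {g : Space m → ℂ} {S : Set (Space m)}
    (h : ∀ N : ℕ, ∃ B, ∀ ξ ∈ S, ‖ξ‖ ^ N * ‖g ξ‖ ≤ B) : DecaysOn g S := fun N ↦ by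
  obtain ⟨B, h1⟩ := h N
  obtain ⟨B', h2⟩ := h 0
  refine ⟨2 ^ N * (|B'| + |B|), by positivity, fun ξ hξ ↦ ?_⟩
  have h3 : (1 + ‖ξ‖) ^ N ≤ 2 ^ N * (1 + ‖ξ‖ ^ N) := by
    refine (add_pow_le zero_le_one (norm_nonneg ξ) N).trans ?_
    rw [one_pow]
    gcongr
    · norm_num
    · omega
  have h4 := (h1 ξ hξ).trans (le_abs_self _)
  have h5 := (h2 ξ hξ).trans (le_abs_self _)
  rw [pow_zero, one_mul] at h5
  calc _ ≤ 2 ^ N * (1 + ‖ξ‖ ^ N) * ‖g ξ‖ := by gcongr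
    _ = 2 ^ N * (‖g ξ‖ + ‖ξ‖ ^ N * ‖g ξ‖) := by ring
    _ ≤ _ := by gcongr

/-- The standard integrable weight. -/
def weight {m : ℕ} (ξ : Space m) : ℝ := (1 + ‖ξ‖) ^ (-((m + 2 : ℕ) : ℝ))

theorem weight_nonneg {m : ℕ} (ξ : Space m) : 0 ≤ weight ξ := by
  unfold weight
  positivity

theorem integrable_weight {m : ℕ} : Integrable (weight : Space m → ℝ) := by
  refine integrable_one_add_norm ?_
  rw [finrank_euclideanSpace_fin]
  push_cast
  linarith

theorem le_mul_weight {m : ℕ} {ξ : Space m} {y B : ℝ} (h : (1 + ‖ξ‖) ^ (m + 2) * y ≤ B) :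
    y ≤ B * weight ξ := by
  have h1 : (0 : ℝ) < (1 + ‖ξ‖) ^ (m + 2) := by positivity
  rw [weight, Real.rpow_neg (by positivity), Real.rpow_natCast, ← div_eq_mul_inv, le_div_iff₀ h1]
  linarith

/-- The convolution of a rapidly decreasing function with a function of polynomial growth which
decays on `S'` decays on each set `S` such that `S'` is a conic neighbourhood of `S`. -/
theorem exists_convolution_bound {m : ℕ} {a G : Space m → ℂ} {S S' : Set (Space m)} {δ : ℝ}
    (hδ : 0 < δ) (ha : DecaysOn a univ) {M : ℕ} {A : ℝ} (hA : 0 ≤ A)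
    (hG : ∀ ξ, ‖G ξ‖ ≤ A * (1 + ‖ξ‖) ^ M)
    (hS : ∀ η ∈ S, ∀ ζ, ‖η - ζ‖ ≤ δ * ‖η‖ → ζ ∈ S') (hdec : DecaysOn G S') (N : ℕ) :
    ∃ B, 0 ≤ B ∧ ∀ η ∈ S, ∀ (H : Space m → ℂ) (c : ℝ), 0 ≤ c →
      (∀ ζ, ‖H ζ‖ ≤ c * (‖a (ζ - η)‖ * ‖G ζ‖)) → (1 + ‖η‖) ^ N * ‖∫ ζ, H ζ‖ ≤ c * B := by
  -- The surplus `m + 2`, one more than the dimension, pays for the integrable weight. In the last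
  -- bound `M` more powers compensate for the growth of `G`.
  obtain ⟨B₁, hB₁, h₁⟩ := ha N
  obtain ⟨B₂, hB₂, h₂⟩ := hdec (N + (m + 2))
  obtain ⟨B₃, hB₃, h₃⟩ := ha (N + M + (m + 2))
  set k : ℝ := 1 + δ⁻¹
  have hk : 1 ≤ k := by simp only [k]; linarith [inv_pos.2 hδ]
  have key : ∀ η ∈ S, ∀ ζ, (1 + ‖η‖) ^ N * (‖a (ζ - η)‖ * ‖G ζ‖) ≤
      B₁ * B₂ * weight ζ + k ^ (N + M) * A * B₃ * weight (ζ - η) := by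
    intro η hη ζ
    have hw₁ := weight_nonneg ζ
    have hw₂ := weight_nonneg (ζ - η)
    -- For `ζ` close to `η` relative to `‖η‖`, the point `ζ` lies in `S'` and `G` decays. Otherwise
    -- `‖η‖` and `‖ζ‖` are both at most a constant times `‖ζ - η‖`, and the decay of `a` suffices.
    by_cases hζ : ‖η - ζ‖ ≤ δ * ‖η‖
    · have h4 : 1 + ‖η‖ ≤ (1 + ‖ζ - η‖) * (1 + ‖ζ‖) := by
        have : ‖η‖ ≤ ‖ζ - η‖ + ‖ζ‖ := by
          calc ‖η‖ = ‖ζ - (ζ - η)‖ := by congr 1; abel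
            _ ≤ ‖ζ‖ + ‖ζ - η‖ := norm_sub_le _ _
            _ = _ := add_comm _ _
        nlinarith [norm_nonneg ζ, norm_nonneg (ζ - η), mul_nonneg (norm_nonneg ζ) (norm_nonneg (ζ - η))]
      have h5 : (1 + ‖ζ‖) ^ N * ‖G ζ‖ ≤ B₂ * weight ζ := by
        refine le_mul_weight ?_
        have := h₂ ζ (hS η hη ζ hζ)
        rw [pow_add] at this
        linarith
      calc _ ≤ ((1 + ‖ζ - η‖) * (1 + ‖ζ‖)) ^ N * (‖a (ζ - η)‖ * ‖G ζ‖) := by gcongr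
        _ = ((1 + ‖ζ - η‖) ^ N * ‖a (ζ - η)‖) * ((1 + ‖ζ‖) ^ N * ‖G ζ‖) := by rw [mul_pow]; ring
        _ ≤ B₁ * (B₂ * weight ζ) := by
          gcongr
          exact h₁ _ (mem_univ _)
        _ ≤ _ := by
          have : 0 ≤ k ^ (N + M) * A * B₃ * weight (ζ - η) := by positivity
          linarith
    · push Not at hζ
      rw [norm_sub_rev] at hζ
      have h4 : ‖η‖ ≤ δ⁻¹ * ‖ζ - η‖ := by
        rw [inv_mul_eq_div, le_div_iff₀ hδ]
        linarith
      have h6 : ‖ζ‖ ≤ ‖ζ - η‖ + ‖η‖ := by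
        calc ‖ζ‖ = ‖(ζ - η) + η‖ := by congr 1; abel
          _ ≤ _ := norm_add_le _ _
      have h5 : 1 + ‖η‖ ≤ k * (1 + ‖ζ - η‖) := by
        simp only [k]
        nlinarith [norm_nonneg (ζ - η), inv_pos.2 hδ]
      have h7 : 1 + ‖ζ‖ ≤ k * (1 + ‖ζ - η‖) := by
        simp only [k]
        nlinarith [norm_nonneg (ζ - η), inv_pos.2 hδ]
      have h8 : (1 + ‖ζ - η‖) ^ (N + M) * ‖a (ζ - η)‖ ≤ B₃ * weight (ζ - η) := by
        refine le_mul_weight ?_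
        have := h₃ (ζ - η) (mem_univ _)
        rw [pow_add] at this
        linarith
      calc _ ≤ (k * (1 + ‖ζ - η‖)) ^ N * (‖a (ζ - η)‖ * (A * (k * (1 + ‖ζ - η‖)) ^ M)) := by
            gcongr
            exact (hG ζ).trans (by gcongr)
        _ = k ^ (N + M) * A * ((1 + ‖ζ - η‖) ^ (N + M) * ‖a (ζ - η)‖) := by
            rw [mul_pow, mul_pow, pow_add, pow_add]; ring
        _ ≤ k ^ (N + M) * A * (B₃ * weight (ζ - η)) := by gcongr
        _ ≤ _ := by
          have : 0 ≤ B₁ * B₂ * weight ζ := by positivity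
          linarith
  set W : ℝ := ∫ ξ : Space m, weight ξ
  have hW : 0 ≤ W := integral_nonneg weight_nonneg
  refine ⟨B₁ * B₂ * W + k ^ (N + M) * A * B₃ * W, by positivity, fun η hη H c hc hH ↦ ?_⟩
  have hpos : (0 : ℝ) < (1 + ‖η‖) ^ N := by positivity
  have hi₂ : Integrable fun ζ : Space m ↦ weight (ζ - η) := integrable_weight.comp_sub_right η
  have h9 : ‖∫ ζ, H ζ‖ ≤ ∫ ζ, c * ((1 + ‖η‖) ^ N)⁻¹ *
      (B₁ * B₂ * weight ζ + k ^ (N + M) * A * B₃ * weight (ζ - η)) := by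
    refine norm_integral_le_of_norm_le (((integrable_weight.const_mul _).add
      (hi₂.const_mul _)).const_mul _) (Eventually.of_forall fun ζ ↦ (hH ζ).trans ?_)
    rw [mul_assoc]
    refine mul_le_mul_of_nonneg_left ?_ hc
    rw [inv_mul_eq_div, le_div_iff₀ hpos]
    linarith [key η hη ζ]
  rw [integral_const_mul, integral_add (integrable_weight.const_mul _) (hi₂.const_mul _),
    integral_const_mul, integral_const_mul, integral_sub_right_eq_self] at h9
  calc _ ≤ (1 + ‖η‖) ^ N * (c * ((1 + ‖η‖) ^ N)⁻¹ *
      (B₁ * B₂ * W + k ^ (N + M) * A * B₃ * W)) := by gcongr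
    _ = _ := by field_simp

/-! ### Fourier transforms of compactly supported smooth functions -/

open FourierTransform in
theorem decaysOn_fourierInv {m : ℕ} (f : SmoothFun m) (hf : HasCompactSupport (f : Space m → ℂ)) :
    DecaysOn (𝓕⁻ (f : Space m → ℂ)) univ := by
  set s : SchwartzMap (Space m) ℂ := hf.toSchwartzMap (SmoothFun.contDiff f)
  set g : SchwartzMap (Space m) ℂ := 𝓕⁻ s
  have hg : (𝓕⁻ (f : Space m → ℂ)) = g := (SchwartzMap.fourierInv_coe s).symm
  refine DecaysOn.of_pow fun N ↦ ?_
  obtain ⟨C, -, hC⟩ := g.decay N 0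
  refine ⟨C, fun ξ _ ↦ ?_⟩
  have := hC ξ
  rwa [norm_iteratedFDeriv_zero, ← hg] at this

/-- The product of smooth functions. -/
def SmoothFun.mul {m : ℕ} (f g : SmoothFun m) : SmoothFun m :=
  ⟨fun x ↦ (f : Space m → ℂ) x * (g : Space m → ℂ) x,
    (SmoothFun.contDiff f).mul (SmoothFun.contDiff g)⟩

theorem SmoothFun.mul_apply {m : ℕ} (f g : SmoothFun m) (x : Space m) :
    (SmoothFun.mul f g : Space m → ℂ) x = (f : Space m → ℂ) x * (g : Space m → ℂ) x := rfl

/-- A test function as a smooth function. -/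
def TestFun.smooth {m : ℕ} {Ω : Opens (Space m)} (φ : TestFun Ω) : SmoothFun m := ⟨φ, φ.contDiff⟩

open FourierTransform in
theorem fourierInv_osc_mul {m : ℕ} (η : Space m) (f : SmoothFun m) (ζ : Space m) :
    𝓕⁻ (SmoothFun.mul (osc η) f : Space m → ℂ) ζ = 𝓕⁻ (f : Space m → ℂ) (ζ - η) := by
  rw [Real.fourierInv_eq, Real.fourierInv_eq]
  refine integral_congr_ae (Eventually.of_forall fun x ↦ ?_)
  simp only [SmoothFun.mul_apply, osc_eq_fourierChar, Circle.smul_def, smul_eq_mul]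
  rw [inner_sub_right, sub_eq_add_neg, AddChar.map_add_eq_mul, real_inner_comm x η]
  push_cast
  ring

/-! ### Covectors and cones -/

/-- The vector `ξ` such that `cov ξ` is a given covector. -/
def uncov {m : ℕ} (η : Covector m) : Space m :=
  (2 * Real.pi)⁻¹ • (InnerProductSpace.toDual ℝ (Space m)).symm η

@[simp]
theorem cov_uncov {m : ℕ} (η : Covector m) : cov (uncov η) = η := by
  ext x
  rw [cov_apply, uncov, inner_smul_left, InnerProductSpace.toDual_symm_apply]
  simp only [conj_trivial]
  field_simp

theorem cov_injective {m : ℕ} : Function.Injective (cov : Space m → Covector m) := fun ξ η h ↦ by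
  refine ext_inner_right ℝ fun x ↦ ?_
  have := DFunLike.congr_fun h x
  rw [cov_apply, cov_apply] at this
  exact mul_left_cancel₀ (by positivity) this

@[simp]
theorem uncov_cov {m : ℕ} (ξ : Space m) : uncov (cov ξ) = ξ := cov_injective (cov_uncov _)

theorem continuous_uncov {m : ℕ} : Continuous (uncov : Covector m → Space m) := by
  unfold uncov
  fun_prop

theorem continuous_cov {m : ℕ} : Continuous (cov : Space m → Covector m) := by
  unfold cov
  fun_prop

theorem cov_smul {m : ℕ} (t : ℝ) (ξ : Space m) : cov (t • ξ) = t • cov ξ := by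
  simp only [cov, map_smul, smul_comm t]

theorem norm_cov {m : ℕ} (ξ : Space m) : ‖cov ξ‖ = 2 * Real.pi * ‖ξ‖ := by
  rw [cov, norm_smul, innerSL_apply_norm, Real.norm_of_nonneg (by positivity)]

theorem norm_le_norm_cov {m : ℕ} (ξ : Space m) : ‖ξ‖ ≤ ‖cov ξ‖ := by
  rw [norm_cov]
  nlinarith [Real.pi_gt_three, norm_nonneg ξ]

/-- The cone generated by a set of vectors. -/
def coneHull {m : ℕ} (W : Set (Space m)) : Set (Space m) := {ξ | ∃ t : ℝ, 0 < t ∧ t • ξ ∈ W}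

theorem isOpen_coneHull {m : ℕ} {W : Set (Space m)} (hW : IsOpen W) : IsOpen (coneHull W) := by
  have : coneHull W = ⋃ t : ℝ, ⋃ _ : 0 < t, (fun ξ : Space m ↦ t • ξ) ⁻¹' W := by
    ext ξ
    simp [coneHull]
  rw [this]
  exact isOpen_iUnion fun t ↦ isOpen_iUnion fun _ ↦ hW.preimage (continuous_const_smul t)

theorem coneHull_union {m : ℕ} (W W' : Set (Space m)) :
    coneHull (W ∪ W') = coneHull W ∪ coneHull W' := by
  ext ξ
  simp only [coneHull, mem_union, mem_ofPred_eq]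
  constructor
  · rintro ⟨t, ht, h | h⟩
    exacts [Or.inl ⟨t, ht, h⟩, Or.inr ⟨t, ht, h⟩]
  · rintro (⟨t, ht, h⟩ | ⟨t, ht, h⟩)
    exacts [⟨t, ht, Or.inl h⟩, ⟨t, ht, Or.inr h⟩]

theorem subset_coneHull {m : ℕ} (W : Set (Space m)) : W ⊆ coneHull W := fun ξ hξ ↦
  ⟨1, one_pos, by simpa using hξ⟩

/-! ### Rapid decay of local Fourier transforms -/

section Decay

variable {m : ℕ} {Ω : Opens (Space m)} {F : Type} [NormedAddCommGroup F] [NormedSpace ℝ F]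
  [NormedSpace ℂ F] [IsScalarTower ℝ ℂ F]

theorem SmoothFun.hasCompactSupport_mul {m : ℕ} (f : SmoothFun m) {b : SmoothFun m}
    (hb : HasCompactSupport (b : Space m → ℂ)) :
    HasCompactSupport (SmoothFun.mul f b : Space m → ℂ) :=
  hb.mono fun x hx h ↦ hx (by rw [SmoothFun.mul_apply, h, mul_zero])

theorem smulTest_mul {φ φ' : TestFun Ω} {b : SmoothFun m}
    (h : ∀ x, φ' x = (b : Space m → ℂ) x * φ x) (v : F) (f : SmoothFun m) :
    smulTest φ' v f = smulTest φ v (SmoothFun.mul f b) := by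
  ext x
  rw [smulTest_apply, smulTest_apply, SmoothFun.mul_apply, h, mul_assoc]

open FourierTransform in
/-- Multiplication of a distribution with a smooth function convolves its Fourier transform. -/
theorem localFourier_mul [CompleteSpace F] (T : 𝓓(Ω, F) →L[ℂ] ℂ) {φ φ' : TestFun Ω}
    {b : SmoothFun m} (hb : HasCompactSupport (b : Space m → ℂ))
    (h : ∀ x, φ' x = (b : Space m → ℂ) x * φ x) (v : F) (η : Space m) :
    localFourier T φ' v (cov η) =
      ∫ ζ, 𝓕⁻ (b : Space m → ℂ) (ζ - η) * localFourier T φ v (cov ζ) := by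
  rw [localFourier_cov, smulTest_mul h,
    (apply_smulTest_eq_integral T φ v).2 _ (SmoothFun.hasCompactSupport_mul _ hb)]
  simp_rw [fourierInv_osc_mul]

theorem exists_polynomial_bound [CompleteSpace F] (T : 𝓓(Ω, F) →L[ℂ] ℂ) (φ : TestFun Ω) (v : F) :
    ∃ (N : ℕ) (C : ℝ), 0 ≤ C ∧ ∀ ξ, ‖localFourier T φ v (cov ξ)‖ ≤ C * (1 + ‖ξ‖) ^ N := by
  obtain ⟨N, C, hC, h⟩ := exists_polynomial_bound_localFourier (fun _ : Unit ↦ T)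
    (fun α ↦ ⟨‖T α‖, fun _ ↦ le_rfl⟩) φ v
  exact ⟨N, C, hC, h ()⟩

/-- Multiplying the cutoff by a smooth function convolves the transform with a rapidly decreasing
one, which costs only an arbitrarily small conic margin around the directions of decay. -/
theorem DecaysOn.localFourier_mul [CompleteSpace F] {T : 𝓓(Ω, F) →L[ℂ] ℂ} {φ φ' : TestFun Ω}
    {b : SmoothFun m} (hb : HasCompactSupport (b : Space m → ℂ))
    (h : ∀ x, φ' x = (b : Space m → ℂ) x * φ x) {v : F} {S S' : Set (Space m)} {δ : ℝ} (hδ : 0 < δ)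
    (hS : ∀ η ∈ S, ∀ ζ, ‖η - ζ‖ ≤ δ * ‖η‖ → ζ ∈ S')
    (hdec : DecaysOn (fun ξ ↦ localFourier T φ v (cov ξ)) S') :
    DecaysOn (fun ξ ↦ localFourier T φ' v (cov ξ)) S := fun N ↦ by
  obtain ⟨M, A, hA, hM⟩ := exists_polynomial_bound T φ v
  obtain ⟨B, hB, hbd⟩ := exists_convolution_bound hδ (decaysOn_fourierInv b hb) hA hM hS hdec N
  refine ⟨B, hB, fun η hη ↦ ?_⟩
  dsimp only
  rw [Residue.localFourier_mul T hb h]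
  simpa using hbd η hη _ 1 zero_le_one fun ζ ↦ by simp

/-- The quotient `φ' / φ`, which is zero off the support of `φ'`, is smooth since the denominator
does not vanish on that support. It lets decay pass from one cutoff to every smaller one. -/
theorem smooth_div {φ φ' : TestFun Ω} (h : ∀ x ∈ tsupport φ', φ x ≠ 0) :
    ∃ b : SmoothFun m, HasCompactSupport (b : Space m → ℂ) ∧
      ∀ x, φ' x = (b : Space m → ℂ) x * φ x := by
  have h0 : ∀ x ∉ tsupport φ', φ' x = 0 := fun x hx ↦ image_eq_zero_of_notMem_tsupport hx
  refine ⟨⟨fun x ↦ φ' x / φ x, show ContDiff ℝ ∞ _ from contDiff_iff_contDiffAt.2 fun x ↦ ?_⟩, ?_,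
    fun x ↦ ?_⟩
  · by_cases hx : x ∈ tsupport φ'
    · exact φ'.contDiff.contDiffAt.mul ((contDiffAt_inv ℝ (h x hx)).comp x φ.contDiff.contDiffAt)
    · refine contDiffAt_const (c := (0 : ℂ)) |>.congr_of_eventuallyEq ?_
      filter_upwards [notMem_tsupport_iff_eventuallyEq.1 hx] with y hy
      simp [hy]
  · exact φ'.hasCompactSupport.mono' fun x hx ↦ subset_tsupport _ fun h ↦ hx (by
      change φ' x / φ x = 0
      rw [h, zero_div])
  · change φ' x = φ' x / φ x * φ x
    by_cases hx : x ∈ tsupport φ'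
    · rw [div_mul_cancel₀ _ (h x hx)]
    · simp [h0 x hx]

/-- Microlocal smoothness at a point gives decay for all cutoffs near that point. -/
theorem MicroSmoothAt.exists_decaysOn [CompleteSpace F] {T : 𝓓(Ω, F) →L[ℂ] ℂ} {x₀ : Space m}
    {η₀ : Space m} (h : MicroSmoothAt T x₀ (cov η₀)) :
    ∃ U ∈ 𝓝 x₀, ∃ W ∈ 𝓝 η₀, ∀ φ : TestFun Ω, tsupport φ ⊆ U → ∀ v,
      DecaysOn (fun ξ ↦ localFourier T φ v (cov ξ)) (coneHull W) := by
  obtain ⟨φ₀, hφ₀, C, hCo, hC, hηC, hdec⟩ := h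
  obtain ⟨ε, hε, hball⟩ := Metric.mem_nhds_iff.1
    ((hCo.preimage continuous_cov).mem_nhds (show η₀ ∈ cov ⁻¹' C from hηC))
  refine ⟨{x | φ₀ x ≠ 0}, φ₀.contDiff.continuous.continuousAt.eventually_ne hφ₀,
    Metric.ball η₀ (ε / 2), Metric.ball_mem_nhds _ (by positivity), fun φ hφ v ↦ ?_⟩
  obtain ⟨b, hb, hbφ⟩ := smooth_div (φ := φ₀) (φ' := φ) fun x hx ↦ hφ hx
  have hpos : 0 < ‖η₀‖ + ε := by positivity
  -- A multiple `t • η` within `ε / 2` of `η₀` has norm at most `‖η₀‖ + ε`. A relative error `δ`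
  -- therefore moves it by at most `ε / 2`, and it stays in the ball of radius `ε`.
  refine DecaysOn.localFourier_mul hb hbφ (S' := cov ⁻¹' C) (δ := ε / 2 / (‖η₀‖ + ε))
    (by positivity) ?_ (DecaysOn.of_pow fun N ↦ ?_)
  · rintro η ⟨t, ht, hη⟩ ζ hζ
    have h1 : t • ζ ∈ cov ⁻¹' C := by
      refine hball ?_
      rw [mem_ball_iff_norm] at hη ⊢
      have h2 : ‖t • η‖ ≤ ‖η₀‖ + ε := by
        calc ‖t • η‖ = ‖η₀ + (t • η - η₀)‖ := by congr 1; abel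
          _ ≤ ‖η₀‖ + ‖t • η - η₀‖ := norm_add_le _ _
          _ ≤ _ := by linarith
      have h3 : ‖t • ζ - t • η‖ ≤ ε / 2 := by
        rw [← smul_sub, norm_smul, Real.norm_of_nonneg ht.le, norm_sub_rev]
        rw [norm_smul, Real.norm_of_nonneg ht.le] at h2
        calc t * ‖η - ζ‖ ≤ t * (ε / 2 / (‖η₀‖ + ε) * ‖η‖) := by gcongr
          _ = ε / 2 / (‖η₀‖ + ε) * (t * ‖η‖) := by ring
          _ ≤ ε / 2 / (‖η₀‖ + ε) * (‖η₀‖ + ε) := by gcongr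
          _ = ε / 2 := by field_simp
      calc ‖t • ζ - η₀‖ = ‖(t • ζ - t • η) + (t • η - η₀)‖ := by congr 1; abel
        _ ≤ ‖t • ζ - t • η‖ + ‖t • η - η₀‖ := norm_add_le _ _
        _ < ε := by linarith
    have h4 := hC _ h1 t⁻¹ (inv_pos.2 ht)
    rw [← cov_smul, smul_smul, inv_mul_cancel₀ ht.ne', one_smul] at h4
    exact h4
  · obtain ⟨B, hB⟩ := hdec v N
    refine ⟨B, fun ξ hξ ↦ le_trans ?_ (hB _ hξ)⟩
    gcongr
    exact norm_le_norm_cov ξ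

theorem not_mem_wavefront {T : 𝓓(Ω, F) →L[ℂ] ℂ} {x : Space m} (hx : x ∈ Ω) {η : Covector m}
    (hη : η ≠ 0) : (x, η) ∉ wavefront T ↔ MicroSmoothAt T x η := by
  simp [wavefront, hx, hη]

/-- Finitely many of the open sets of directions cover `s`; the neighbourhoods of `x₀` that belong
to them are intersected. -/
theorem exists_decaysOn_of_isCompact [CompleteSpace F] {T : 𝓓(Ω, F) →L[ℂ] ℂ} {x₀ : Space m}
    {s : Set (Space m)} (hs : IsCompact s) (h : ∀ η ∈ s, MicroSmoothAt T x₀ (cov η)) :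
    ∃ U ∈ 𝓝 x₀, ∃ W, IsOpen W ∧ s ⊆ W ∧ ∀ φ : TestFun Ω, tsupport φ ⊆ U → ∀ v,
      DecaysOn (fun ξ ↦ localFourier T φ v (cov ξ)) (coneHull W) := by
  refine hs.induction_on (p := fun t ↦ ∃ U ∈ 𝓝 x₀, ∃ W, IsOpen W ∧ t ⊆ W ∧
    ∀ φ : TestFun Ω, tsupport φ ⊆ U → ∀ v,
      DecaysOn (fun ξ ↦ localFourier T φ v (cov ξ)) (coneHull W)) ?_ ?_ ?_ ?_
  · exact ⟨univ, univ_mem, ∅, isOpen_empty, empty_subset _, fun φ _ v N ↦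
      ⟨0, le_rfl, fun ξ ⟨_, _, h⟩ ↦ absurd h (notMem_empty _)⟩⟩
  · rintro t t' hst ⟨U, hU, W, hW, hsW, hd⟩
    exact ⟨U, hU, W, hW, hst.trans hsW, hd⟩
  · rintro t t' ⟨U, hU, W, hW, hsW, hd⟩ ⟨U', hU', W', hW', hsW', hd'⟩
    refine ⟨U ∩ U', inter_mem hU hU', W ∪ W', hW.union hW', union_subset_union hsW hsW',
      fun φ hφ v ↦ ?_⟩
    rw [coneHull_union]
    exact (hd φ (hφ.trans inter_subset_left) v).union (hd' φ (hφ.trans inter_subset_right) v)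
  · intro η hη
    obtain ⟨U, hU, W, hW, hd⟩ := (h η hη).exists_decaysOn
    obtain ⟨W', hW'W, hW', hηW'⟩ := mem_nhds_iff.1 hW
    exact ⟨W', mem_nhdsWithin_of_mem_nhds (hW'.mem_nhds hηW'), U, hU, W', hW', Subset.rfl,
      fun φ hφ v ↦ (hd φ hφ v).mono fun ξ ⟨t, ht, hξ⟩ ↦ ⟨t, ht, hW'W hξ⟩⟩

/-- Decay in a conic neighbourhood of a closed cone which does not meet the wavefront set over a
point, for all cutoffs near this point. -/
theorem exists_decaysOn_conic [CompleteSpace F] {T : 𝓓(Ω, F) →L[ℂ] ℂ} {x₀ : Space m} (hx₀ : x₀ ∈ Ω)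
    {C : Set (Covector m)} (hCc : IsClosed C) (hC : IsCone C)
    (h : ∀ η ∈ C, (x₀, η) ∉ wavefront T) :
    ∃ U ∈ 𝓝 x₀, ∃ δ : ℝ, 0 < δ ∧ ∃ S' : Set (Space m),
      (∀ η ∈ cov ⁻¹' C, ∀ ζ, ‖η - ζ‖ ≤ δ * ‖η‖ → ζ ∈ S') ∧
      ∀ φ : TestFun Ω, tsupport φ ⊆ U → ∀ v,
        DecaysOn (fun ξ ↦ localFourier T φ v (cov ξ)) S' := by
  -- A closed cone is determined, apart from the origin, by its compact set of unit directions. The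
  -- origin is put into `S'` separately: a single point does not affect decay.
  have hs : IsCompact (Metric.sphere (0 : Space m) 1 ∩ cov ⁻¹' C) :=
    (isCompact_sphere _ _).inter_right (hCc.preimage continuous_cov)
  obtain ⟨U, hU, W, hW, hsW, hd⟩ := exists_decaysOn_of_isCompact hs (T := T) (x₀ := x₀)
    fun η hη ↦ by
      refine (not_mem_wavefront hx₀ fun h0 ↦ ?_).1 (h _ hη.2)
      have h1 := hη.1
      rw [mem_sphere_zero_iff_norm] at h1
      have h2 := norm_le_norm_cov η
      rw [h0, norm_zero] at h2
      linarith
  obtain ⟨δ, hδ, hthick⟩ := hs.exists_cthickening_subset_open hW hsW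
  refine ⟨U, hU, δ, hδ, coneHull W ∪ {0}, fun η hη ζ hζ ↦ ?_, fun φ hφ v ↦
    (hd φ hφ v).union fun N ↦ ⟨_, norm_nonneg (localFourier T φ v (cov 0)), fun ξ hξ ↦ ?_⟩⟩
  · rcases eq_or_ne η 0 with rfl | h0
    · right
      simpa using hζ
    · left
      have hpos : 0 < ‖η‖ := norm_pos_iff.2 h0
      refine ⟨‖η‖⁻¹, inv_pos.2 hpos, hthick ?_⟩
      refine Metric.mem_cthickening_of_dist_le _ (‖η‖⁻¹ • η) δ _ ⟨?_, ?_⟩ ?_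
      · simp [norm_smul, hpos.ne']
      · rw [mem_preimage, cov_smul]
        exact hC _ hη _ (inv_pos.2 hpos)
      · rw [dist_eq_norm, ← smul_sub, norm_smul, norm_inv, norm_norm, norm_sub_rev, inv_mul_eq_div,
          div_le_iff₀ hpos]
        exact hζ
  · rw [mem_singleton_iff] at hξ
    subst hξ
    simp

/-- Decay in a closed cone which does not meet the wavefront set over the support of the cutoff. -/
theorem decaysOn_of_disjoint_wavefront [CompleteSpace F] {T : 𝓓(Ω, F) →L[ℂ] ℂ} {φ : TestFun Ω}
    {C : Set (Covector m)} (hCc : IsClosed C) (hC : IsCone C)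
    (h : ∀ x ∈ tsupport φ, ∀ η ∈ C, (x, η) ∉ wavefront T) (v : F) :
    DecaysOn (fun ξ ↦ localFourier T φ v (cov ξ)) (cov ⁻¹' C) := by
  refine testFun_induction
    (P := fun φ ↦ DecaysOn (fun ξ ↦ localFourier T φ v (cov ξ)) (cov ⁻¹' C)) φ (fun N ↦ ⟨0, le_rfl, fun ξ _ ↦ ?_⟩) (fun f g hf hg ↦ ?_)
    fun x hx ↦ ?_
  · have : oscTest (0 : TestFun Ω) v (cov ξ) = 0 := by
      ext x
      change (_ * (0 : ℂ)) • v = 0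
      simp
    simp [localFourier, this]
  · convert hf.add hg using 2 with ξ
    have : oscTest (f + g) v (cov ξ) = oscTest f v (cov ξ) + oscTest g v (cov ξ) := by
      ext x
      change (_ * (f x + g x)) • v = (_ * f x) • v + (_ * g x) • v
      rw [mul_add, add_smul]
    simp [localFourier, this]
  · obtain ⟨U, hU, δ, hδ, S', hS', hd⟩ := exists_decaysOn_conic (φ.tsupport_subset hx) hCc hC (h x hx)
    exact ⟨U, hU, fun φ' hφ' _ ↦ (hd φ' hφ' v).mono fun ξ hξ ↦ hS' ξ hξ ξ (by
      simp; positivity)⟩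

end Decay

/-! ### The wavefront set of the contraction -/

/-- The `v`-component of `φ ι_V u` is `φ v(V) u`. Its cutoff depends on `v`, and so it matters that
microlocal smoothness gives decay for all cutoffs near the point. -/
theorem wavefront_contract_subset {m : ℕ} {Ω : Opens (Space m)} {V : Space m → Space m}
    (hV : ContDiff ℝ ∞ V) (u : TopCurrent Ω) : wavefront (contract hV u) ⊆ wavefront u := by
  rintro ⟨x, ξ⟩ ⟨hx, hξ, hnot⟩
  refine ⟨hx, hξ, fun hmicro ↦ hnot ?_⟩
  rw [← cov_uncov ξ] at hmicro
  obtain ⟨U, hU, W, hW, hd⟩ := MicroSmoothAt.exists_decaysOn hmicro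
  obtain ⟨W', hW'W, hW', hξW'⟩ := mem_nhds_iff.1 hW
  obtain ⟨φ, hφU, hφ⟩ := exists_cutoff Ω (isCompact_singleton (x := x))
    (U := interior U ∩ Ω) (isOpen_interior.inter Ω.isOpen)
    (singleton_subset_iff.2 ⟨mem_interior_iff_mem_nhds.2 hU, hx⟩) inter_subset_right
  rw [nhdsSet_singleton] at hφ
  refine ⟨φ, by simp [hφ.self_of_nhds], uncov ⁻¹' coneHull W',
    (isOpen_coneHull hW').preimage continuous_uncov, ?_, subset_coneHull _ hξW', fun v N ↦ ?_⟩
  · rintro η ⟨s, hs, hη⟩ t ht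
    refine ⟨s * t⁻¹, by positivity, ?_⟩
    rwa [← cov_uncov η, ← cov_smul, uncov_cov, smul_smul, mul_assoc, inv_mul_cancel₀ ht.ne', mul_one]
  -- At the covector `0` the exponential is `1`, so this is the cutoff `φ v(V)`.
  · set φv : TestFun Ω := contractTest Ω hV (oscTest φ v 0)
    have hφv : ∀ y, φv y = φ y * v (V y) := fun y ↦ by
      change ((Complex.exp (-Complex.I * ((0 : ℝ) : ℂ)) * φ y) • v) (V y) = _
      simp
    have hsupp : tsupport φv ⊆ U := by
      refine (closure_mono fun y hy ↦ ?_).trans (hφU.trans (inter_subset_left.trans interior_subset))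
      intro h
      exact hy (by rw [hφv, h, zero_mul])
    obtain ⟨B, hB, hbd⟩ := hd φv hsupp 1 N
    refine ⟨(2 * Real.pi) ^ N * B, fun η hη ↦ ?_⟩
    have heq : localFourier (contract hV u) φ v η = localFourier u φv 1 η := by
      refine congrArg u ?_
      ext y
      change ((_ * φ y) • v) (V y) = (_ * φv y) • 1
      rw [hφv]
      simp [mul_assoc]
    obtain ⟨t, ht, hη⟩ := hη
    have := hbd (uncov η) ⟨t, ht, hW'W hη⟩
    simp only [cov_uncov] at this
    rw [heq]
    calc ‖η‖ ^ N * ‖localFourier u φv 1 η‖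
        = (2 * Real.pi) ^ N * (‖uncov η‖ ^ N * ‖localFourier u φv 1 η‖) := by
          conv_lhs => rw [← cov_uncov η, norm_cov, mul_pow, cov_uncov]
          ring
      _ ≤ (2 * Real.pi) ^ N * ((1 + ‖uncov η‖) ^ N * ‖localFourier u φv 1 η‖) := by
          gcongr
          linarith
      _ ≤ _ := by gcongr

/-- By homogeneity `Q` vanishes on the whole line through `x`; differentiate along this line. -/
theorem fderiv_quadraticForm_eq_zero {m : ℕ} (Q : QuadraticForm ℝ (Space m)) {x : Space m}
    (hx : Q x = 0) : fderiv ℝ Q x x = 0 := by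
  by_cases hd : DifferentiableAt ℝ Q x
  · have h1 : HasDerivAt (fun t : ℝ ↦ t • x) x 1 := by
      simpa using (hasDerivAt_id (1 : ℝ)).smul_const x
    have h2 : HasFDerivAt Q (fderiv ℝ Q x) ((1 : ℝ) • x) := by
      rw [one_smul]
      exact hd.hasFDerivAt
    have h3 := h2.comp_hasDerivAt (1 : ℝ) h1
    have h4 : Q ∘ (fun t : ℝ ↦ t • x) = fun _ ↦ 0 := by
      ext t
      simp [QuadraticMap.map_smul, hx]
    rw [h4] at h3
    exact h3.unique (hasDerivAt_const _ _)
  · simp [fderiv_zero_of_not_differentiableAt hd]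

/-- A conormal of the unit sphere at `x` kills the tangent space, so it is determined by its value
on `x`. For a multiple of `dQ(x)` with `Q(x) = 0` this value is zero. -/
theorem disjoint_conormalSphere {m : ℕ} {Q : QuadraticForm ℝ (Space m)}
    {Γ : Set (Space m × Covector m)}
    (h : Γ ⊆ {p | Q p.1 = 0 ∧ ∃ τ : ℝ, τ < 0 ∧ p.2 = τ • fderiv ℝ Q p.1}) :
    Disjoint Γ (conormalSphere m) := by
  rw [Set.disjoint_left]
  rintro ⟨x, ξ⟩ hΓ ⟨hx, hξ, hperp⟩
  obtain ⟨hQ, τ, -, hτ⟩ := h hΓ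
  dsimp only at hx hξ hperp hQ hτ
  have h1 : ξ x = 0 := by rw [hτ]; simp [fderiv_quadraticForm_eq_zero Q hQ]
  refine hξ (ContinuousLinearMap.ext fun y ↦ ?_)
  have h2 := hperp (y - inner ℝ x y • x) (by
    rw [inner_sub_right, inner_smul_right, real_inner_self_eq_norm_sq, hx]; ring)
  rw [map_sub, map_smul, h1, smul_zero, sub_zero] at h2
  simpa using h2

/-! ### Regularization -/

section Regularization

open FourierTransform

variable {m : ℕ}

theorem decaysOn_fourier (f : SmoothFun m) (hf : HasCompactSupport (f : Space m → ℂ)) :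
    DecaysOn (𝓕 (f : Space m → ℂ)) univ := fun N ↦ by
  obtain ⟨B, hB, h⟩ := decaysOn_fourierInv f hf N
  refine ⟨B, hB, fun ξ _ ↦ ?_⟩
  simpa [Real.fourierInv_eq_fourier_neg] using h (-ξ) (mem_univ _)

theorem continuous_fourier (f : SmoothFun m) (hf : HasCompactSupport (f : Space m → ℂ)) :
    Continuous (𝓕 (f : Space m → ℂ)) :=
  VectorFourier.fourierIntegral_continuous Real.continuous_fourierChar
    (by exact continuous_inner) ((SmoothFun.contDiff f).continuous.integrable_of_hasCompactSupport hf)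

theorem DecaysOn.mul_of_polynomial_bound {g G : Space m → ℂ} {S : Set (Space m)}
    (hg : DecaysOn g S) {M : ℕ} {A : ℝ} (hA : 0 ≤ A) (hG : ∀ ξ, ‖G ξ‖ ≤ A * (1 + ‖ξ‖) ^ M) :
    DecaysOn (fun ξ ↦ g ξ * G ξ) S := fun N ↦ by
  obtain ⟨B, hB, h⟩ := hg (N + M)
  refine ⟨B * A, by positivity, fun ξ hξ ↦ ?_⟩
  calc (1 + ‖ξ‖) ^ N * ‖g ξ * G ξ‖ ≤ (1 + ‖ξ‖) ^ N * (‖g ξ‖ * (A * (1 + ‖ξ‖) ^ M)) := by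
        rw [norm_mul]
        gcongr
        exact hG ξ
    _ = (1 + ‖ξ‖) ^ (N + M) * ‖g ξ‖ * A := by rw [pow_add]; ring
    _ ≤ _ := by gcongr; exact h ξ hξ

theorem DecaysOn.integrable_pow_mul {g : Space m → ℂ} (hg : DecaysOn g univ) (hc : Continuous g)
    (n : ℕ) : Integrable fun ξ ↦ ‖ξ‖ ^ n * ‖g ξ‖ := by
  obtain ⟨B, hB, h⟩ := hg (m + 2 + n)
  refine (integrable_weight.const_mul B).mono' (by fun_prop) (Eventually.of_forall fun ξ ↦ ?_)
  rw [Real.norm_of_nonneg (by positivity)]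
  refine le_mul_weight (le_trans ?_ (h ξ (mem_univ _)))
  rw [pow_add _ (m + 2) n, mul_assoc]
  gcongr
  linarith

theorem DecaysOn.integrable {g : Space m → ℂ} (hg : DecaysOn g univ) (hc : Continuous g) :
    Integrable g := by
  have := hg.integrable_pow_mul hc 0
  simp only [pow_zero, one_mul] at this
  exact (integrable_norm_iff hc.aestronglyMeasurable).1 this

theorem DecaysOn.contDiff_fourierInv {g : Space m → ℂ} (hg : DecaysOn g univ) (hc : Continuous g) :
    ContDiff ℝ ∞ (𝓕⁻ g) := by
  have : 𝓕⁻ g = fun x ↦ 𝓕 g (-x) := funext fun x ↦ Real.fourierInv_eq_fourier_neg g x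
  rw [this]
  exact (Real.contDiff_fourier (N := ⊤) fun n _ ↦ hg.integrable_pow_mul hc n).comp contDiff_neg

/-- The inverse transform is the Fourier transform for the pairing `-⟨·, ·⟩`; this pairing is
symmetric, so the transform is its own transpose by Fubini. -/
theorem integral_mul_fourierInv {f g : Space m → ℂ} (hf : Integrable f) (hg : Integrable g) :
    ∫ x, f x * 𝓕⁻ g x = ∫ ξ, 𝓕⁻ f ξ * g ξ := by
  have h := VectorFourier.integral_fourierIntegral_smul_eq_flip (L := -innerₗ (Space m))
    (μ := volume) (ν := volume) Real.continuous_fourierChar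
    (by exact (continuous_inner (𝕜 := ℝ) (E := Space m)).neg) hf hg
  have h1 : ∀ k : Space m → ℂ, ∀ ξ, VectorFourier.fourierIntegral Real.fourierChar volume
      (-innerₗ (Space m)) k ξ = 𝓕⁻ k ξ := fun k ξ ↦ by
    rw [Real.fourierInv_eq, VectorFourier.fourierIntegral]
    simp
  have h2 : ∀ k : Space m → ℂ, ∀ ξ, VectorFourier.fourierIntegral Real.fourierChar volume
      (-innerₗ (Space m)).flip k ξ = 𝓕⁻ k ξ := fun k ξ ↦ by
    rw [Real.fourierInv_eq, VectorFourier.fourierIntegral]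
    simp [real_inner_comm]
  simp only [h1, h2, smul_eq_mul] at h
  exact h.symm

/-- The function `y ↦ f (x - y)`. -/
def SmoothFun.reflect (f : SmoothFun m) (x : Space m) : SmoothFun m :=
  ⟨fun y ↦ (f : Space m → ℂ) (x - y),
    (SmoothFun.contDiff f).comp (contDiff_const.sub contDiff_id)⟩

theorem SmoothFun.reflect_apply (f : SmoothFun m) (x y : Space m) :
    (SmoothFun.reflect f x : Space m → ℂ) y = (f : Space m → ℂ) (x - y) := rfl

theorem SmoothFun.hasCompactSupport_reflect {f : SmoothFun m}
    (hf : HasCompactSupport (f : Space m → ℂ)) (x : Space m) :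
    HasCompactSupport (SmoothFun.reflect f x : Space m → ℂ) :=
  hf.comp_homeomorph (Homeomorph.subLeft x)

theorem fourierInv_reflect (f : SmoothFun m) (x ζ : Space m) :
    𝓕⁻ (SmoothFun.reflect f x : Space m → ℂ) ζ =
      (Real.fourierChar (inner ℝ ζ x) : ℂ) * 𝓕 (f : Space m → ℂ) ζ := by
  rw [Real.fourierInv_eq, Real.fourier_eq, ← integral_const_mul,
    ← integral_sub_left_eq_self (fun y ↦ (Real.fourierChar (inner ℝ ζ x) : ℂ) *
      (Real.fourierChar (-inner ℝ y ζ) • (f : Space m → ℂ) y)) volume x]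
  refine integral_congr_ae (Eventually.of_forall fun y ↦ ?_)
  simp only [SmoothFun.reflect_apply, Circle.smul_def, smul_eq_mul]
  rw [← mul_assoc, ← Circle.coe_mul, ← AddChar.map_add_eq_mul]
  congr 4
  rw [inner_sub_left, real_inner_comm ζ x]
  ring

variable {Ω : Opens (Space m)} {F : Type} [NormedAddCommGroup F] [NormedSpace ℝ F]
  [NormedSpace ℂ F] [IsScalarTower ℝ ℂ F]

/-- The component `v` of the convolution of `φ T` with `f`. -/
def regularize (T : 𝓓(Ω, F) →L[ℂ] ℂ) (φ : TestFun Ω) (v : F) (f : SmoothFun m) (x : Space m) : ℂ :=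
  T (smulTest φ v (SmoothFun.reflect f x))

/-- Convolution becomes a product after Fourier transformation. The transform of `f` decays rapidly
and that of `φ T` grows polynomially, so their product decays rapidly and the convolution is smooth.
-/
theorem regularize_eq_fourierInv [CompleteSpace F] (T : 𝓓(Ω, F) →L[ℂ] ℂ) (φ : TestFun Ω) (v : F)
    {f : SmoothFun m} (hf : HasCompactSupport (f : Space m → ℂ)) (x : Space m) :
    regularize T φ v f x =
      𝓕⁻ (fun ζ ↦ 𝓕 (f : Space m → ℂ) ζ * localFourier T φ v (cov ζ)) x := by
  rw [regularize, (apply_smulTest_eq_integral T φ v).2 _ (SmoothFun.hasCompactSupport_reflect hf x),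
    Real.fourierInv_eq]
  refine integral_congr_ae (Eventually.of_forall fun ζ ↦ ?_)
  simp only [fourierInv_reflect, Circle.smul_def, smul_eq_mul, mul_assoc]

theorem decaysOn_fourier_mul_localFourier [CompleteSpace F] (T : 𝓓(Ω, F) →L[ℂ] ℂ) (φ : TestFun Ω)
    (v : F) {f : SmoothFun m} (hf : HasCompactSupport (f : Space m → ℂ)) :
    DecaysOn (fun ζ ↦ 𝓕 (f : Space m → ℂ) ζ * localFourier T φ v (cov ζ)) univ ∧
      Continuous fun ζ ↦ 𝓕 (f : Space m → ℂ) ζ * localFourier T φ v (cov ζ) := by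
  obtain ⟨M, A, hA, hM⟩ := exists_polynomial_bound T φ v
  exact ⟨(decaysOn_fourier f hf).mul_of_polynomial_bound hA hM,
    (continuous_fourier f hf).mul (apply_smulTest_eq_integral T φ v).1⟩

theorem contDiff_regularize [CompleteSpace F] (T : 𝓓(Ω, F) →L[ℂ] ℂ) (φ : TestFun Ω) (v : F)
    {f : SmoothFun m} (hf : HasCompactSupport (f : Space m → ℂ)) :
    ContDiff ℝ ∞ (regularize T φ v f) := by
  rw [funext (regularize_eq_fourierInv T φ v hf)]
  obtain ⟨h1, h2⟩ := decaysOn_fourier_mul_localFourier T φ v hf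
  exact h1.contDiff_fourierInv h2

theorem integral_mul_regularize [CompleteSpace F] (T : 𝓓(Ω, F) →L[ℂ] ℂ) (φ : TestFun Ω) (v : F)
    {f : SmoothFun m} (hf : HasCompactSupport (f : Space m → ℂ)) {g : Space m → ℂ}
    (hg : Integrable g) :
    ∫ x, g x * regularize T φ v f x =
      ∫ ζ, 𝓕⁻ g ζ * (𝓕 (f : Space m → ℂ) ζ * localFourier T φ v (cov ζ)) := by
  obtain ⟨h1, h2⟩ := decaysOn_fourier_mul_localFourier T φ v hf
  rw [← integral_mul_fourierInv hg (h1.integrable h2)]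
  simp_rw [regularize_eq_fourierInv T φ v hf]

/-- Bump functions with support in the ball of radius `1 / (j + 1)`. -/
def mollifierBump (m j : ℕ) : ContDiffBump (0 : Space m) where
  rIn := 1 / (j + 1 : ℝ) / 2
  rOut := 1 / (j + 1 : ℝ)
  rIn_pos := by positivity
  rIn_lt_rOut := half_lt_self (by positivity)

/-- Smooth approximations of the Dirac measure. -/
def mollifier (m j : ℕ) : SmoothFun m :=
  ⟨fun x ↦ ((mollifierBump m j).normed volume x : ℂ),
    Complex.ofRealCLM.contDiff.comp ((mollifierBump m j).contDiff_normed (n := ⊤))⟩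

theorem mollifier_apply (j : ℕ) (x : Space m) :
    (mollifier m j : Space m → ℂ) x = ((mollifierBump m j).normed volume x : ℂ) := rfl

theorem mollifier_eq_zero {j : ℕ} {x : Space m} (hx : 1 / (j + 1 : ℝ) ≤ ‖x‖) :
    (mollifier m j : Space m → ℂ) x = 0 := by
  have : x ∉ Function.support ((mollifierBump m j).normed volume) := by
    rw [ContDiffBump.support_normed_eq, mem_ball_zero_iff]
    exact hx.not_gt
  rw [mollifier_apply, Function.notMem_support.1 this, Complex.ofReal_zero]

theorem hasCompactSupport_mollifier (j : ℕ) :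
    HasCompactSupport (mollifier m j : Space m → ℂ) :=
  ((mollifierBump m j).hasCompactSupport_normed (μ := volume)).comp_left Complex.ofReal_zero

/-- The mollifier has integral `1`, and `|e^{is} - 1| ≤ |s|` with `|s| ≤ 2π ‖x‖ ‖ζ‖`, where `‖x‖` is
at most `1 / (j + 1)` on the support. -/
theorem norm_fourier_mollifier_sub_one_le (j : ℕ) (ζ : Space m) :
    ‖𝓕 (mollifier m j : Space m → ℂ) ζ - 1‖ ≤ 1 / (j + 1 : ℝ) * (2 * Real.pi * ‖ζ‖) := by
  set ρ := (mollifierBump m j).normed volume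
  have hρ : Integrable ρ := (mollifierBump m j).integrable_normed
  have hρ1 : ∫ x, ρ x = 1 := (mollifierBump m j).integral_normed
  have h1 : 𝓕 (mollifier m j : Space m → ℂ) ζ - 1 =
      ∫ x, (((Real.fourierChar (-inner ℝ x ζ) : Circle) : ℂ) - 1) * (ρ x : ℂ) := by
    have h0 : ∫ x, (ρ x : ℂ) = 1 := by rw [integral_complex_ofReal, hρ1, Complex.ofReal_one]
    rw [Real.fourier_eq]
    conv_lhs => rw [← h0]
    rw [← integral_sub]
    · refine integral_congr_ae (Eventually.of_forall fun x ↦ ?_)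
      simp only [mollifier_apply, Circle.smul_def, smul_eq_mul, sub_mul, one_mul]
      rfl
    · refine (Real.fourierIntegral_convergent_iff ζ).2 ?_
      exact hρ.ofReal
    · exact hρ.ofReal
  rw [h1]
  refine (norm_integral_le_of_norm_le (g := fun x ↦ 1 / (j + 1 : ℝ) * (2 * Real.pi * ‖ζ‖) * ρ x)
    (hρ.const_mul _) (Eventually.of_forall fun x ↦ ?_)).trans ?_
  · have hρ0 : 0 ≤ ρ x := (mollifierBump m j).nonneg_normed x
    rw [norm_mul, Complex.norm_real, Real.norm_of_nonneg hρ0]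
    by_cases hx : 1 / (j + 1 : ℝ) ≤ ‖x‖
    · have h2 := mollifier_eq_zero hx
      rw [mollifier_apply, Complex.ofReal_eq_zero] at h2
      rw [show ρ x = 0 from h2]
      simp
    · gcongr
      rw [Real.fourierChar_apply, mul_comm _ Complex.I]
      refine (Real.norm_exp_I_mul_ofReal_sub_one_le).trans ?_
      rw [Real.norm_eq_abs, abs_mul, abs_of_pos (by positivity), abs_neg]
      calc _ ≤ 2 * Real.pi * (‖x‖ * ‖ζ‖) := by gcongr; exact abs_real_inner_le_norm x ζ
        _ ≤ 2 * Real.pi * (1 / (j + 1 : ℝ) * ‖ζ‖) := by gcongr; exact (not_le.1 hx).le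
        _ = _ := by ring
  · rw [integral_const_mul, hρ1, mul_one]

end Regularization

/-! ### Smooth approximations of currents -/

section Approximation

open FourierTransform

variable {m : ℕ}

/-- The alternating form `(-1)^i dx_0 ∧ ⋯ ∧ dx_{n-1}` with the factor `dx_i` left out. -/
def coordForm (i : Fin (m + 1)) : AltForm m :=
  (-1 : ℂ) ^ (i : ℕ) • Complex.ofRealCLM.compContinuousAlternatingMap
    { (Matrix.detRowAlternating (n := Fin m) (R := ℝ)).compLinearMap
        (LinearMap.pi fun k ↦
          ((EuclideanSpace.proj (i.succAbove k) : Space m →L[ℝ] ℝ) : Space m →ₗ[ℝ] ℝ)) with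
      cont := by
        change Continuous fun w : Fin m → Space m ↦
          (Matrix.of fun j k ↦ w j (i.succAbove k)).det
        refine Continuous.matrix_det (continuous_pi fun j ↦ continuous_pi fun k ↦ ?_)
        exact (EuclideanSpace.proj (i.succAbove k) : Space m →L[ℝ] ℝ).continuous.comp
          (continuous_apply j) }

theorem coordForm_apply (i : Fin (m + 1)) (w : Fin m → Space m) :
    coordForm i w = (-1 : ℂ) ^ (i : ℕ) *
      ((Matrix.of fun j k ↦ w j (i.succAbove k)).det : ℂ) := rfl

/-- The two signs `(-1)^i` cancel, and the forms `coordForm i` are dual to the coordinate covectors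
under the wedge pairing. A form with prescribed pairings can thus be written down componentwise. -/
theorem topWedge_coordForm (α : Space m →L[ℝ] ℂ) (i : Fin (m + 1)) :
    topWedge m α (coordForm i) = α (stdBasis i) := by
  rw [topWedge_apply, Finset.sum_eq_single i]
  · rw [coordForm_apply]
    have : (Matrix.of fun j k ↦ (stdBasis (i.succAbove j) : Space m) (i.succAbove k)) =
        (1 : Matrix (Fin m) (Fin m) ℝ) := by
      ext j k
      simp [stdBasis, Matrix.one_apply, eq_comm]
    rw [this, Matrix.det_one, Complex.ofReal_one, mul_one, mul_right_comm, ← pow_add,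
      Even.neg_one_pow ⟨_, rfl⟩, one_mul]
  · intro k _ hk
    obtain ⟨j, hj⟩ := Fin.exists_succAbove_eq hk.symm
    rw [coordForm_apply, Matrix.det_eq_zero_of_row_eq_zero j]
    · simp
    · intro l
      simp [stdBasis, hj, Fin.succAbove_ne]
  · simp

/-- The coordinate covectors. -/
def coordCovector (i : Fin (m + 1)) : Space m →L[ℝ] ℂ :=
  Complex.ofRealCLM ∘L EuclideanSpace.proj i

theorem coordCovector_apply (i : Fin (m + 1)) (x : Space m) : coordCovector i x = (x i : ℂ) := rfl

theorem sum_smul_stdBasis (x : Space m) : ∑ i, x i • stdBasis i = x := by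
  ext j
  simp [stdBasis, Finset.sum_apply, Pi.single_apply]

theorem sum_smul_coordCovector (α : Space m →L[ℝ] ℂ) :
    ∑ i, α (stdBasis i) • coordCovector i = α := by
  ext x
  conv_rhs => rw [← sum_smul_stdBasis x]
  rw [map_sum, sum_apply]
  refine Finset.sum_congr rfl fun i _ ↦ ?_
  rw [map_smul, smul_apply, coordCovector_apply, smul_eq_mul, Complex.real_smul,
    mul_comm]

/-- Cutoffs which exhaust an open set. -/
theorem exists_exhausting_cutoffs (Ω : Opens (Space m)) : ∃ χ : ℕ → TestFun Ω,
    ∀ K, IsCompact K → K ⊆ (Ω : Set (Space m)) → ∀ᶠ j in atTop, ∀ x ∈ K, χ j x = 1 := by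
  have : LocallyCompactSpace Ω := Ω.isOpen.locallyCompactSpace
  set E : CompactExhaustion Ω := default
  choose χ _ hχ using fun j ↦ exists_cutoff Ω ((E.isCompact j).image continuous_subtype_val)
    Ω.isOpen (by rintro _ ⟨x, -, rfl⟩; exact x.2) Subset.rfl
  refine ⟨χ, fun K hK hKΩ ↦ ?_⟩
  obtain ⟨n, hn⟩ := E.exists_superset_of_isCompact (s := ((↑) : Ω → Space m) ⁻¹' K)
    (Topology.IsInducing.subtypeVal.isCompact_preimage_iff
      (by simpa using hKΩ) |>.2 hK)
  filter_upwards [eventually_ge_atTop n] with j hj x hx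
  exact (hχ j).self_of_nhdsSet x ⟨⟨x, hKΩ hx⟩, E.subset hj (hn hx), rfl⟩

variable {Ω : Opens (Space m)}

theorem regularize_smul_left {F : Type} [NormedAddCommGroup F] [NormedSpace ℝ F]
    [NormedSpace ℂ F] [IsScalarTower ℝ ℂ F] (T : 𝓓(Ω, F) →L[ℂ] ℂ) (φ : TestFun Ω) {ι : Type*}
    (s : Finset ι) (c : ι → ℂ) (v : ι → F) (f : SmoothFun m) (x : Space m) :
    regularize T φ (∑ i ∈ s, c i • v i) f x = ∑ i ∈ s, c i * regularize T φ (v i) f x := by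
  simp only [regularize]
  have : smulTest φ (∑ i ∈ s, c i • v i) (SmoothFun.reflect f x) =
      ∑ i ∈ s, c i • smulTest φ (v i) (SmoothFun.reflect f x) := by
    classical
    induction s using Finset.induction_on with
    | empty =>
      ext y
      simp
    | insert a s ha ih =>
      rw [Finset.sum_insert ha, Finset.sum_insert ha, ← ih]
      ext y
      exact (smul_add _ _ _).trans (congrArg₂ (· + ·) (smul_comm _ (c a) (v a)) rfl)
  rw [this, map_sum]
  simp

theorem currentOfForm_apply {θ : Space m → AltForm m} (hθ : ContinuousOn θ Ω)
    (α : TestOneForm Ω) :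
    currentOfForm Ω θ α = ∫ x, topWedge m (α x) (θ x) :=
  TestFunction.integralAgainstBilinCLM_eq_integral
    (hθ.locallyIntegrableOn Ω.isOpen.measurableSet)

/-- Every current is approximated by smooth forms which locally are convolutions. -/
theorem exists_regularization (T : SubtopCurrent Ω) : ∃ θ : ℕ → Space m → AltForm m,
    (∀ j, ContDiff ℝ ∞ (θ j)) ∧ ∀ φ φ₁ : TestFun Ω, (∀ᶠ x in 𝓝ˢ (tsupport φ), φ₁ x = 1) →
      ∀ᶠ j in atTop, ∀ v f, currentOfForm Ω (θ j) (smulTest φ v f) =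
        ∫ x, (f : Space m → ℂ) x * φ x * regularize T φ₁ v (mollifier m j) x := by
  obtain ⟨χ, hχ⟩ := exists_exhausting_cutoffs Ω
  -- The components are convolutions of `χ j T` with the mollifier; the exhausting cutoffs make them
  -- globally defined.
  set θ : ℕ → Space m → AltForm m := fun j x ↦
    ∑ i, regularize T (χ j) (coordCovector i) (mollifier m j) x • coordForm i
  have hθ : ∀ j, ContDiff ℝ ∞ (θ j) := fun j ↦ ContDiff.sum fun i _ ↦
    (contDiff_regularize T (χ j) _ (hasCompactSupport_mollifier j)).smul contDiff_const
  have hwedge : ∀ j x α, topWedge m α (θ j x) = regularize T (χ j) α (mollifier m j) x := by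
    intro j x α
    conv_rhs => rw [← sum_smul_coordCovector α, regularize_smul_left]
    simp only [θ, map_sum, map_smul, topWedge_coordForm, smul_eq_mul]
    exact Finset.sum_congr rfl fun i _ ↦ mul_comm _ _
  refine ⟨θ, hθ, fun φ φ₁ hφ₁ ↦ ?_⟩
  obtain ⟨U, hU, hφU, hU1⟩ := eventually_nhdsSet_iff_exists.1 hφ₁
  have hK : IsCompact (tsupport φ) := φ.hasCompactSupport
  -- At a point of the support of `φ` the convolution only sees the ball of radius `1 / (j + 1)`.
  -- Once this radius is below `δ` and `χ j = 1` on the `δ`-neighbourhood, `χ j` may be replaced by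
  -- `φ₁`.
  obtain ⟨δ, hδ, hthick⟩ := hK.exists_cthickening_subset_open (hU.inter Ω.isOpen)
    (subset_inter hφU φ.tsupport_subset)
  have hKδ : IsCompact (Metric.cthickening δ (tsupport φ)) := hK.cthickening
  have hε : ∀ᶠ j : ℕ in atTop, 1 / (j + 1 : ℝ) < δ :=
    tendsto_one_div_add_atTop_nhds_zero_nat.eventually_lt_const hδ
  filter_upwards [hε, hχ _ hKδ (hthick.trans inter_subset_right)] with j hj hχj v f
  rw [currentOfForm_apply (hθ j).continuous.continuousOn]
  refine integral_congr_ae (Eventually.of_forall fun x ↦ ?_)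
  dsimp only
  rw [smulTest_apply, map_smul, smul_apply, hwedge, smul_eq_mul]
  by_cases hx : x ∈ tsupport φ
  · congr 1
    refine congrArg T ?_
    ext1 y
    rw [smulTest_apply, smulTest_apply, SmoothFun.reflect_apply]
    by_cases hy : 1 / (j + 1 : ℝ) ≤ ‖x - y‖
    · rw [mollifier_eq_zero hy, zero_mul, zero_mul]
    · have hyK : y ∈ Metric.cthickening δ (tsupport φ) := by
        refine Metric.mem_cthickening_of_dist_le _ x δ _ hx ?_
        rw [dist_comm, dist_eq_norm]
        linarith
      rw [hχj y hyK, hU1 y (hthick hyK).1]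
  · rw [image_eq_zero_of_notMem_tsupport hx]
    simp

theorem localFourier_zero_left {F : Type} [NormedAddCommGroup F] [NormedSpace ℝ F]
    [NormedSpace ℂ F] [IsScalarTower ℝ ℂ F] (T : 𝓓(Ω, F) →L[ℂ] ℂ) (v : F) (η : Covector m) :
    localFourier T 0 v η = 0 := by
  have : oscTest (0 : TestFun Ω) v η = 0 := by
    ext x
    change (_ * (0 : ℂ)) • v = 0
    simp
  simp [localFourier, this]

theorem localFourier_add_left {F : Type} [NormedAddCommGroup F] [NormedSpace ℝ F]
    [NormedSpace ℂ F] [IsScalarTower ℝ ℂ F] (T : 𝓓(Ω, F) →L[ℂ] ℂ) (f g : TestFun Ω) (v : F)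
    (η : Covector m) : localFourier T (f + g) v η = localFourier T f v η + localFourier T g v η := by
  have : oscTest (f + g) v η = oscTest f v η + oscTest g v η := by
    ext x
    change (_ * (f x + g x)) • v = (_ * f x) • v + (_ * g x) • v
    rw [mul_add, add_smul]
  simp [localFourier, this]

/-- The local Fourier transforms of regularizations converge rapidly, in all closed cones which do
not meet the wavefront set. -/
theorem eventually_norm_localFourier_sub_le {T : SubtopCurrent Ω} {θ : ℕ → Space m → AltForm m}
    (hθ : ∀ φ φ₁ : TestFun Ω, (∀ᶠ x in 𝓝ˢ (tsupport φ), φ₁ x = 1) →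
      ∀ᶠ j in atTop, ∀ v f, currentOfForm Ω (θ j) (smulTest φ v f) =
        ∫ x, (f : Space m → ℂ) x * φ x * regularize T φ₁ v (mollifier m j) x)
    {φ : TestFun Ω} {C : Set (Covector m)} (hCc : IsClosed C) (hC : IsCone C)
    (h : ∀ x ∈ tsupport φ, ∀ η ∈ C, (x, η) ∉ wavefront T) (v : Space m →L[ℝ] ℂ) (N : ℕ) :
    ∃ B : ℝ, ∀ᶠ j : ℕ in atTop, ∀ η ∈ cov ⁻¹' C, (1 + ‖η‖) ^ N *
      ‖localFourier (currentOfForm Ω (θ j)) φ v (cov η) - localFourier T φ v (cov η)‖ ≤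
        1 / (j + 1 : ℝ) * B := by
  refine testFun_induction (P := fun φ ↦ ∃ B : ℝ, ∀ᶠ j : ℕ in atTop, ∀ η ∈ cov ⁻¹' C,
    (1 + ‖η‖) ^ N * ‖localFourier (currentOfForm Ω (θ j)) φ v (cov η) -
      localFourier T φ v (cov η)‖ ≤ 1 / (j + 1 : ℝ) * B) φ ?_ ?_ fun x₀ hx₀ ↦ ?_
  · exact ⟨0, Eventually.of_forall fun j η _ ↦ by simp [localFourier_zero_left]⟩
  · rintro f g ⟨B, hB⟩ ⟨B', hB'⟩
    refine ⟨B + B', ?_⟩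
    filter_upwards [hB, hB'] with j hj hj' η hη
    rw [localFourier_add_left, localFourier_add_left, add_sub_add_comm, mul_add]
    refine le_trans ?_ (add_le_add (hj η hη) (hj' η hη))
    rw [← mul_add]
    gcongr
    exact norm_add_le _ _
  · have hx₀Ω := φ.tsupport_subset hx₀
    obtain ⟨U, hU, δ, hδ, S', hS', hd⟩ := exists_decaysOn_conic hx₀Ω hCc hC (h x₀ hx₀)
    obtain ⟨φ₁, hφ₁U, hφ₁⟩ := exists_cutoff Ω (isCompact_singleton (x := x₀))
      (U := interior U ∩ Ω) (isOpen_interior.inter Ω.isOpen)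
      (singleton_subset_iff.2 ⟨mem_interior_iff_mem_nhds.2 hU, hx₀Ω⟩) inter_subset_right
    rw [nhdsSet_singleton] at hφ₁
    refine ⟨{x | ∀ᶠ y in 𝓝 x, φ₁ y = 1}, hφ₁.eventually_nhds, fun φ' hφ' _ ↦ ?_⟩
    set a : SmoothFun m := TestFun.smooth φ'
    have ha : HasCompactSupport (a : Space m → ℂ) := φ'.hasCompactSupport
    have hmul : ∀ x, φ' x = (a : Space m → ℂ) x * φ₁ x := fun x ↦ by
      change φ' x = φ' x * φ₁ x
      by_cases hx : x ∈ tsupport φ'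
      · rw [(hφ' hx).self_of_nhds, mul_one]
      · rw [image_eq_zero_of_notMem_tsupport hx, zero_mul]
    have hdec := hd φ₁ (hφ₁U.trans (inter_subset_left.trans interior_subset)) v
    set G : Space m → ℂ := fun ζ ↦ localFourier T φ₁ v (cov ζ)
    obtain ⟨M, A, hA, hM⟩ := exists_polynomial_bound T φ₁ v
    -- The bound `2π ‖ζ‖ / (j + 1)` for the transform of the mollifier minus `1` costs one power of
    -- `‖ζ‖`. It is put into `G`, which changes neither polynomial growth nor rapid decay.
    have hG' : ∀ ζ, ‖(‖ζ‖ : ℂ) * G ζ‖ ≤ A * (1 + ‖ζ‖) ^ (M + 1) := fun ζ ↦ by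
      rw [norm_mul, Complex.norm_real, norm_norm]
      calc ‖ζ‖ * ‖G ζ‖ ≤ (1 + ‖ζ‖) * (A * (1 + ‖ζ‖) ^ M) := by
            gcongr
            · linarith
            · exact hM ζ
        _ = _ := by ring
    have hdec' : DecaysOn (fun ζ ↦ (‖ζ‖ : ℂ) * G ζ) S' := fun k ↦ by
      obtain ⟨B, hB, hb⟩ := hdec (k + 1)
      refine ⟨B, hB, fun ζ hζ ↦ le_trans ?_ (hb ζ hζ)⟩
      rw [norm_mul, Complex.norm_real, norm_norm, pow_succ, mul_assoc]
      gcongr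
      linarith
    obtain ⟨B, hB, hbd⟩ := exists_convolution_bound hδ (decaysOn_fourierInv a ha) hA hG' hS' hdec' N
    refine ⟨2 * Real.pi * B, ?_⟩
    filter_upwards [hθ φ' φ₁ (eventually_nhdsSet_iff_forall.2 fun x hx ↦ hφ' hx)] with j hj η hη
    have hρ := hasCompactSupport_mollifier (m := m) j
    have hcont : Continuous G := (apply_smulTest_eq_integral T φ₁ v).1
    have hshift : DecaysOn (𝓕⁻ (SmoothFun.mul (osc η) a : Space m → ℂ)) univ :=
      decaysOn_fourierInv _ (SmoothFun.hasCompactSupport_mul _ ha)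
    have hcont' : Continuous (𝓕⁻ (SmoothFun.mul (osc η) a : Space m → ℂ)) := by
      have h1 : 𝓕⁻ (SmoothFun.mul (osc η) a : Space m → ℂ) =
          fun ζ ↦ 𝓕 (SmoothFun.mul (osc η) a : Space m → ℂ) (-ζ) :=
        funext fun x ↦ Real.fourierInv_eq_fourier_neg _ x
      rw [h1]
      exact (continuous_fourier _ (SmoothFun.hasCompactSupport_mul _ ha)).comp continuous_neg
    have hint : ∀ {G' : Space m → ℂ}, Continuous G' → ∀ (M : ℕ) (A : ℝ), 0 ≤ A →
        (∀ ζ, ‖G' ζ‖ ≤ A * (1 + ‖ζ‖) ^ M) → Integrable fun ζ ↦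
          𝓕⁻ (a : Space m → ℂ) (ζ - η) * G' ζ := fun hG M A hA hM ↦ by
      simp_rw [← fourierInv_osc_mul]
      exact (hshift.mul_of_polynomial_bound hA hM).integrable (hcont'.mul hG)
    -- Both transforms are convolutions with the shifted transform of `a`, the first of them with
    -- the mollifier's transform as an additional factor.
    have heq : localFourier (currentOfForm Ω (θ j)) φ' v (cov η) - localFourier T φ' v (cov η) =
        ∫ ζ, 𝓕⁻ (a : Space m → ℂ) (ζ - η) *
          ((𝓕 (mollifier m j : Space m → ℂ) ζ - 1) * G ζ) := by
      rw [localFourier_mul T ha hmul, localFourier_cov, hj]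
      have h1 := integral_mul_regularize T φ₁ v hρ
        (g := (SmoothFun.mul (osc η) a : Space m → ℂ))
        ((SmoothFun.contDiff _).continuous.integrable_of_hasCompactSupport
          (SmoothFun.hasCompactSupport_mul _ ha))
      simp only [fourierInv_osc_mul] at h1
      refine (congrArg (· - _) h1).trans ?_
      obtain ⟨B', hB', hb'⟩ := decaysOn_fourier _ hρ 0
      rw [← integral_sub]
      · refine integral_congr_ae (Eventually.of_forall fun ζ ↦ ?_)
        simp only [G]
        ring
      · refine hint ((continuous_fourier _ hρ).mul hcont) M (B' * A) (by positivity) fun ζ ↦ ?_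
        rw [norm_mul, mul_assoc]
        have := hb' ζ (mem_univ _)
        rw [pow_zero, one_mul] at this
        gcongr
        exact hM ζ
      · exact hint hcont M A hA hM
    rw [heq]
    refine (hbd η hη _ (1 / (j + 1 : ℝ) * (2 * Real.pi)) (by positivity) fun ζ ↦ ?_).trans_eq
      (by ring)
    rw [norm_mul, norm_mul, norm_mul, Complex.norm_real, norm_norm]
    calc _ ≤ ‖𝓕⁻ (a : Space m → ℂ) (ζ - η)‖ *
        (1 / (j + 1 : ℝ) * (2 * Real.pi * ‖ζ‖) * ‖G ζ‖) := by
          gcongr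
          exact norm_fourier_mollifier_sub_one_le j ζ
      _ = _ := by ring

/-- The components of a test form. -/
def component (α : TestOneForm Ω) (i : Fin (m + 1)) : TestFun Ω where
  toFun x := α x (stdBasis i)
  contDiff' := α.contDiff.clm_apply contDiff_const
  hasCompactSupport' :=
    α.hasCompactSupport.mono' (fun x hx ↦ subset_tsupport _ (fun h ↦ hx (by simp [h])))
  tsupport_subset' := (closure_mono (Function.support_subset_iff'.2 fun x hx ↦ by
    simp [Function.notMem_support.1 hx])).trans α.tsupport_subset

/-- At the covector `0` the local Fourier transform is the pairing itself. Weak convergence thus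
becomes an instance of convergence on a cone. -/
theorem apply_eq_sum_component (T : SubtopCurrent Ω) (α : TestOneForm Ω) :
    T α = ∑ i, localFourier T (component α i) (coordCovector i) (cov 0) := by
  simp only [localFourier]
  rw [← map_sum]
  congr 1
  ext1 x
  have : ∀ s : Finset (Fin (m + 1)), (∑ i ∈ s, oscTest (component α i) (coordCovector i) (cov 0) :
      TestOneForm Ω) x = ∑ i ∈ s, α x (stdBasis i) • coordCovector i := by
    classical
    intro s
    induction s using Finset.induction_on with
    | empty => simp
    | insert a s ha ih =>
      rw [Finset.sum_insert ha, Finset.sum_insert ha, ← ih]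
      refine congrArg₂ (· + ·) (congrArg (fun c : ℂ ↦ c • coordCovector a) ?_) rfl
      change Complex.exp (-Complex.I * (cov 0 x : ℂ)) * α x (stdBasis a) = α x (stdBasis a)
      simp [cov_apply]
  rw [this, sum_smul_coordCovector]

/-- Every current is a limit of smooth forms in the spaces `𝓓'_Γ` such that `Γ` contains its
wavefront set. -/
theorem exists_tendstoHormander (T : SubtopCurrent Ω) {Γ : Set (Space m × Covector m)}
    (hΓ : wavefront T ⊆ Γ) : ∃ θ : ℕ → Space m → AltForm m, (∀ j, ContDiff ℝ ∞ (θ j)) ∧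
      TendstoHormander Γ (fun j ↦ currentOfForm Ω (θ j)) T := by
  obtain ⟨θ, hθ, h⟩ := exists_regularization T
  refine ⟨θ, hθ, ⟨fun α ↦ ?_, fun φ C hCc hC hdisj v N ↦ ?_⟩⟩
  · simp_rw [apply_eq_sum_component _ α]
    refine tendsto_finsetSum _ fun i _ ↦ ?_
    -- The closed cone `{0}` never meets a wavefront set.
    obtain ⟨B, hB⟩ := eventually_norm_localFourier_sub_le h (φ := component α i) (C := {0})
      isClosed_singleton (fun η hη t _ ↦ by rw [mem_singleton_iff.1 hη, smul_zero]; rfl)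
      (fun x _ η hη hw ↦ hw.2.1 hη) (coordCovector i) 0
    rw [tendsto_iff_norm_sub_tendsto_zero]
    refine squeeze_zero' (Eventually.of_forall fun _ ↦ norm_nonneg _) ?_
      (by simpa using tendsto_one_div_add_atTop_nhds_zero_nat.mul_const B)
    filter_upwards [hB] with j hj
    simpa using hj 0 (by simp [cov])
  · obtain ⟨B, hB⟩ := eventually_norm_localFourier_sub_le h (φ := φ) hCc hC
      (fun x hx η hη hw ↦ hdisj x hx η hη (hΓ hw)) v N
    rw [Metric.tendstoUniformlyOn_iff]
    intro ε hε
    have hlim : Tendsto (fun j : ℕ ↦ (2 * Real.pi) ^ N * (1 / (j + 1 : ℝ) * B)) atTop (𝓝 0) := by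
      simpa using (tendsto_one_div_add_atTop_nhds_zero_nat.mul_const B).const_mul
        ((2 * Real.pi) ^ N)
    filter_upwards [hB, hlim.eventually_lt_const hε] with j hj hjε η hη
    rw [dist_comm, dist_eq_norm, ← mul_sub, norm_mul, norm_pow, Complex.norm_real, norm_norm]
    refine lt_of_le_of_lt ?_ hjε
    have h1 := hj (uncov η) (by rwa [mem_preimage, cov_uncov])
    rw [cov_uncov] at h1
    have h2 : ‖η‖ = 2 * Real.pi * ‖uncov η‖ := by rw [← norm_cov, cov_uncov]
    rw [h2, mul_pow, mul_assoc]
    refine mul_le_mul_of_nonneg_left (le_trans ?_ h1) (by positivity)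
    gcongr
    linarith

end Approximation

/-! ### Oscillatory integrals of functions which are invariant under rotations -/

section Oscillatory

variable {m : ℕ}

/-- The infinitesimal rotation in the plane of `x₀` and `w`. -/
def rotField (x₀ w x : Space m) : Space m := inner ℝ x₀ x • w - inner ℝ w x • x₀

theorem inner_rotField_self (x₀ w x : Space m) : inner ℝ x (rotField x₀ w x) = 0 := by
  simp only [rotField, inner_sub_right, inner_smul_right, real_inner_comm x]
  ring

theorem contDiff_rotField (x₀ : Space m) :
    ContDiff ℝ ∞ fun p : Space m × Space m ↦ rotField x₀ p.2 p.1 := by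
  unfold rotField
  exact ((contDiff_const.inner ℝ contDiff_fst).smul contDiff_snd).sub
    ((contDiff_snd.inner ℝ contDiff_fst).smul contDiff_const)

theorem integral_inner_smul_fderiv (a v : Space m) {F : Space m → ℂ} (hF : ContDiff ℝ ∞ F)
    (hc : HasCompactSupport F) :
    Integrable (fun x ↦ (inner ℝ a x : ℂ) * fderiv ℝ F x v) ∧
    ∫ x, (inner ℝ a x : ℂ) * fderiv ℝ F x v = -(inner ℝ a v : ℂ) * ∫ x, F x := by
  have hl : ContDiff ℝ ∞ fun x : Space m ↦ ((inner ℝ a x : ℝ) : ℂ) :=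
    Complex.ofRealCLM.contDiff.comp (contDiff_const.inner ℝ contDiff_id)
  have hl' : ∀ x, HasFDerivAt (fun x : Space m ↦ ((inner ℝ a x : ℝ) : ℂ))
      (Complex.ofRealCLM ∘L innerSL ℝ a) x := fun x ↦
    (Complex.ofRealCLM ∘L innerSL ℝ a).hasFDerivAt
  have hdF : Continuous fun x ↦ fderiv ℝ F x v :=
    (hF.continuous_fderiv (by simp)).clm_apply continuous_const
  have hdFc : HasCompactSupport fun x ↦ fderiv ℝ F x v := hc.fderiv_apply ℝ v
  have h1 : Integrable fun x ↦ (inner ℝ a x : ℂ) * fderiv ℝ F x v :=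
    (hl.continuous.mul hdF).integrable_of_hasCompactSupport hdFc.mul_left
  refine ⟨h1, ?_⟩
  have h := integral_mul_fderiv_eq_neg_fderiv_mul_of_integrable (μ := volume) (𝕜 := ℂ)
    (f := fun x : Space m ↦ ((inner ℝ a x : ℝ) : ℂ)) (g := F) (v := v) ?_ h1
    ((hl.continuous.mul hF.continuous).integrable_of_hasCompactSupport hc.mul_left)
    (fun x _ ↦ (hl' x).differentiableAt) (fun x _ ↦ hF.differentiable (by simp) x)
  · rw [h]
    simp only [fun x ↦ (hl' x).fderiv, ContinuousLinearMap.comp_apply, innerSL_apply_apply,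
      Complex.ofRealCLM_apply]
    rw [integral_const_mul, neg_mul]
  · simp only [fun x ↦ (hl' x).fderiv]
    exact (continuous_const.mul hF.continuous).integrable_of_hasCompactSupport hc.mul_left

/-- Infinitesimal rotations have vanishing divergence. -/
theorem integral_fderiv_rotField (x₀ w : Space m) {F : Space m → ℂ} (hF : ContDiff ℝ ∞ F)
    (hc : HasCompactSupport F) : ∫ x, fderiv ℝ F x (rotField x₀ w x) = 0 := by
  obtain ⟨h1, h1'⟩ := integral_inner_smul_fderiv x₀ w hF hc
  obtain ⟨h2, h2'⟩ := integral_inner_smul_fderiv w x₀ hF hc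
  have : ∀ x, fderiv ℝ F x (rotField x₀ w x) =
      (inner ℝ x₀ x : ℂ) * fderiv ℝ F x w - (inner ℝ w x : ℂ) * fderiv ℝ F x x₀ := fun x ↦ by
    rw [rotField, map_sub, map_smul, map_smul, Complex.real_smul, Complex.real_smul]
  simp_rw [this]
  rw [integral_sub h1 h2, h1', h2', real_inner_comm]
  ring

theorem hasFDerivAt_osc (ξ x : Space m) : HasFDerivAt (osc ξ : Space m → ℂ)
    ((osc ξ : Space m → ℂ) x • ((-Complex.I) • (Complex.ofRealCLM ∘L cov ξ))) x := by
  have h1 : HasFDerivAt (fun y : Space m ↦ -Complex.I * (cov ξ y : ℂ))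
      ((-Complex.I) • (Complex.ofRealCLM ∘L cov ξ)) x :=
    (Complex.ofRealCLM ∘L cov ξ).hasFDerivAt.const_mul _
  exact h1.cexp

/-- A smooth function on the line which is equal to `1 / y` for `y ≥ c`. -/
theorem exists_smooth_inv {c : ℝ} (hc : 0 < c) :
    ∃ s : ℝ → ℝ, ContDiff ℝ ∞ s ∧ ∀ y, c ≤ y → s y * y = 1 := by
  refine ⟨fun y ↦ Real.smoothTransition (2 * y / c - 1) * y⁻¹,
    contDiff_iff_contDiffAt.2 fun y ↦ ?_, fun y hy ↦ ?_⟩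
  · rcases lt_or_ge 0 y with hy | hy
    · exact ((Real.smoothTransition.contDiff (n := ⊤)).comp
        (((contDiff_const.mul contDiff_id).div_const c).sub contDiff_const)).contDiffAt.mul
        (contDiffAt_inv ℝ hy.ne')
    · refine (contDiffAt_const (c := (0 : ℝ))).congr_of_eventuallyEq ?_
      filter_upwards [eventually_lt_nhds (show y < c / 2 by linarith)] with z hz
      rw [Real.smoothTransition.zero_of_nonpos, zero_mul]
      rw [sub_nonpos, div_le_one hc]
      linarith
  · have h0 : y ≠ 0 := (hc.trans_le hy).ne'
    dsimp only
    rw [Real.smoothTransition.one_of_one_le, one_mul, inv_mul_cancel₀ h0]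
    rw [le_sub_iff_add_le, le_div_iff₀ hc]
    linarith

/-- Rapid decay of oscillatory integrals whose integrand contains a function `h` which is invariant
under rotations, in directions which are not normal to the orbits. -/
theorem exists_oscillatory_bound {x₀ : Space m} {K : Set (Space m)} (hK : IsCompact K) {c : ℝ}
    (hc : 0 < c) {S : Set (Space m)} (hS1 : ∀ w ∈ S, ‖w‖ = 1)
    (hS : ∀ w ∈ S, ∀ x ∈ K, c ≤ inner ℝ x₀ x - inner ℝ w x * inner ℝ w x₀) (N : ℕ) :
    ∀ a : Space m × Space m → ℂ, ContDiff ℝ ∞ a → (∀ x ∉ K, ∀ w, a (x, w) = 0) →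
    ∃ B : ℝ, 0 ≤ B ∧ ∀ w ∈ S, ∀ t : ℝ, 0 < t → ∀ (h : Space m → ℂ) (E : Set (Space m)),
      ContDiff ℝ ∞ h → (∀ w x, fderiv ℝ h x (rotField x₀ w x) = 0) → (∀ x, ‖h x‖ ≤ 1) →
      (∀ x ∉ E, h x = 0) → volume E < ⊤ →
      t ^ N * ‖∫ x, (osc (-(t • w)) : Space m → ℂ) x * (a (x, w) * h x)‖ ≤ B * volume.real E := by
  induction N with
  | zero =>
    intro a ha haK
    -- The amplitude is smooth jointly in `(x, w)`, and unit vectors `w` stay in a compact set; this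
    -- gives the uniformity in the direction.
    obtain ⟨B, hB⟩ := (hK.prod (isCompact_closedBall (0 : Space m) 1)).exists_bound_of_continuousOn
      ha.continuous.continuousOn
    have hB' : ∀ w ∈ S, ∀ x, ‖a (x, w)‖ ≤ max B 0 := fun w hw x ↦ by
      by_cases hx : x ∈ K
      · exact (hB (x, w) ⟨hx, by simp [hS1 w hw]⟩).trans (le_max_left _ _)
      · simp [haK x hx]
    refine ⟨max B 0, le_max_right _ _, fun w hw t ht h E hh _ hh1 hhE hE ↦ ?_⟩
    rw [pow_zero, one_mul, ← setIntegral_eq_integral_of_forall_compl_eq_zero (s := E) (fun x hx ↦ by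
      rw [hhE x hx, mul_zero, mul_zero])]
    refine norm_setIntegral_le_of_norm_le_const hE fun x _ ↦ ?_
    rw [norm_mul, norm_osc, one_mul, norm_mul]
    calc _ ≤ max B 0 * 1 := by
          gcongr
          exacts [hB' w hw x, hh1 x]
      _ = _ := mul_one _
  | succ N ih =>
    intro a ha haK
    obtain ⟨s, hs, hs1⟩ := exists_smooth_inv hc
    -- For unit `w` the bracket is `⟨w, rotField x₀ w x⟩`, the derivative of the phase along the
    -- rotation up to a factor. It is at least `c` where `a` is not zero, so `a` can be divided by
    -- it smoothly.
    set b : Space m × Space m → ℂ := fun p ↦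
      (s (inner ℝ x₀ p.1 - inner ℝ p.2 p.1 * inner ℝ p.2 x₀) : ℂ) * a p
    have hb : ContDiff ℝ ∞ b := by
      refine (Complex.ofRealCLM.contDiff.comp (hs.comp ?_)).mul ha
      exact (contDiff_const.inner ℝ contDiff_fst).sub
        ((contDiff_snd.inner ℝ contDiff_fst).mul (contDiff_snd.inner ℝ contDiff_const))
    have hbK : ∀ x ∉ K, ∀ w, b (x, w) = 0 := fun x hx w ↦ by simp [b, haK x hx w]
    set a' : Space m × Space m → ℂ := fun p ↦
      fderiv ℝ (fun y ↦ b (y, p.2)) p.1 (rotField x₀ p.2 p.1)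
    have ha' : ContDiff ℝ ∞ a' := by
      refine ContDiff.clm_apply ?_ (contDiff_rotField x₀)
      refine ContDiff.fderiv (f := fun (p : Space m × Space m) y ↦ b (y, p.2)) (m := ∞) (n := ∞)
        ?_ contDiff_fst (by simp)
      exact hb.comp (contDiff_snd.prodMk (contDiff_snd.comp contDiff_fst))
    have ha'K : ∀ x ∉ K, ∀ w, a' (x, w) = 0 := fun x hx w ↦ by
      have : (fun y ↦ b (y, w)) =ᶠ[𝓝 x] fun _ ↦ 0 := by
        filter_upwards [hK.isClosed.isOpen_compl.mem_nhds hx] with y hy using hbK y hy w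
      simp [a', this.fderiv_eq]
    obtain ⟨B, hB, hbd⟩ := ih a' ha' ha'K
    refine ⟨B / (2 * Real.pi), by positivity, fun w hw t ht h E hh hrot hh1 hhE hE ↦ ?_⟩
    set e : Space m → ℂ := (osc (-(t • w)) : Space m → ℂ)
    have he : ContDiff ℝ ∞ e := SmoothFun.contDiff _
    have hbw : ContDiff ℝ ∞ fun x ↦ b (x, w) := hb.comp (contDiff_id.prodMk contDiff_const)
    have hbc : HasCompactSupport fun x ↦ b (x, w) :=
      HasCompactSupport.intro hK fun x hx ↦ hbK x hx w
    have haw : ContDiff ℝ ∞ fun x ↦ a (x, w) := ha.comp (contDiff_id.prodMk contDiff_const)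
    have hac : HasCompactSupport fun x ↦ a (x, w) :=
      HasCompactSupport.intro hK fun x hx ↦ haK x hx w
    have ha'w : ContDiff ℝ ∞ fun x ↦ a' (x, w) := ha'.comp (contDiff_id.prodMk contDiff_const)
    have ha'c : HasCompactSupport fun x ↦ a' (x, w) :=
      HasCompactSupport.intro hK fun x hx ↦ ha'K x hx w
    -- Integration by parts along a divergence-free field which annihilates `h`: differentiating the
    -- phase returns `t a`, and differentiating `b` gives the new amplitude `a'`. One power of `t`
    -- is gained, and no derivative of `h` appears.
    have hI := integral_fderiv_rotField x₀ w (F := fun x ↦ e x * (b (x, w) * h x))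
      (he.mul (hbw.mul hh)) (hbc.mul_right.mul_left)
    have hder : ∀ x, fderiv ℝ (fun x ↦ e x * (b (x, w) * h x)) x (rotField x₀ w x) =
        (2 * Real.pi * t * Complex.I) * (e x * (a (x, w) * h x)) + e x * (a' (x, w) * h x) := by
      intro x
      have h1 : HasFDerivAt e _ x := hasFDerivAt_osc (-(t • w)) x
      have h2 : HasFDerivAt (fun x ↦ b (x, w)) _ x :=
        (hbw.differentiable (by simp) x).hasFDerivAt
      have h3 := (hh.differentiable (by simp) x).hasFDerivAt
      rw [show fderiv ℝ (fun x ↦ e x * (b (x, w) * h x)) x = _ from (h1.mul (h2.mul h3)).fderiv]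
      simp only [add_apply, smul_apply, smul_eq_mul, hrot,
        ContinuousLinearMap.comp_apply, Complex.ofRealCLM_apply, cov_apply]
      have h4 : inner ℝ (-(t • w)) (rotField x₀ w x) =
          -t * (inner ℝ x₀ x - inner ℝ w x * inner ℝ w x₀) := by
        rw [rotField, inner_neg_left, inner_smul_left, inner_sub_right, inner_smul_right,
          inner_smul_right, real_inner_self_eq_norm_sq, hS1 w hw]
        simp
      have h5 : b (x, w) * ((inner ℝ x₀ x - inner ℝ w x * inner ℝ w x₀ : ℝ) : ℂ) = a (x, w) := by
        by_cases hx : x ∈ K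
        · have := hs1 _ (hS w hw x hx)
          simp only [b]
          rw [mul_right_comm, ← Complex.ofReal_mul, this, Complex.ofReal_one, one_mul]
        · rw [hbK x hx, haK x hx, zero_mul]
      rw [h4, ← h5]
      simp only [a']
      change _ + (b (x, w) * h x) * (e x * _) = _
      push_cast
      ring
    have hint1 : Integrable fun x ↦ e x * (a (x, w) * h x) :=
      (he.mul (haw.mul hh)).continuous.integrable_of_hasCompactSupport hac.mul_right.mul_left
    have hint2 : Integrable fun x ↦ e x * (a' (x, w) * h x) :=
      (he.mul (ha'w.mul hh)).continuous.integrable_of_hasCompactSupport ha'c.mul_right.mul_left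
    simp_rw [hder] at hI
    rw [integral_add (hint1.const_mul _) hint2, integral_const_mul] at hI
    have hnorm : 2 * Real.pi * t * ‖∫ x, e x * (a (x, w) * h x)‖ =
        ‖∫ x, e x * (a' (x, w) * h x)‖ := by
      rw [← norm_neg (∫ x, e x * (a' (x, w) * h x)), ← eq_neg_of_add_eq_zero_left hI, norm_mul]
      simp [abs_of_pos ht, abs_of_pos Real.pi_pos]
    have := hbd w hw t ht h E hh hrot hh1 hhE hE
    change t ^ N * ‖∫ x, e x * (a' (x, w) * h x)‖ ≤ _ at this
    rw [← hnorm] at this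
    rw [div_mul_eq_mul_div, le_div_iff₀ (by positivity)]
    calc _ = t ^ N * (2 * Real.pi * t * ‖∫ x, e x * (a (x, w) * h x)‖) := by
          rw [pow_succ]; ring
      _ ≤ _ := this

end Oscillatory

/-! ### Pairings with differentials of functions concentrated near the sphere -/

section Shell

open FourierTransform

variable {m : ℕ} {Ω : Opens (Space m)}

theorem one_add_pow_le {t : ℝ} (ht : 0 ≤ t) (N : ℕ) : (1 + t) ^ N ≤ 2 ^ N * (1 + t ^ N) := by
  refine (add_pow_le zero_le_one ht N).trans ?_
  rw [one_pow]
  gcongr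
  · norm_num
  · omega

theorem fourierInv_eq_integral_osc (f : Space m → ℂ) (ζ : Space m) :
    𝓕⁻ f ζ = ∫ x, (osc (-ζ) : Space m → ℂ) x * f x := by
  rw [Real.fourierInv_eq]
  refine integral_congr_ae (Eventually.of_forall fun x ↦ ?_)
  simp only [osc_eq_fourierChar, Circle.smul_def, smul_eq_mul, inner_neg_left, neg_neg,
    real_inner_comm]

/-- The derivative is moved to the exponential, where it costs a factor of at most `2π ‖ζ‖`. -/
theorem norm_fourierInv_fderiv_le {g : Space m → ℂ} (hg : ContDiff ℝ ∞ g)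
    (hc : HasCompactSupport g) (i : Fin (m + 1)) (ζ : Space m) :
    ‖𝓕⁻ (fun x ↦ fderiv ℝ g x (stdBasis i)) ζ‖ ≤ 2 * Real.pi * ‖ζ‖ * ‖𝓕⁻ g ζ‖ := by
  have he : ContDiff ℝ ∞ (osc (-ζ) : Space m → ℂ) := SmoothFun.contDiff _
  have hdg : Continuous fun x ↦ fderiv ℝ g x (stdBasis i) :=
    (hg.continuous_fderiv (by simp)).clm_apply continuous_const
  have hdgc : HasCompactSupport fun x ↦ fderiv ℝ g x (stdBasis i) := hc.fderiv_apply ℝ _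
  have hde : Continuous fun x ↦ fderiv ℝ (osc (-ζ) : Space m → ℂ) x (stdBasis i) :=
    (he.continuous_fderiv (by simp)).clm_apply continuous_const
  rw [fourierInv_eq_integral_osc, fourierInv_eq_integral_osc,
    integral_mul_fderiv_eq_neg_fderiv_mul_of_integrable
      ((hde.mul hg.continuous).integrable_of_hasCompactSupport hc.mul_left)
      ((he.continuous.mul hdg).integrable_of_hasCompactSupport hdgc.mul_left)
      ((he.continuous.mul hg.continuous).integrable_of_hasCompactSupport hc.mul_left)
      (fun x _ ↦ he.differentiable (by simp) x) (fun x _ ↦ hg.differentiable (by simp) x)]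
  have : ∀ x, fderiv ℝ (osc (-ζ) : Space m → ℂ) x (stdBasis i) * g x =
      -Complex.I * (cov (-ζ) (stdBasis i) : ℂ) * ((osc (-ζ) : Space m → ℂ) x * g x) := fun x ↦ by
    rw [(hasFDerivAt_osc (-ζ) x).fderiv]
    simp only [smul_apply, smul_eq_mul, ContinuousLinearMap.comp_apply, Complex.ofRealCLM_apply]
    ring
  simp_rw [this]
  rw [integral_const_mul, norm_neg, norm_mul, norm_mul, norm_neg, Complex.norm_I, one_mul,
    Complex.norm_real]
  gcongr
  refine ((cov (-ζ)).le_opNorm _).trans ?_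
  rw [norm_cov, norm_neg]
  simp [stdBasis]

/-- The pairing of a current with an exact form, bounded in terms of Fourier transforms. -/
theorem norm_apply_dTest_le (T : SubtopCurrent Ω) (g φ₁ : TestFun Ω)
    (h1 : ∀ x ∈ tsupport g, φ₁ x = 1) {b : Space m → ℝ} (hb : Integrable b)
    (hbd : ∀ i ζ, 2 * Real.pi * ‖ζ‖ * ‖𝓕⁻ (g : Space m → ℂ) ζ‖ *
      ‖localFourier T φ₁ (coordCovector i) (cov ζ)‖ ≤ b ζ) :
    ‖T (dTest Ω g)‖ ≤ (m + 1) * ∫ ζ, b ζ := by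
  set dg : Fin (m + 1) → SmoothFun m := fun i ↦ ⟨fun x ↦ fderiv ℝ g x (stdBasis i),
    (g.contDiff.fderiv_right (m := ∞) (by simp)).clm_apply contDiff_const⟩
  have hdgc : ∀ i, HasCompactSupport (dg i : Space m → ℂ) := fun i ↦
    g.hasCompactSupport.fderiv_apply ℝ _
  have hsum : dTest Ω g = ∑ i, smulTest φ₁ (coordCovector i) (dg i) := by
    ext1 x
    have : ∀ s : Finset (Fin (m + 1)), (∑ i ∈ s, smulTest φ₁ (coordCovector i) (dg i) :
        TestOneForm Ω) x = ∑ i ∈ s, fderiv ℝ g x (stdBasis i) • coordCovector i := by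
      classical
      intro s
      induction s using Finset.induction_on with
      | empty => simp
      | insert a s ha ih =>
        rw [Finset.sum_insert ha, Finset.sum_insert ha, ← ih]
        refine congrArg₂ (· + ·) (congrArg (fun c : ℂ ↦ c • coordCovector a) ?_) rfl
        change fderiv ℝ g x (stdBasis a) * φ₁ x = _
        by_cases hx : x ∈ tsupport g
        · rw [h1 x hx, mul_one]
        · have : fderiv ℝ g x = 0 :=
            image_eq_zero_of_notMem_tsupport fun h ↦ hx (tsupport_fderiv_subset ℝ h)
          simp [this]
    rw [this, sum_smul_coordCovector, dTest_apply]
  rw [hsum, map_sum]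
  refine (norm_sum_le _ _).trans ?_
  calc _ ≤ ∑ _i : Fin (m + 1), ∫ ζ, b ζ := by
        refine Finset.sum_le_sum fun i _ ↦ ?_
        rw [(apply_smulTest_eq_integral T φ₁ _).2 _ (hdgc i)]
        refine norm_integral_le_of_norm_le hb (Eventually.of_forall fun ζ ↦ ?_)
        rw [norm_mul]
        refine le_trans ?_ (hbd i ζ)
        gcongr
        exact norm_fourierInv_fderiv_le g.contDiff g.hasCompactSupport i ζ
    _ = _ := by simp

/-- A closed conic neighbourhood of the line spanned by `x₀`. -/
def axialCone (x₀ : Space m) (δ : ℝ) : Set (Space m) :=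
  {ζ | ‖ζ - inner ℝ ζ x₀ • x₀‖ ≤ δ * |inner ℝ ζ x₀|}

theorem isClosed_axialCone (x₀ : Space m) (δ : ℝ) : IsClosed (axialCone x₀ δ) := by
  refine isClosed_le ?_ ?_ <;> fun_prop

theorem smul_mem_axialCone {x₀ ζ : Space m} {δ : ℝ} (h : ζ ∈ axialCone x₀ δ) {t : ℝ} (ht : 0 < t) :
    t • ζ ∈ axialCone x₀ δ := by
  simp only [axialCone, mem_ofPred_eq] at h ⊢
  rw [inner_smul_left, conj_trivial, mul_smul, ← smul_sub, norm_smul, abs_mul,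
    Real.norm_of_nonneg ht.le, abs_of_pos ht]
  nlinarith

theorem isCone_uncov_preimage_axialCone (x₀ : Space m) (δ : ℝ) :
    IsCone (uncov ⁻¹' axialCone x₀ δ) := fun η hη t ht ↦ by
  rw [mem_preimage] at hη ⊢
  rw [← cov_uncov η, ← cov_smul, uncov_cov]
  exact smul_mem_axialCone hη ht

/-- A closed conic set which does not meet the conormal bundle of the sphere does not meet a conic
neighbourhood of the normal direction at a given point of the sphere. -/
theorem exists_axialCone {Γ : Set (Space m × Covector m)} (hΓ : IsClosedConic Ω Γ)
    (hdisj : Disjoint Γ (conormalSphere m)) {x₀ : Space m} (hx₀ : ‖x₀‖ = 1) (hx₀Ω : x₀ ∈ Ω) :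
    ∃ U ∈ 𝓝 x₀, ∃ δ : ℝ, 0 < δ ∧ ∀ x ∈ U, ∀ η ∈ uncov ⁻¹' axialCone x₀ δ, (x, η) ∉ Γ := by
  obtain ⟨⟨A, hA, hΓA⟩, hcone⟩ := hΓ
  have key : ∀ σ : ℝ, σ ≠ 0 → (x₀, cov (σ • x₀)) ∉ A := by
    intro σ hσ hmem
    have hne : cov (σ • x₀) ≠ 0 := by
      rw [← norm_ne_zero_iff, norm_cov, norm_smul, hx₀]
      simp [Real.pi_ne_zero, hσ]
    have h1 : (x₀, cov (σ • x₀)) ∈ Γ := by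
      rw [hΓA]
      exact ⟨hmem, hx₀Ω, hne⟩
    refine Set.disjoint_left.1 hdisj h1 ⟨hx₀, hne, fun w hw ↦ ?_⟩
    dsimp only at hw ⊢
    rw [cov_apply, inner_smul_left, hw]
    simp
  have hnear : ∀ σ : ℝ, σ ≠ 0 → ∃ ε > 0, ∀ x, dist x x₀ < ε → ∀ ζ : Space m,
      dist ζ (σ • x₀) < ε → (x, cov ζ) ∉ A := by
    intro σ hσ
    have hop : IsOpen {p : Space m × Space m | (p.1, cov p.2) ∉ A} :=
      hA.isOpen_compl.preimage (continuous_fst.prodMk (continuous_cov.comp continuous_snd))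
    obtain ⟨ε, hε, h⟩ := Metric.isOpen_iff.1 hop (x₀, σ • x₀) (key σ hσ)
    refine ⟨ε, hε, fun x hx ζ hζ ↦ ?_⟩
    have hmem : (x, ζ) ∈ Metric.ball (x₀, σ • x₀) ε := by
      rw [Metric.mem_ball, Prod.dist_eq]
      exact max_lt hx hζ
    exact h hmem
  obtain ⟨ε₁, hε₁, h1⟩ := hnear 1 one_ne_zero
  obtain ⟨ε₂, hε₂, h2⟩ := hnear (-1) (by norm_num)
  refine ⟨Metric.ball x₀ (min ε₁ ε₂), Metric.ball_mem_nhds _ (by positivity), min ε₁ ε₂ / 2,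
    by positivity, fun x hx η hη hmem ↦ ?_⟩
  rw [Metric.mem_ball] at hx
  set ζ := uncov η
  have hηζ : η = cov ζ := (cov_uncov η).symm
  have hη0 : η ≠ 0 := by
    rw [hΓA] at hmem
    exact hmem.2.2
  have hs0 : inner ℝ ζ x₀ ≠ 0 := by
    intro h0
    have h3 : ‖ζ - inner ℝ ζ x₀ • x₀‖ ≤ min ε₁ ε₂ / 2 * |inner ℝ ζ x₀| := hη
    rw [h0, zero_smul, sub_zero, abs_zero, mul_zero, norm_le_zero_iff] at h3
    exact hη0 (by rw [hηζ, h3]; simp [cov])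
  set s := inner ℝ ζ x₀
  have hpos : 0 < |s| := abs_pos.2 hs0
  -- Rescaling by `1 / |s|` moves a vector of the axial cone close to `x₀` or `-x₀`, according to
  -- the sign of `s`. The aperture is half of `min ε₁ ε₂`, so as to obtain a strict inequality.
  have hmem' := hcone _ hmem (|s|⁻¹) (inv_pos.2 hpos)
  rw [hΓA] at hmem'
  have hA' := hmem'.1
  dsimp only at hA'
  rw [hηζ, ← cov_smul] at hA'
  have h3 : ‖ζ - s • x₀‖ ≤ min ε₁ ε₂ / 2 * |s| := hη
  have h4 : ‖|s|⁻¹ • ζ - (|s|⁻¹ * s) • x₀‖ < min ε₁ ε₂ := by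
    rw [mul_smul, ← smul_sub, norm_smul, norm_inv, Real.norm_eq_abs, abs_abs, inv_mul_eq_div,
      div_lt_iff₀ hpos]
    have : 0 < min ε₁ ε₂ := by positivity
    nlinarith
  rcases hs0.lt_or_gt with hneg | hp
  · rw [abs_of_neg hneg, show (-s)⁻¹ * s = -1 by field_simp] at h4
    refine h2 x (hx.trans_le (min_le_right _ _)) _ ?_ (by rw [abs_of_neg hneg] at hA'; exact hA')
    rw [dist_eq_norm]
    exact h4.trans_le (min_le_right _ _)
  · rw [abs_of_pos hp, show s⁻¹ * s = 1 by field_simp] at h4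
    refine h1 x (hx.trans_le (min_le_left _ _)) _ ?_ (by rw [abs_of_pos hp] at hA'; exact hA')
    rw [dist_eq_norm]
    exact h4.trans_le (min_le_left _ _)

/-- The limit itself decays on the cone, which avoids its wavefront set, and the differences
eventually have weighted norm below `1`. -/
theorem TendstoHormander.exists_uniform_decay {F : Type} [NormedAddCommGroup F] [NormedSpace ℝ F]
    [NormedSpace ℂ F] [IsScalarTower ℝ ℂ F] [CompleteSpace F]
    {Γ : Set (Space m × Covector m)} {Tseq : ℕ → 𝓓(Ω, F) →L[ℂ] ℂ} {T : 𝓓(Ω, F) →L[ℂ] ℂ}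
    (hT : TendstoHormander Γ Tseq T) (hΓ : wavefront T ⊆ Γ) {φ : TestFun Ω} {C : Set (Covector m)}
    (hCc : IsClosed C) (hC : IsCone C) (h : ∀ x ∈ tsupport φ, ∀ η ∈ C, (x, η) ∉ Γ) (v : F) (N : ℕ) :
    ∃ B : ℝ, 0 ≤ B ∧ ∀ᶠ j in atTop, ∀ ζ ∈ cov ⁻¹' C,
      (1 + ‖ζ‖) ^ N * ‖localFourier (Tseq j) φ v (cov ζ)‖ ≤ B := by
  have hpow : ∀ k : ℕ, ∃ B : ℝ, 0 ≤ B ∧ ∀ᶠ j in atTop, ∀ ζ ∈ cov ⁻¹' C,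
      ‖ζ‖ ^ k * ‖localFourier (Tseq j) φ v (cov ζ)‖ ≤ B := by
    intro k
    obtain ⟨B, hB, hb⟩ := decaysOn_of_disjoint_wavefront hCc hC
      (fun x hx η hη hw ↦ h x hx η hη (hΓ hw)) v k
    refine ⟨(2 * Real.pi) ^ k * B + 1, by positivity, ?_⟩
    filter_upwards [Metric.tendstoUniformlyOn_iff.1 (hT.decay φ C hCc hC h v k) 1 one_pos]
      with j hj ζ hζ
    have h1 := (hj (cov ζ) hζ).le
    rw [dist_comm, dist_eq_norm, ← mul_sub, norm_mul, norm_pow, Complex.norm_real, norm_norm] at h1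
    have h2 : ‖cov ζ‖ ^ k * ‖localFourier T φ v (cov ζ)‖ ≤ (2 * Real.pi) ^ k * B := by
      rw [norm_cov, mul_pow, mul_assoc]
      refine mul_le_mul_of_nonneg_left (le_trans ?_ (hb ζ hζ)) (by positivity)
      gcongr
      linarith
    calc ‖ζ‖ ^ k * ‖localFourier (Tseq j) φ v (cov ζ)‖
        ≤ ‖cov ζ‖ ^ k * (‖localFourier T φ v (cov ζ)‖ +
          ‖localFourier (Tseq j) φ v (cov ζ) - localFourier T φ v (cov ζ)‖) := by
          gcongr
          · exact norm_le_norm_cov ζ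
          · exact norm_le_norm_add_norm_sub' _ _
      _ ≤ _ := by rw [mul_add]; exact add_le_add h2 h1
  obtain ⟨B, hB, hb⟩ := hpow N
  obtain ⟨B', hB', hb'⟩ := hpow 0
  refine ⟨2 ^ N * (B' + B), by positivity, ?_⟩
  filter_upwards [hb, hb'] with j hj hj' ζ hζ
  have h1 := hj ζ hζ
  have h2 := hj' ζ hζ
  rw [pow_zero, one_mul] at h2
  calc _ ≤ 2 ^ N * (1 + ‖ζ‖ ^ N) * ‖localFourier (Tseq j) φ v (cov ζ)‖ := by
        gcongr
        exact one_add_pow_le (norm_nonneg ζ) N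
    _ = 2 ^ N * (‖localFourier (Tseq j) φ v (cov ζ)‖ +
        ‖ζ‖ ^ N * ‖localFourier (Tseq j) φ v (cov ζ)‖) := by ring
    _ ≤ _ := by gcongr

/-- A spherical shell of the unit ball. -/
def shell (m : ℕ) (ε : ℝ) : Set (Space m) := {x | 1 - ε ≤ ‖x‖ ^ 2 ∧ ‖x‖ ^ 2 ≤ 1}

theorem volume_shell_lt_top (ε : ℝ) : volume (shell m ε) < ⊤ := by
  refine (measure_mono fun x hx ↦ ?_).trans_lt
    (measure_closedBall_lt_top (μ := volume) (x := (0 : Space m)) (r := 1))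
  rw [mem_closedBall_zero_iff]
  nlinarith [hx.2, norm_nonneg x]

/-- Smooth functions which are invariant under rotations, bounded by `1` and supported in a
shell. -/
structure IsShellFun (ε : ℝ) (h : SmoothFun m) : Prop where
  rot : ∀ x₀ w x, fderiv ℝ (h : Space m → ℂ) x (rotField x₀ w x) = 0
  norm_le : ∀ x, ‖(h : Space m → ℂ) x‖ ≤ 1
  eq_zero : ∀ x ∉ shell m ε, (h : Space m → ℂ) x = 0

theorem tsupport_smulTest_subset (φ : TestFun Ω) (f : SmoothFun m) :
    tsupport (smulTest φ (1 : ℂ) f) ⊆ tsupport φ :=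
  closure_mono fun x hx h ↦ hx (by rw [smulTest_apply, h, mul_zero, zero_smul])

/-- By Pythagoras the right-hand side is the squared distance of `w` from the axis, and also the
derivative of the phase at `x₀`. The factor `2` leaves half of it as a margin for moving `x` away
from `x₀`. -/
theorem axialCone_angle {x₀ w : Space m} {δ : ℝ} (hδ : 0 < δ) (hx₀ : ‖x₀‖ = 1) (hw : ‖w‖ = 1)
    (h : w ∉ axialCone x₀ δ) : 2 * (δ ^ 2 / (2 * (1 + δ ^ 2))) ≤ 1 - inner ℝ w x₀ ^ 2 := by
  have h1 : δ * |inner ℝ w x₀| < ‖w - inner ℝ w x₀ • x₀‖ := not_le.1 h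
  have h2 : ‖w - inner ℝ w x₀ • x₀‖ ^ 2 = 1 - inner ℝ w x₀ ^ 2 := by
    rw [norm_sub_sq_real, inner_smul_right, norm_smul, hx₀, hw, Real.norm_eq_abs, mul_one, sq_abs]
    ring
  have h3 : δ ^ 2 * inner ℝ w x₀ ^ 2 < 1 - inner ℝ w x₀ ^ 2 := by
    rw [← h2, ← sq_abs (inner ℝ w x₀), ← mul_pow]
    gcongr
  rw [show 2 * (δ ^ 2 / (2 * (1 + δ ^ 2))) = δ ^ 2 / (1 + δ ^ 2) by field_simp,
    div_le_iff₀ (by positivity)]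
  nlinarith

/-- Decay of the Fourier transforms of shell functions off the normal direction. -/
theorem exists_fourierInv_shell_bound {x₀ : Space m} (hx₀ : ‖x₀‖ = 1) {δ : ℝ} (hδ : 0 < δ) :
    ∃ U ∈ 𝓝 x₀, ∀ ψ : TestFun Ω, tsupport ψ ⊆ U → ∀ N : ℕ, ∃ B : ℝ, 0 ≤ B ∧ ∀ ε h,
      IsShellFun ε h → ∀ ζ ∉ axialCone x₀ δ,
        (1 + ‖ζ‖) ^ N * ‖𝓕⁻ (smulTest ψ (1 : ℂ) h : Space m → ℂ) ζ‖ ≤ B * volume.real (shell m ε) := by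
  set c : ℝ := δ ^ 2 / (2 * (1 + δ ^ 2))
  have hc : 0 < c := by positivity
  set S : Set (Space m) := {w | ‖w‖ = 1 ∧ w ∉ axialCone x₀ δ}
  -- Moving `x` from `x₀` by `c / 2` changes each of the two terms of the derivative of the phase by
  -- at most `c / 2`, so `c` remains of the `2c` available at `x₀`.
  refine ⟨Metric.closedBall x₀ (c / 2), Metric.closedBall_mem_nhds _ (by positivity),
    fun ψ hψ N ↦ ?_⟩
  have hS : ∀ w ∈ S, ∀ x ∈ tsupport ψ, c ≤ inner ℝ x₀ x - inner ℝ w x * inner ℝ w x₀ := by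
    intro w hw x hx
    have h1 := axialCone_angle hδ hx₀ hw.1 hw.2
    have h2 : ‖x - x₀‖ ≤ c / 2 := by simpa [dist_eq_norm] using hψ hx
    have h3 : |inner ℝ x₀ (x - x₀)| ≤ c / 2 := by
      refine (abs_real_inner_le_norm _ _).trans ?_
      rwa [hx₀, one_mul]
    have h4 : |inner ℝ w (x - x₀) * inner ℝ w x₀| ≤ c / 2 := by
      rw [abs_mul]
      calc _ ≤ (‖w‖ * ‖x - x₀‖) * (‖w‖ * ‖x₀‖) := by
            gcongr <;> exact abs_real_inner_le_norm _ _
        _ ≤ c / 2 := by rw [hw.1, hx₀]; linarith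
    have h5 : inner ℝ x₀ x - inner ℝ w x * inner ℝ w x₀ = (1 - inner ℝ w x₀ ^ 2) +
        inner ℝ x₀ (x - x₀) - inner ℝ w (x - x₀) * inner ℝ w x₀ := by
      rw [inner_sub_right, inner_sub_right, real_inner_self_eq_norm_sq, hx₀]
      ring
    rw [h5]
    have := neg_abs_le (inner ℝ x₀ (x - x₀))
    have := le_abs_self (inner ℝ w (x - x₀) * inner ℝ w x₀)
    linarith
  have ha : ContDiff ℝ ∞ fun p : Space m × Space m ↦ ψ p.1 := ψ.contDiff.comp contDiff_fst
  have haK : ∀ x ∉ tsupport ψ, ∀ w : Space m, ψ (x, w).1 = 0 := fun x hx _ ↦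
    image_eq_zero_of_notMem_tsupport hx
  obtain ⟨B₀, hB₀, h₀⟩ := exists_oscillatory_bound ψ.hasCompactSupport hc (S := S)
    (fun w hw ↦ hw.1) hS 0 _ ha haK
  obtain ⟨B, hB, h₁⟩ := exists_oscillatory_bound ψ.hasCompactSupport hc (S := S)
    (fun w hw ↦ hw.1) hS N _ ha haK
  refine ⟨2 ^ N * (B₀ + B), by positivity, fun ε h hh ζ hζ ↦ ?_⟩
  have hζ0 : 0 < ‖ζ‖ := by
    rw [norm_pos_iff]
    rintro rfl
    exact hζ (by simp [axialCone])
  have hw : ‖ζ‖⁻¹ • ζ ∈ S := by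
    refine ⟨by simp [norm_smul, hζ0.ne'], fun h ↦ hζ ?_⟩
    have := smul_mem_axialCone h hζ0
    rwa [smul_smul, mul_inv_cancel₀ hζ0.ne', one_smul] at this
  have hζw : ‖ζ‖ • (‖ζ‖⁻¹ • ζ) = ζ := by rw [smul_smul, mul_inv_cancel₀ hζ0.ne', one_smul]
  have heq : 𝓕⁻ (smulTest ψ (1 : ℂ) h : Space m → ℂ) ζ =
      ∫ x, (osc (-ζ) : Space m → ℂ) x * (ψ x * (h : Space m → ℂ) x) := by
    rw [fourierInv_eq_integral_osc]
    simp [mul_comm]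
  have h2 := h₀ _ hw ‖ζ‖ hζ0 h (shell m ε) (SmoothFun.contDiff h) (hh.rot x₀) hh.norm_le hh.eq_zero
    (volume_shell_lt_top ε)
  have h3 := h₁ _ hw ‖ζ‖ hζ0 h (shell m ε) (SmoothFun.contDiff h) (hh.rot x₀) hh.norm_le hh.eq_zero
    (volume_shell_lt_top ε)
  rw [hζw, ← heq] at h2 h3
  rw [pow_zero, one_mul] at h2
  calc _ ≤ 2 ^ N * (1 + ‖ζ‖ ^ N) * ‖𝓕⁻ (smulTest ψ (1 : ℂ) h : Space m → ℂ) ζ‖ := by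
        gcongr
        exact one_add_pow_le (norm_nonneg ζ) N
    _ = 2 ^ N * (‖𝓕⁻ (smulTest ψ (1 : ℂ) h : Space m → ℂ) ζ‖ +
        ‖ζ‖ ^ N * ‖𝓕⁻ (smulTest ψ (1 : ℂ) h : Space m → ℂ) ζ‖) := by ring
    _ ≤ 2 ^ N * (B₀ * volume.real (shell m ε) + B * volume.real (shell m ε)) := by gcongr
    _ = _ := by ring

/-- The trivial estimate by the supremum times the volume, for the normal directions, where nothing
better holds uniformly in the shell functions. -/
theorem exists_fourierInv_shell_bound_const (ψ : TestFun Ω) : ∃ B : ℝ, 0 ≤ B ∧ ∀ ε h,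
    IsShellFun ε h → ∀ ζ, ‖𝓕⁻ (smulTest ψ (1 : ℂ) h : Space m → ℂ) ζ‖ ≤ B * volume.real (shell m ε) := by
  obtain ⟨B, hB⟩ := ψ.hasCompactSupport.exists_bound_of_continuous ψ.contDiff.continuous
  refine ⟨B, (norm_nonneg _).trans (hB 0), fun ε h hh ζ ↦ ?_⟩
  rw [fourierInv_eq_integral_osc, ← setIntegral_eq_integral_of_forall_compl_eq_zero
    (s := shell m ε) (fun x hx ↦ by simp [hh.eq_zero x hx])]
  refine norm_setIntegral_le_of_norm_le_const (volume_shell_lt_top ε) fun x _ ↦ ?_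
  rw [norm_mul, norm_osc, one_mul, smulTest_apply, smul_eq_mul, mul_one, norm_mul]
  calc _ ≤ 1 * B := by
        gcongr
        exacts [hh.norm_le x, hB x]
    _ = B := one_mul B

/-- The pairing of a convergent sequence in `𝓓'_Γ` with the differentials of shell functions is
bounded by the volume of the shell, uniformly in the sequence. -/
theorem exists_shell_estimate {Γ : Set (Space m × Covector m)} (hΓ : IsClosedConic Ω Γ)
    (hdisj : Disjoint Γ (conormalSphere m)) {Tseq : ℕ → SubtopCurrent Ω} {T : SubtopCurrent Ω}
    (hT : TendstoHormander Γ Tseq T) (hWF : wavefront T ⊆ Γ) (ψ : TestFun Ω) :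
    ∃ (D ε₀ : ℝ), 0 < ε₀ ∧ ∀ᶠ j in atTop, ∀ ε ≤ ε₀, ∀ h, IsShellFun ε h →
      ‖Tseq j (dTest Ω (smulTest ψ (1 : ℂ) h))‖ ≤ D * volume.real (shell m ε) := by
  refine testFun_induction (P := fun ψ ↦ ∃ (D ε₀ : ℝ), 0 < ε₀ ∧ ∀ᶠ j in atTop, ∀ ε ≤ ε₀, ∀ h,
    IsShellFun ε h → ‖Tseq j (dTest Ω (smulTest ψ (1 : ℂ) h))‖ ≤ D * volume.real (shell m ε))
    ψ ?_ ?_ fun x₀ hx₀ ↦ ?_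
  · refine ⟨0, 1, one_pos, Eventually.of_forall fun j ε _ h _ ↦ ?_⟩
    have : smulTest (0 : TestFun Ω) (1 : ℂ) h = 0 := by
      ext x
      change (_ * (0 : ℂ)) • (1 : ℂ) = 0
      simp
    simp [this]
  · rintro f g ⟨D, ε₀, hε₀, hD⟩ ⟨D', ε₁, hε₁, hD'⟩
    refine ⟨D + D', min ε₀ ε₁, by positivity, ?_⟩
    filter_upwards [hD, hD'] with j hj hj' ε hε h hh
    have : smulTest (f + g) (1 : ℂ) h = smulTest f 1 h + smulTest g 1 h := by
      ext x
      change (_ * (f x + g x)) • (1 : ℂ) = (_ * f x) • 1 + (_ * g x) • 1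
      rw [mul_add, add_smul]
    rw [this, map_add, map_add, add_mul]
    exact (norm_add_le _ _).trans (add_le_add (hj ε (hε.trans (min_le_left _ _)) h hh)
      (hj' ε (hε.trans (min_le_right _ _)) h hh))
  have hx₀Ω : x₀ ∈ Ω := ψ.tsupport_subset hx₀
  by_cases hnorm : ‖x₀‖ = 1
  · obtain ⟨U, hU, δ, hδ, hUΓ⟩ := exists_axialCone hΓ hdisj hnorm hx₀Ω
    obtain ⟨U', hU', hdecay⟩ := exists_fourierInv_shell_bound (Ω := Ω) hnorm hδ
    obtain ⟨φ₁, hφ₁U, hφ₁⟩ := exists_cutoff Ω (isCompact_singleton (x := x₀))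
      (U := interior U ∩ Ω) (isOpen_interior.inter Ω.isOpen)
      (singleton_subset_iff.2 ⟨mem_interior_iff_mem_nhds.2 hU, hx₀Ω⟩) inter_subset_right
    rw [nhdsSet_singleton] at hφ₁
    refine ⟨U' ∩ {x | φ₁ x = 1}, inter_mem hU' hφ₁, fun ψ' hψ' _ ↦ ?_⟩
    -- Weak convergence makes the sequence pointwise bounded, so Banach–Steinhaus gives one
    -- polynomial bound for all its members.
    choose M A hA hM using fun i : Fin (m + 1) ↦ exists_polynomial_bound_localFourier Tseq
      (fun α ↦ by
        obtain ⟨C, hC⟩ := (hT.weak α).norm.bddAbove_range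
        exact ⟨C, fun j ↦ hC ⟨j, rfl⟩⟩) φ₁ (coordCovector i)
    -- Of the `m + 3` powers, `m + 2` make the integral over `ζ` converge and one pays for the
    -- differential of the shell function.
    choose B hB hb using fun i : Fin (m + 1) ↦ hT.exists_uniform_decay hWF (φ := φ₁)
      ((isClosed_axialCone x₀ δ).preimage continuous_uncov) (isCone_uncov_preimage_axialCone x₀ δ)
      (fun x hx ↦ hUΓ x (interior_subset (hφ₁U hx).1)) (coordCovector i) (m + 3)
    choose B' hB' hb' using fun i : Fin (m + 1) ↦
      hdecay ψ' (hψ'.trans inter_subset_left) (M i + (m + 3))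
    obtain ⟨B₀, hB₀, hb₀⟩ := exists_fourierInv_shell_bound_const ψ'
    set D : ℝ := ∑ i, (2 * Real.pi) * (B₀ * B i + B' i * A i)
    refine ⟨(m + 1) * (D * ∫ ζ : Space m, weight ζ), 1, one_pos, ?_⟩
    filter_upwards [eventually_all.2 hb] with j hj ε _ h hh
    refine (norm_apply_dTest_le (Tseq j) (smulTest ψ' (1 : ℂ) h) φ₁
      (fun x hx ↦ (hψ' (tsupport_smulTest_subset ψ' h hx)).2)
      (b := fun ζ ↦ D * volume.real (shell m ε) * weight ζ) (integrable_weight.const_mul _)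
      fun i ζ ↦ ?_).trans_eq (by rw [integral_const_mul]; ring)
    have hle : 2 * Real.pi * (B₀ * B i + B' i * A i) ≤ D :=
      Finset.single_le_sum (f := fun i ↦ (2 * Real.pi) * (B₀ * B i + B' i * A i))
        (fun k _ ↦ mul_nonneg (by positivity)
          (add_nonneg (mul_nonneg hB₀ (hB k)) (mul_nonneg (hB' k) (hA k)))) (Finset.mem_univ i)
    have hv : 0 ≤ volume.real (shell m ε) := measureReal_nonneg
    have hpos : (0 : ℝ) ≤ B₀ * B i := mul_nonneg hB₀ (hB i)
    have hpos' : (0 : ℝ) ≤ B' i * A i := mul_nonneg (hB' i) (hA i)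
    refine le_mul_weight ?_
    refine le_trans ?_ (mul_le_mul_of_nonneg_right hle hv)
    set X := ‖𝓕⁻ (smulTest ψ' (1 : ℂ) h : Space m → ℂ) ζ‖
    set Y := ‖localFourier (Tseq j) φ₁ (coordCovector i) (cov ζ)‖
    have hX : 0 ≤ X := norm_nonneg _
    have hY : 0 ≤ Y := norm_nonneg _
    have hstep : (1 + ‖ζ‖) ^ (m + 2) * (2 * Real.pi * ‖ζ‖ * X * Y) ≤
        2 * Real.pi * ((1 + ‖ζ‖) ^ (m + 3) * (X * Y)) := by
      rw [pow_succ (1 + ‖ζ‖) (m + 2)]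
      calc _ = 2 * Real.pi * ((1 + ‖ζ‖) ^ (m + 2) * ‖ζ‖ * (X * Y)) := by ring
        _ ≤ _ := by
          gcongr
          linarith
    refine hstep.trans ?_
    rw [mul_assoc (2 * Real.pi)]
    refine mul_le_mul_of_nonneg_left ?_ (by positivity)
    -- In the axial cone the current decays; outside of it the shell function decays, with `M i`
    -- powers to spare for the growth of the current. Each case yields one factor of the volume of
    -- the shell.
    by_cases hζ : ζ ∈ axialCone x₀ δ
    · have h1 := hj i ζ (by rw [mem_preimage, mem_preimage, uncov_cov]; exact hζ)
      calc _ = X * ((1 + ‖ζ‖) ^ (m + 3) * Y) := by ring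
        _ ≤ (B₀ * volume.real (shell m ε)) * B i := by
          gcongr
          exact hb₀ ε h hh ζ
        _ = B₀ * B i * volume.real (shell m ε) := by ring
        _ ≤ _ := by gcongr; linarith
    · have h1 := hb' i ε h hh ζ hζ
      calc _ ≤ (1 + ‖ζ‖) ^ (m + 3) * (X * (A i * (1 + ‖ζ‖) ^ M i)) := by
            gcongr
            exact hM i j ζ
        _ = ((1 + ‖ζ‖) ^ (M i + (m + 3)) * X) * A i := by rw [pow_add]; ring
        _ ≤ (B' i * volume.real (shell m ε)) * A i := by
          have := hA i
          gcongr
        _ = B' i * A i * volume.real (shell m ε) := by ring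
        _ ≤ _ := by gcongr; linarith
  -- A point off the sphere has a neighbourhood which all sufficiently thin shells avoid.
  · have hout : ∃ U ∈ 𝓝 x₀, ∃ ε₀ : ℝ, 0 < ε₀ ∧ ∀ x ∈ U, x ∉ shell m ε₀ := by
      have hc : Tendsto (fun x : Space m ↦ ‖x‖ ^ 2) (𝓝 x₀) (𝓝 (‖x₀‖ ^ 2)) :=
        (continuous_norm.pow 2).tendsto x₀
      rcases lt_or_gt_of_ne hnorm with hlt | hgt
      · have h1 : ‖x₀‖ ^ 2 < 1 := by nlinarith [norm_nonneg x₀]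
        refine ⟨_, hc.eventually_lt_const (show ‖x₀‖ ^ 2 < 1 - (1 - ‖x₀‖ ^ 2) / 2 by linarith),
          (1 - ‖x₀‖ ^ 2) / 2, by linarith, fun x hx hxs ↦ ?_⟩
        exact (not_le.2 hx) hxs.1
      · have h1 : 1 < ‖x₀‖ ^ 2 := by nlinarith [norm_nonneg x₀]
        exact ⟨_, hc.eventually_const_lt h1, 1, one_pos, fun x hx hxs ↦ (not_le.2 hx) hxs.2⟩
    obtain ⟨U, hU, ε₀, hε₀, hUs⟩ := hout
    refine ⟨U, hU, fun ψ' hψ' _ ↦ ⟨0, ε₀, hε₀, Eventually.of_forall fun j ε hε h hh ↦ ?_⟩⟩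
    have : smulTest ψ' (1 : ℂ) h = 0 := by
      ext x
      rw [smulTest_apply]
      change _ = (0 : ℂ)
      by_cases hx : x ∈ tsupport ψ'
      · rw [hh.eq_zero x fun hxs ↦ hUs x (hψ' hx) ⟨by linarith [hxs.1], hxs.2⟩, zero_mul, zero_smul]
      · rw [image_eq_zero_of_notMem_tsupport hx, mul_zero, zero_smul]
    simp [this]

end Shell

/-! ### The integral over the sphere as a limit of pairings with cutoffs -/

section Sphere

variable {m : ℕ}

/-- Polar coordinates, for the product of a function of the radius and a function of the direction.
-/
theorem integral_radial_mul {𝕜 : Type*} [RCLike 𝕜] (a : ℝ → 𝕜) (f : Space m → 𝕜) :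
    ∫ x : Space m, a ‖x‖ * f (‖x‖⁻¹ • x) =
      (∫ w : Metric.sphere (0 : Space m) 1, f w ∂(volume : Measure (Space m)).toSphere) *
        ∫ r in Ioi (0 : ℝ), r ^ m • a r := by
  have hdim : Module.finrank ℝ (Space m) - 1 = m := by simp
  calc ∫ x : Space m, a ‖x‖ * f (‖x‖⁻¹ • x) = ∫ x : ({(0)}ᶜ : Set (Space m)),
        a ‖x.1‖ * f (‖x.1‖⁻¹ • x.1) ∂(volume.comap Subtype.val) := by
        rw [integral_subtype_comap (measurableSet_singleton _).compl
          fun x : Space m ↦ a ‖x‖ * f (‖x‖⁻¹ • x), restrict_compl_singleton]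
    _ = ∫ p : Metric.sphere (0 : Space m) 1 × Ioi (0 : ℝ), f p.1 * a p.2
        ∂(volume : Measure (Space m)).toSphere.prod (.volumeIoiPow m) := by
      have := (volume : Measure (Space m)).measurePreserving_homeomorphUnitSphereProd.integral_comp
        (Homeomorph.measurableEmbedding _)
        fun p : Metric.sphere (0 : Space m) 1 × Ioi (0 : ℝ) ↦ f p.1 * a p.2
      rw [hdim] at this
      rw [← this]
      refine integral_congr_ae (Eventually.of_forall fun x ↦ ?_)
      simp [mul_comm]
    _ = _ := by
      rw [integral_prod_mul (fun w : Metric.sphere (0 : Space m) 1 ↦ f w)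
        fun r : Ioi (0 : ℝ) ↦ a r]
      congr 1
      simp only [Measure.volumeIoiPow, ENNReal.ofReal]
      rw [integral_withDensity_eq_integral_smul,
        integral_subtype_comap measurableSet_Ioi fun r ↦ Real.toNNReal (r ^ m) • a r,
        setIntegral_congr_fun measurableSet_Ioi fun x hx ↦ ?_]
      · rw [NNReal.smul_def, Real.coe_toNNReal _ (pow_nonneg hx.out.le _)]
      · exact (measurable_subtype_coe.pow_const _).real_toNNReal

/-- The profile of the cutoffs which approach the indicator function of the ball. -/
def profile (k : ℕ) (s : ℝ) : ℝ := Real.smoothTransition ((k + 2) * (1 - s))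

theorem contDiff_profile (k : ℕ) : ContDiff ℝ ∞ (profile k) :=
  (Real.smoothTransition.contDiff (n := ⊤)).comp
    (contDiff_const.mul (contDiff_const.sub contDiff_id))

theorem profile_eq_zero (k : ℕ) {s : ℝ} (hs : 1 ≤ s) : profile k s = 0 := by
  refine Real.smoothTransition.zero_of_nonpos ?_
  have : (0 : ℝ) < k + 2 := by positivity
  nlinarith

theorem profile_eq_one (k : ℕ) {s : ℝ} (hs : s ≤ 1 - 1 / (k + 2 : ℝ)) : profile k s = 1 := by
  refine Real.smoothTransition.one_of_one_le ?_
  have h : (0 : ℝ) < k + 2 := by positivity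
  calc (1 : ℝ) = (k + 2) * (1 / (k + 2)) := by field_simp
    _ ≤ _ := by gcongr; linarith

theorem antitone_profile (k : ℕ) : Antitone (profile k) := fun s t hst ↦
  Real.smoothTransition.monotone (by gcongr)

theorem deriv_profile_nonpos (k : ℕ) (s : ℝ) : deriv (profile k) s ≤ 0 :=
  (antitone_profile k).deriv_nonpos

theorem deriv_profile_eq_zero (k : ℕ) {s : ℝ} (hs : s < 1 - 1 / (k + 2 : ℝ) ∨ 1 < s) :
    deriv (profile k) s = 0 := by
  rcases hs with hs | hs
  · have : profile k =ᶠ[𝓝 s] fun _ ↦ 1 := by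
      filter_upwards [eventually_lt_nhds hs] with t ht using profile_eq_one k ht.le
    rw [this.deriv_eq, deriv_const]
  · have : profile k =ᶠ[𝓝 s] fun _ ↦ 0 := by
      filter_upwards [eventually_gt_nhds hs] with t ht using profile_eq_zero k ht.le
    rw [this.deriv_eq, deriv_const]

/-- The integrand is the derivative of `r ↦ profile k (r ^ 2)`, which falls from `1` at the origin
to `0`. -/
theorem integral_deriv_profile (k : ℕ) :
    ∫ r in Ioi (0 : ℝ), 2 * r * deriv (profile k) (r ^ 2) = -1 := by
  have hd : ∀ r : ℝ, HasDerivAt (fun r ↦ profile k (r ^ 2)) (2 * r * deriv (profile k) (r ^ 2)) r := by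
    intro r
    have h1 := ((contDiff_profile k).differentiable (by simp) (r ^ 2)).hasDerivAt
    have h2 : HasDerivAt (fun r : ℝ ↦ r ^ 2) (2 * r) r := by simpa using hasDerivAt_pow 2 r
    rw [mul_comm]
    exact HasDerivAt.comp (h := fun r : ℝ ↦ r ^ 2) r h1 h2
  have hcont : Continuous fun r : ℝ ↦ 2 * r * deriv (profile k) (r ^ 2) := by
    have := (contDiff_profile k).continuous_deriv (by simp)
    fun_prop
  have hsupp : HasCompactSupport fun r : ℝ ↦ 2 * r * deriv (profile k) (r ^ 2) := by
    refine HasCompactSupport.intro (isCompact_Icc (a := (-1 : ℝ)) (b := 1)) fun r hr ↦ ?_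
    rw [deriv_profile_eq_zero k (Or.inr _), mul_zero]
    by_contra h
    rw [not_lt, sq_le_one_iff_abs_le_one, abs_le] at h
    exact hr h
  rw [integral_Ioi_of_hasDerivAt_of_tendsto' (fun r _ ↦ hd r)
    (hcont.integrable_of_hasCompactSupport hsupp).integrableOn (m := 0) ?_]
  · rw [profile_eq_one]
    · norm_num
    · have : 1 / (k + 2 : ℝ) ≤ 1 := by
        rw [div_le_one (by positivity)]
        linarith [(Nat.cast_nonneg k : (0 : ℝ) ≤ k)]
      simpa using this
  · refine tendsto_const_nhds.congr' ?_
    filter_upwards [eventually_ge_atTop 1] with r hr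
    rw [profile_eq_zero k (by nlinarith)]

/-- Cutoffs which approach the indicator function of the unit ball. -/
def sphereCutoff (m k : ℕ) : TestFun (⊤ : Opens (Space m)) where
  toFun x := (profile k (‖x‖ ^ 2) : ℂ)
  contDiff' := Complex.ofRealCLM.contDiff.comp ((contDiff_profile k).comp (contDiff_norm_sq ℝ))
  hasCompactSupport' := by
    refine HasCompactSupport.intro (isCompact_closedBall (0 : Space m) 1) fun x hx ↦ ?_
    rw [mem_closedBall_zero_iff, not_le] at hx
    rw [profile_eq_zero k (by nlinarith), Complex.ofReal_zero]
  tsupport_subset' := subset_univ _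

theorem sphereCutoff_apply (k : ℕ) (x : Space m) :
    sphereCutoff m k x = (profile k (‖x‖ ^ 2) : ℂ) := rfl

theorem sphereCutoff_eventually_eq_one (k : ℕ) : ∀ᶠ x in 𝓝 0, sphereCutoff m k x = 1 := by
  -- With `k + 1` in place of `k + 2` this would fail for `k = 0`, and that cutoff would not be `1`
  -- near the origin.
  have h : (0 : ℝ) < 1 - 1 / (k + 2 : ℝ) := by
    rw [sub_pos, div_lt_one (by positivity)]
    linarith [(Nat.cast_nonneg k : (0 : ℝ) ≤ k)]
  have hc : Tendsto (fun x : Space m ↦ ‖x‖ ^ 2) (𝓝 0) (𝓝 0) := by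
    have : Continuous fun x : Space m ↦ ‖x‖ ^ 2 := by fun_prop
    simpa using this.tendsto 0
  filter_upwards [hc.eventually_lt_const h] with x hx
  rw [sphereCutoff_apply, profile_eq_one k hx.le, Complex.ofReal_one]

theorem hasFDerivAt_profile_norm_sq (k : ℕ) (x : Space m) :
    HasFDerivAt (fun x : Space m ↦ profile k (‖x‖ ^ 2))
      ((2 * deriv (profile k) (‖x‖ ^ 2)) • innerSL ℝ x) x := by
  have h1 := ((contDiff_profile k).differentiable (by simp) (‖x‖ ^ 2)).hasDerivAt
  have h2 := h1.comp_hasFDerivAt x (hasStrictFDerivAt_norm_sq x).hasFDerivAt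
  refine h2.congr_fderiv ?_
  ext y
  simp only [smul_apply, smul_eq_mul, nsmul_eq_mul, Nat.cast_ofNat]
  ring

theorem fderiv_sphereCutoff (k : ℕ) (x : Space m) : fderiv ℝ (sphereCutoff m k) x =
    ((2 * deriv (profile k) (‖x‖ ^ 2) : ℝ) : ℂ) • unitConormal x := by
  have h := Complex.ofRealCLM.hasFDerivAt.comp x (hasFDerivAt_profile_norm_sq k x)
  refine (show HasFDerivAt (sphereCutoff m k : Space m → ℂ) _ x from h).fderiv.trans ?_
  ext y
  simp [unitConormal]

theorem fderiv_sphereCutoff_rotField (k : ℕ) (x₀ w x : Space m) :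
    fderiv ℝ (sphereCutoff m k) x (rotField x₀ w x) = 0 := by
  rw [fderiv_sphereCutoff, smul_apply, unitConormal, ContinuousLinearMap.comp_apply,
    innerSL_apply_apply, inner_rotField_self]
  simp

theorem one_div_add_two_pos (k : ℕ) : 0 < 1 / (k + 2 : ℝ) := by positivity

theorem one_div_add_two_le_half (k : ℕ) : 1 / (k + 2 : ℝ) ≤ 1 / 2 := by
  gcongr
  linarith [(Nat.cast_nonneg k : (0 : ℝ) ≤ k)]

theorem tendsto_one_div_add_two : Tendsto (fun k : ℕ ↦ 1 / (k + 2 : ℝ)) atTop (𝓝 0) := by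
  have := (tendsto_add_atTop_iff_nat 1).2 (tendsto_one_div_add_atTop_nhds_zero_nat (𝕜 := ℝ))
  refine this.congr fun k ↦ ?_
  push_cast
  ring_nf

theorem isCompact_shell (ε : ℝ) : IsCompact (shell m ε) := by
  refine (isCompact_closedBall (0 : Space m) 1).of_isClosed_subset ?_ fun x hx ↦ ?_
  · exact (isClosed_le continuous_const (continuous_norm.pow 2)).inter
      (isClosed_le (continuous_norm.pow 2) continuous_const)
  · rw [mem_closedBall_zero_iff]
    nlinarith [hx.2, norm_nonneg x]

theorem shell_mono {ε ε' : ℝ} (h : ε ≤ ε') : shell m ε ⊆ shell m ε' := fun x hx ↦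
  ⟨by linarith [hx.1], hx.2⟩

theorem shell_subset_punctured {ε : ℝ} (h : ε < 1) : shell m ε ⊆ punctured m := by
  intro x hx h0
  rw [mem_singleton_iff] at h0
  have := hx.1
  rw [h0, norm_zero] at this
  norm_num at this
  linarith

/-- The shells decrease to the unit sphere, which is a null set. -/
theorem tendsto_volume_shell :
    Tendsto (fun k : ℕ ↦ volume.real (shell m (1 / (k + 2 : ℝ)))) atTop (𝓝 0) := by
  have hanti : Antitone fun k : ℕ ↦ shell m (1 / (k + 2 : ℝ)) := fun k l hkl ↦ shell_mono (by gcongr)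
  have hinter : ⋂ k : ℕ, shell m (1 / (k + 2 : ℝ)) = Metric.sphere (0 : Space m) 1 := by
    ext x
    rw [mem_iInter, mem_sphere_zero_iff_norm]
    constructor
    · intro h
      have h1 : 1 ≤ ‖x‖ ^ 2 := by
        have : Tendsto (fun k : ℕ ↦ 1 - 1 / (k + 2 : ℝ)) atTop (𝓝 1) := by
          simpa using tendsto_const_nhds.sub tendsto_one_div_add_two
        exact le_of_tendsto' this fun k ↦ (h k).1
      have h2 := (h 0).2
      nlinarith [norm_nonneg x]
    · intro h k
      have := one_div_add_two_pos k
      simp only [shell, mem_ofPred_eq, h]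
      constructor <;> linarith
  have := tendsto_measure_iInter_atTop (μ := (volume : Measure (Space m)))
    (fun k : ℕ ↦ (isCompact_shell (m := m) (1 / (k + 2 : ℝ))).measurableSet.nullMeasurableSet) hanti
    ⟨0, (volume_shell_lt_top _).ne⟩
  rw [hinter, Measure.addHaar_sphere] at this
  exact (ENNReal.tendsto_toReal ENNReal.zero_ne_top).comp this

/-- The pairings of a smooth form with the differentials of cutoffs which approach the indicator
function of the unit ball. -/
theorem tendsto_currentOfForm_dCutoff {θ : Space m → AltForm m}
    (hθ : ContDiffOn ℝ ∞ θ (punctured m)) :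
    Tendsto (fun k ↦ currentOfForm (punctured m) θ
      (dCutoff (sphereCutoff m k) (sphereCutoff_eventually_eq_one k))) atTop
      (𝓝 (-sphereIntegral θ)) := by
  set F : Space m → ℂ := fun x ↦ topWedge m (unitConormal x) (θ x)
  -- `G` agrees with `F` on the sphere and depends on the radius only through a weight that turns
  -- the Jacobian `r^m` into `r`. Its pairings are then exactly minus the sphere integral for every
  -- `k`, and only the pairing with `F - G` has to be estimated.
  set G : Space m → ℂ := fun x ↦ ((‖x‖ * (‖x‖ ^ m)⁻¹ : ℝ) : ℂ) * F (‖x‖⁻¹ • x)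
  set p : ℕ → ℝ → ℝ := fun k r ↦ 2 * deriv (profile k) (r ^ 2)
  have hF : ContinuousOn F {0}ᶜ := by
    have h1 : Continuous fun x : Space m ↦ topWedge m (unitConormal x) :=
      (topWedge m).continuous.comp
        (by unfold unitConormal; exact continuous_const.clm_comp (innerSL ℝ).continuous)
    exact h1.continuousOn.clm_apply hθ.continuousOn
  have hG : ContinuousOn G {0}ᶜ := by
    refine ContinuousOn.mul (Complex.continuous_ofReal.comp_continuousOn
      (continuous_norm.continuousOn.mul ((continuous_norm.pow m).continuousOn.inv₀ fun x hx ↦ ?_)))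
      (hF.comp ?_ fun x hx ↦ ?_)
    · exact pow_ne_zero _ (norm_ne_zero_iff.2 hx)
    · exact (continuous_norm.continuousOn.inv₀ fun x hx ↦ norm_ne_zero_iff.2 hx).smul
        continuousOn_id
    · exact smul_ne_zero (inv_ne_zero (norm_ne_zero_iff.2 hx)) hx
  have hpair : ∀ k, currentOfForm (punctured m) θ
      (dCutoff (sphereCutoff m k) (sphereCutoff_eventually_eq_one k)) =
      ∫ x, (p k ‖x‖ : ℂ) * F x := fun k ↦ by
    rw [currentOfForm_apply hθ.continuousOn]
    refine integral_congr_ae (Eventually.of_forall fun x ↦ ?_)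
    change topWedge m (fderiv ℝ (sphereCutoff m k) x) (θ x) = _
    rw [fderiv_sphereCutoff, map_smul, smul_apply, smul_eq_mul]
  have hmain : ∀ k, ∫ x, (p k ‖x‖ : ℂ) * G x = -sphereIntegral θ := fun k ↦ by
    have h1 := integral_radial_mul (m := m)
      (fun r ↦ ((p k r * (r * (r ^ m)⁻¹) : ℝ) : ℂ)) F
    have h2 : ∫ r in Ioi (0 : ℝ), r ^ m • ((p k r * (r * (r ^ m)⁻¹) : ℝ) : ℂ) = -1 := by
      have h3 : ∫ r in Ioi (0 : ℝ), ((2 * r * deriv (profile k) (r ^ 2) : ℝ) : ℂ) = -1 := by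
        rw [integral_complex_ofReal, integral_deriv_profile]
        simp
      rw [← h3]
      refine setIntegral_congr_fun measurableSet_Ioi fun r hr ↦ ?_
      have hr' : (r : ℂ) ≠ 0 := Complex.ofReal_ne_zero.2 (ne_of_gt hr)
      simp only [p, Complex.real_smul]
      push_cast
      field_simp
    rw [h2, mul_neg_one] at h1
    rw [sphereIntegral, ← h1]
    refine integral_congr_ae (Eventually.of_forall fun x ↦ ?_)
    simp only [G]
    push_cast
    ring
  set σ : ℝ := ∫ _w : Metric.sphere (0 : Space m) 1, (1 : ℝ) ∂(volume : Measure (Space m)).toSphere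
  have hσ : 0 ≤ σ := integral_nonneg fun _ ↦ zero_le_one
  -- The weighted total mass of the radial derivative does not depend on `k`, so uniform smallness
  -- of `F - G` on thin shells is enough.
  have hmass : ∀ k, ∫ x : Space m, -p k ‖x‖ * (‖x‖ * (‖x‖ ^ m)⁻¹) = σ := fun k ↦ by
    have h1 := integral_radial_mul (m := m) (fun r ↦ -p k r * (r * (r ^ m)⁻¹)) fun _ ↦ (1 : ℝ)
    have h2 : ∫ r in Ioi (0 : ℝ), r ^ m • (-p k r * (r * (r ^ m)⁻¹)) = 1 := by
      have h3 : ∫ r in Ioi (0 : ℝ), -(2 * r * deriv (profile k) (r ^ 2)) = 1 := by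
        rw [integral_neg, integral_deriv_profile, neg_neg]
      rw [← h3]
      refine setIntegral_congr_fun measurableSet_Ioi fun r hr ↦ ?_
      have hr' : r ≠ 0 := ne_of_gt hr
      simp only [p, smul_eq_mul]
      field_simp
    rw [h2, mul_one] at h1
    simp only [mul_one] at h1
    exact h1
  have hp0 : ∀ k : ℕ, ∀ x ∉ shell m (1 / (k + 2 : ℝ)), p k ‖x‖ = 0 := fun k x hx ↦ by
    simp only [p]
    rw [deriv_profile_eq_zero k, mul_zero]
    by_contra h
    push Not at h
    exact hx h
  have hpc : ∀ k, Continuous fun x : Space m ↦ p k ‖x‖ := fun k ↦ by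
    have := (contDiff_profile k).continuous_deriv (by simp)
    simp only [p]
    fun_prop
  have hint : ∀ {X : Type} [NormedRing X] [NormedAlgebra ℝ X] (k) {f : Space m → X},
      ContinuousOn f {0}ᶜ → Integrable fun x ↦ p k ‖x‖ • f x := fun k f hf ↦ by
    have hsub := shell_subset_punctured (m := m) ((one_div_add_two_le_half k).trans_lt one_half_lt_one)
    rw [← integrableOn_iff_integrable_of_support_subset (s := shell m (1 / (k + 2 : ℝ)))]
    · exact ((hpc k).continuousOn.smul (hf.mono hsub)).integrableOn_compact (isCompact_shell _)
    · intro x hx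
      by_contra h
      exact hx (by simp [hp0 k x h])
  have hint' : ∀ k {f : Space m → ℂ}, ContinuousOn f {0}ᶜ →
      Integrable fun x ↦ (p k ‖x‖ : ℂ) * f x := fun k f hf ↦ by
    simpa [Complex.real_smul] using hint k hf
  rw [Metric.tendsto_atTop]
  intro η hη
  -- The factor `2` compensates for the weight, which is at least `1 / 2` on the shell; `σ + 1`
  -- avoids division by zero.
  obtain ⟨δ, hδ, hδE⟩ := Metric.uniformContinuousOn_iff.1
    ((isCompact_shell (m := m) (1 / 2)).uniformContinuousOn_of_continuous
      ((hF.sub hG).mono (shell_subset_punctured one_half_lt_one))) (η / (2 * (σ + 1))) (by positivity)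
  obtain ⟨k₀, hk₀⟩ := eventually_atTop.1 (tendsto_one_div_add_two.eventually_lt_const hδ)
  refine ⟨k₀, fun k hk ↦ ?_⟩
  rw [dist_eq_norm, hpair, ← hmain k, ← integral_sub (hint' k hF) (hint' k hG)]
  have hbound : ∀ x, ‖(p k ‖x‖ : ℂ) * F x - (p k ‖x‖ : ℂ) * G x‖ ≤
      η / (σ + 1) * (-p k ‖x‖ * (‖x‖ * (‖x‖ ^ m)⁻¹)) := by
    intro x
    by_cases hx : x ∈ shell m (1 / (k + 2 : ℝ))
    · have hx2 : x ∈ shell m (1 / 2) := shell_mono (one_div_add_two_le_half k) hx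
      have hx0 : x ≠ 0 := shell_subset_punctured one_half_lt_one hx2
      have hxpos : 0 < ‖x‖ := norm_pos_iff.2 hx0
      have hx1 : ‖x‖ ≤ 1 := by nlinarith [hx.2]
      have hhalf : 1 / 2 ≤ ‖x‖ := by nlinarith [hx2.1]
      have hn : ‖(‖x‖⁻¹ • x)‖ = 1 := by simp [norm_smul, hxpos.ne']
      have hx' : ‖x‖⁻¹ • x ∈ shell m (1 / 2) := by
        simp only [shell, mem_ofPred_eq, hn]
        norm_num
      have hd : dist x (‖x‖⁻¹ • x) < δ := by
        refine lt_of_le_of_lt ?_ (hk₀ k hk)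
        have : x - ‖x‖⁻¹ • x = (1 - ‖x‖⁻¹) • x := by rw [sub_smul, one_smul]
        rw [dist_eq_norm, this, norm_smul, Real.norm_eq_abs, abs_sub_comm, abs_of_nonneg
          (sub_nonneg.2 ((one_le_inv₀ hxpos).2 hx1)), sub_mul, inv_mul_cancel₀ hxpos.ne', one_mul]
        have := hx.1
        nlinarith
      have hE := hδE x hx2 _ hx' hd
      have hG1 : G (‖x‖⁻¹ • x) = F (‖x‖⁻¹ • x) := by
        simp only [G, hn]
        simp
      rw [dist_eq_norm, Pi.sub_apply, Pi.sub_apply, hG1, sub_self, sub_zero] at hE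
      have hp : 0 ≤ -p k ‖x‖ := by
        have := deriv_profile_nonpos k (‖x‖ ^ 2)
        simp only [p]
        linarith
      have hw : 1 / 2 ≤ ‖x‖ * (‖x‖ ^ m)⁻¹ := by
        have : 1 ≤ (‖x‖ ^ m)⁻¹ := (one_le_inv₀ (by positivity)).2 (pow_le_one₀ hxpos.le hx1)
        nlinarith
      rw [← mul_sub, norm_mul, Complex.norm_real, ← norm_neg, Real.norm_of_nonneg hp]
      calc _ ≤ -p k ‖x‖ * (η / (2 * (σ + 1))) := by gcongr
        _ = η / (σ + 1) * (-p k ‖x‖ * (1 / 2)) := by field_simp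
        _ ≤ _ := by gcongr
    · simp [hp0 k x hx]
  have hintR : Integrable fun x : Space m ↦ -p k ‖x‖ * (‖x‖ * (‖x‖ ^ m)⁻¹) := by
    have h := (hint k (f := fun x : Space m ↦ ‖x‖ * (‖x‖ ^ m)⁻¹) (continuous_norm.continuousOn.mul
      ((continuous_norm.pow m).continuousOn.inv₀ fun x hx ↦
        pow_ne_zero _ (norm_ne_zero_iff.2 hx)))).neg
    refine h.congr (Eventually.of_forall fun x ↦ ?_)
    simp
  calc _ ≤ ∫ x : Space m, η / (σ + 1) * (-p k ‖x‖ * (‖x‖ * (‖x‖ ^ m)⁻¹)) :=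
        norm_integral_le_of_norm_le (hintR.const_mul _) (Eventually.of_forall hbound)
    _ = η / (σ + 1) * σ := by rw [integral_const_mul, hmass]
    _ < η := by
      rw [div_mul_eq_mul_div, div_lt_iff₀ (by positivity)]
      nlinarith

/-- The integrals over the unit sphere of smooth forms which converge in `𝓓'_Γ`, where `Γ` does not
meet the conormal bundle of the sphere. -/
theorem tendsto_sphereIntegral {Γ : Set (Space m × Covector m)}
    (hΓ : IsClosedConic (punctured m) Γ) (hdisj : Disjoint Γ (conormalSphere m))
    {T : SubtopCurrent (punctured m)} (hWF : wavefront T ⊆ Γ) {R : ℂ}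
    (hR : ∀ k, T (dCutoff (sphereCutoff m k) (sphereCutoff_eventually_eq_one k)) = R)
    {θ : ℕ → Space m → AltForm m} (hθ : ∀ j, ContDiffOn ℝ ∞ (θ j) (punctured m))
    (hT : TendstoHormander Γ (fun j ↦ currentOfForm (punctured m) (θ j)) T) :
    Tendsto (fun j ↦ sphereIntegral (θ j)) atTop (𝓝 (-R)) := by
  set α : ℕ → TestOneForm (punctured m) := fun k ↦
    dCutoff (sphereCutoff m k) (sphereCutoff_eventually_eq_one k)
  set S : ℕ → SubtopCurrent (punctured m) := fun j ↦ currentOfForm (punctured m) (θ j)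
  -- Differences of the cutoffs are supported in the shell of width `1 / 2`. A single `Ψ`, equal to
  -- `1` there, turns them into test functions on the punctured space of the form treated by the
  -- shell estimate.
  obtain ⟨Ψ, -, hΨ⟩ := exists_cutoff (punctured m) (isCompact_shell (m := m) (1 / 2))
    (punctured m).isOpen (shell_subset_punctured one_half_lt_one) Subset.rfl
  obtain ⟨D, ε₀, hε₀, hD⟩ := exists_shell_estimate hΓ hdisj hT hWF Ψ
  have hvol := (tendsto_volume_shell (m := m)).const_mul D
  rw [mul_zero] at hvol
  have hdiff : ∀ l k : ℕ, l ≤ k → ∃ h : SmoothFun m, IsShellFun (1 / (l + 2 : ℝ)) h ∧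
      α k - α l = dTest (punctured m) (smulTest Ψ (1 : ℂ) h) := by
    intro l k hlk
    refine ⟨TestFun.smooth (sphereCutoff m k) - TestFun.smooth (sphereCutoff m l),
      ⟨fun x₀ w x ↦ ?_, fun x ↦ ?_, fun x hx ↦ ?_⟩, ?_⟩
    · change fderiv ℝ ((sphereCutoff m k : Space m → ℂ) - (sphereCutoff m l : Space m → ℂ)) x _ = 0
      rw [fderiv_sub ((sphereCutoff m k).contDiff.differentiable (by simp) x)
        ((sphereCutoff m l).contDiff.differentiable (by simp) x), sub_apply,
        fderiv_sphereCutoff_rotField, fderiv_sphereCutoff_rotField, sub_zero]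
    · change ‖sphereCutoff m k x - sphereCutoff m l x‖ ≤ 1
      rw [sphereCutoff_apply, sphereCutoff_apply, ← Complex.ofReal_sub, Complex.norm_real,
        Real.norm_eq_abs, abs_sub_le_iff]
      have h1 := Real.smoothTransition.nonneg ((k + 2) * (1 - ‖x‖ ^ 2))
      have h2 := Real.smoothTransition.le_one ((k + 2) * (1 - ‖x‖ ^ 2))
      have h3 := Real.smoothTransition.nonneg ((l + 2) * (1 - ‖x‖ ^ 2))
      have h4 := Real.smoothTransition.le_one ((l + 2) * (1 - ‖x‖ ^ 2))
      simp only [profile]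
      constructor <;> linarith
    · change sphereCutoff m k x - sphereCutoff m l x = 0
      rw [sphereCutoff_apply, sphereCutoff_apply]
      rcases le_total (‖x‖ ^ 2) (1 - 1 / (l + 2 : ℝ)) with h | h
      · rw [profile_eq_one l h, profile_eq_one k (h.trans (by gcongr)), sub_self]
      · have h1 : 1 ≤ ‖x‖ ^ 2 := by
          by_contra h1
          exact hx ⟨h, (not_le.1 h1).le⟩
        rw [profile_eq_zero l h1, profile_eq_zero k h1, sub_self]
    · ext1 x
      rw [dTest_apply]
      have heq : (smulTest Ψ (1 : ℂ) (TestFun.smooth (sphereCutoff m k) -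
          TestFun.smooth (sphereCutoff m l)) : Space m → ℂ) =
          (sphereCutoff m k : Space m → ℂ) - (sphereCutoff m l : Space m → ℂ) := by
        ext y
        change ((sphereCutoff m k y - sphereCutoff m l y) * Ψ y) • (1 : ℂ) =
          sphereCutoff m k y - sphereCutoff m l y
        by_cases hy : y ∈ shell m (1 / 2)
        · rw [hΨ.self_of_nhdsSet y hy]
          simp
        · have h0 : ∀ n : ℕ, sphereCutoff m n y = if ‖y‖ ^ 2 ≤ 1 then 1 else 0 := by
            intro n
            rw [sphereCutoff_apply]
            split_ifs with h
            · rw [profile_eq_one, Complex.ofReal_one]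
              by_contra h2
              have := one_div_add_two_le_half n
              exact hy ⟨by linarith, h⟩
            · rw [profile_eq_zero n (not_le.1 h).le, Complex.ofReal_zero]
          simp [h0]
      rw [heq, fderiv_sub ((sphereCutoff m k).contDiff.differentiable (by simp) x)
        ((sphereCutoff m l).contDiff.differentiable (by simp) x)]
      rfl
  have hlim : ∀ j, Tendsto (fun k ↦ S j (α k)) atTop (𝓝 (-sphereIntegral (θ j))) := fun j ↦
    tendsto_currentOfForm_dCutoff (hθ j)
  rw [Metric.tendsto_atTop']
  intro η hη
  -- Fix `l` with a small shell volume, and only then let `j` be large. The shell estimate, uniform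
  -- in `j` and `k`, survives the limit `k → ∞` and compares the sphere integral of `θ j` with its
  -- pairing with `α l`, which converges to `R`.
  obtain ⟨l, hl1, hl2⟩ := ((hvol.eventually_lt_const (show (0 : ℝ) < η / 2 by positivity)).and
    (tendsto_one_div_add_two.eventually_le_const hε₀)).exists
  have hweak := Metric.tendsto_atTop.1 (hT.weak (α l)) (η / 2) (by positivity)
  obtain ⟨J, hJ⟩ := hweak
  obtain ⟨J', hJ'⟩ := eventually_atTop.1 hD
  refine ⟨max J J', fun j hj ↦ ?_⟩
  have hj1 := hJ j ((le_max_left _ _).trans hj.le)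
  rw [hR l, dist_eq_norm] at hj1
  have hbd : ‖-sphereIntegral (θ j) - S j (α l)‖ ≤
      D * volume.real (shell m (1 / (l + 2 : ℝ))) := by
    refine le_of_tendsto ((hlim j).sub_const _).norm ?_
    filter_upwards [eventually_ge_atTop l] with k hk
    obtain ⟨h, hh, heq⟩ := hdiff l k hk
    rw [← map_sub, heq]
    exact hJ' j ((le_max_right _ _).trans hj.le) _ hl2 h hh
  rw [dist_eq_norm]
  calc ‖sphereIntegral (θ j) - -R‖ = ‖(-sphereIntegral (θ j) - S j (α l)) + (S j (α l) - R)‖ := by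
        rw [← norm_neg]
        congr 1
        ring
    _ ≤ _ := norm_add_le _ _
    _ < η := by linarith

end Sphere

/-! ### Composition operators on spaces of continuous functions -/

section Nemytskii

variable {X : Type} [TopologicalSpace X] [CompactSpace X] {G F : Type} [NormedAddCommGroup G]
  [NormedSpace ℝ G] [NormedAddCommGroup F] [NormedSpace ℝ F]

/-- The pointwise application of a continuous family of linear maps. -/
def applyFamily (A : C(X, G →L[ℝ] F)) (h : C(X, G)) : C(X, F) :=
  ⟨fun x ↦ A x (h x), A.continuous.clm_apply h.continuous⟩

variable (X G F) in
/-- The pointwise application of continuous families of linear maps. -/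
def pointwiseApply : C(X, G →L[ℝ] F) →L[ℝ] C(X, G) →L[ℝ] C(X, F) :=
  LinearMap.mkContinuous₂
    (LinearMap.mk₂ ℝ (applyFamily : C(X, G →L[ℝ] F) → C(X, G) → C(X, F))
      (fun _ _ _ ↦ by ext; simp [applyFamily]) (fun _ _ _ ↦ by ext; simp [applyFamily])
      (fun _ _ _ ↦ by ext; simp [applyFamily]) (fun _ _ _ ↦ by ext; simp [applyFamily]))
    1
    (fun A h ↦ by
      rw [one_mul, ContinuousMap.norm_le _ (by positivity)]
      intro x
      exact (A x).le_of_opNorm_le_of_le (A.norm_coe_le_norm x) (h.norm_coe_le_norm x))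

/-- The operator `y ↦ f ∘ y`. -/
def nemytskii (f : C(G, F)) (y : C(X, G)) : C(X, F) := f.comp y

omit [CompactSpace X] [NormedSpace ℝ G] [NormedSpace ℝ F] in
theorem nemytskii_apply (f : C(G, F)) (y : C(X, G)) (x : X) : nemytskii f y x = f (y x) := rfl

/-- The range of `y` is compact, so `f'` is uniformly continuous near it. The mean value inequality
then bounds the remainder uniformly in the point `x`. -/
theorem hasFDerivAt_nemytskii {f : C(G, F)} {f' : C(G, G →L[ℝ] F)}
    (hf : ∀ g, HasFDerivAt f (f' g) g) (y : C(X, G)) :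
    HasFDerivAt (nemytskii f : C(X, G) → C(X, F)) (pointwiseApply X G F (nemytskii f' y)) y := by
  rw [hasFDerivAt_iff_isLittleO_nhds_zero, Asymptotics.isLittleO_iff]
  intro c hc
  have hK : IsCompact (range y) := isCompact_range y.continuous
  have hu := hK.uniformContinuousAt_of_continuousAt f' (fun a _ ↦ f'.continuous.continuousAt)
    (Metric.dist_mem_uniformity hc)
  obtain ⟨δ, hδ, hball⟩ := Metric.mem_uniformity_dist.1 hu
  filter_upwards [Metric.ball_mem_nhds (0 : C(X, G)) hδ] with h hh
  rw [mem_ball_zero_iff] at hh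
  rw [ContinuousMap.norm_le _ (by positivity)]
  intro x
  have hx : ‖h x‖ < δ := (h.norm_coe_le_norm x).trans_lt hh
  have hmv := (convex_ball (y x) δ).norm_image_sub_le_of_norm_hasFDerivWithin_le'
    (f := f) (f' := f') (φ := f' (y x)) (C := c) (x := y x) (y := y x + h x)
    (fun z _ ↦ (hf z).hasFDerivWithinAt) (fun z hz ↦ ?_) (Metric.mem_ball_self hδ)
    (by simpa [dist_eq_norm] using hx)
  · rw [add_sub_cancel_left] at hmv
    have h2 : c * ‖h x‖ ≤ c * ‖h‖ := by
      gcongr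
      exact h.norm_coe_le_norm x
    exact hmv.trans h2
  · have := hball (a := y x) (b := z) (by rw [dist_comm]; exact hz) (mem_range_self x)
    rw [← dist_eq_norm, dist_comm]
    exact le_of_lt this

/-- The derivative is again a composition operator, with the derivative of `f`, followed by a
continuous linear map. The target space changes, so the induction has to quantify over it. -/
theorem contDiff_nemytskii_nat (n : ℕ) : ∀ (F : Type) [NormedAddCommGroup F] [NormedSpace ℝ F]
    (f : C(G, F)), ContDiff ℝ ∞ f → ContDiff ℝ n (nemytskii f : C(X, G) → C(X, F)) := by
  induction n with
  | zero =>
    intro F _ _ f hf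
    rw [Nat.cast_zero, contDiff_zero]
    exact ContinuousMap.continuous_postcomp f
  | succ n ih =>
    intro F _ _ f hf
    have hf' : ContDiff ℝ ∞ (fderiv ℝ f) := hf.fderiv_right (by simp)
    have := ih (G →L[ℝ] F) ⟨fderiv ℝ f, hf'.continuous⟩ hf'
    rw [Nat.cast_add, Nat.cast_one, contDiff_succ_iff_hasFDerivAt]
    exact ⟨_, (pointwiseApply X G F).contDiff.comp this, fun y ↦ hasFDerivAt_nemytskii
      (fun g ↦ (hf.differentiable (by simp) g).hasFDerivAt) y⟩

theorem contDiff_nemytskii {f : C(G, F)} (hf : ContDiff ℝ ∞ f) :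
    ContDiff ℝ ∞ (nemytskii f : C(X, G) → C(X, F)) :=
  contDiff_infty.2 fun n ↦ contDiff_nemytskii_nat n F f hf

end Nemytskii

/-! ### Integrals over the unit interval depending on parameters -/

section UnitInterval

open unitInterval

variable {E F : Type} [NormedAddCommGroup E] [NormedSpace ℝ E] [NormedAddCommGroup F]
  [NormedSpace ℝ F]

variable (F) in
/-- The integral over the unit interval. -/
def integralI : C(I, F) →L[ℝ] F :=
  LinearMap.mkContinuous
    { toFun := fun f ↦ ∫ t in (0 : ℝ)..1, IccExtend zero_le_one f t
      map_add' := fun f g ↦ by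
        rw [← intervalIntegral.integral_add
          (f.continuous.Icc_extend'.intervalIntegrable _ _)
          (g.continuous.Icc_extend'.intervalIntegrable _ _)]
        rfl
      map_smul' := fun c f ↦ by
        rw [RingHom.id_apply, ← intervalIntegral.integral_smul]
        rfl }
    1
    (fun f ↦ by
      have := intervalIntegral.norm_integral_le_of_norm_le_const (a := 0) (b := 1) (C := ‖f‖)
        (f := IccExtend zero_le_one f) fun t _ ↦ f.norm_coe_le_norm _
      simpa using this)

theorem integralI_apply (f : C(I, F)) :
    integralI F f = ∫ t in (0 : ℝ)..1, IccExtend zero_le_one f t := rfl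

theorem norm_integralI_le (f : C(I, F)) : ‖integralI F f‖ ≤ ‖f‖ := by
  have := intervalIntegral.norm_integral_le_of_norm_le_const (a := 0) (b := 1) (C := ‖f‖)
    (f := IccExtend zero_le_one f) fun t _ ↦ f.norm_coe_le_norm _
  rw [sub_zero, abs_one, mul_one] at this
  exact this

theorem integralI_eq {f : C(I, F)} {g : ℝ → F} (h : ∀ t : I, f t = g t) :
    integralI F f = ∫ t in (0 : ℝ)..1, g t := by
  rw [integralI_apply]
  refine intervalIntegral.integral_congr fun t ht ↦ ?_
  rw [uIcc_of_le zero_le_one] at ht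
  rw [IccExtend_of_mem _ _ ht, h]

variable (E) in
/-- The segments from `0`, as a continuous linear function of the end point. -/
def segmentMap : E →L[ℝ] C(I, E) :=
  LinearMap.mkContinuous
    { toFun := fun x ↦ ⟨fun t ↦ (t : ℝ) • x, by fun_prop⟩
      map_add' := fun x y ↦ by ext; simp
      map_smul' := fun c x ↦ by
        ext t
        exact smul_comm _ _ _ }
    1
    (fun x ↦ by
      rw [one_mul, ContinuousMap.norm_le _ (norm_nonneg x)]
      intro t
      change ‖(t : ℝ) • x‖ ≤ ‖x‖
      rw [norm_smul, Real.norm_of_nonneg t.2.1]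
      exact mul_le_of_le_one_left (norm_nonneg x) t.2.2)

/-- The mean of `f` over the segment from `0` to `x`. -/
def segmentMean (f : C(E, F)) (x : E) : F := integralI F (nemytskii f (segmentMap E x))

theorem segmentMean_eq (f : C(E, F)) (x : E) : segmentMean f x = ∫ t in (0 : ℝ)..1, f (t • x) :=
  integralI_eq fun _ ↦ rfl

/-- A smooth composition operator between two continuous linear maps; no differentiation under the
integral sign is required. -/
theorem contDiff_segmentMean {f : C(E, F)} (hf : ContDiff ℝ ∞ f) : ContDiff ℝ ∞ (segmentMean f) :=
  (integralI F).contDiff.comp ((contDiff_nemytskii hf).comp (segmentMap E).contDiff)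

theorem segmentMean_zero [CompleteSpace F] (f : C(E, F)) : segmentMean f 0 = f 0 := by
  simp [segmentMean_eq]

/-- Hadamard's lemma. -/
theorem eq_add_segmentMean_fderiv [CompleteSpace F] {f : E → F} (hf : ContDiff ℝ ∞ f) (x : E) :
    f x = f 0 + segmentMean ⟨fderiv ℝ f, (hf.fderiv_right (m := ∞) (by simp)).continuous⟩ x x := by
  have hc : Continuous (fderiv ℝ f) := (hf.fderiv_right (m := ∞) (by simp)).continuous
  have hd : ∀ t : ℝ, HasDerivAt (fun t : ℝ ↦ f (t • x)) (fderiv ℝ f (t • x) x) t := fun t ↦ by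
    have h1 : HasDerivAt (fun t : ℝ ↦ t • x) x t := by
      simpa using (hasDerivAt_id t).smul_const x
    exact (hf.differentiable (by simp) (t • x)).hasFDerivAt.comp_hasDerivAt t h1
  have hint : IntervalIntegrable (fun t : ℝ ↦ fderiv ℝ f (t • x)) volume 0 1 :=
    (hc.comp (by fun_prop)).intervalIntegrable _ _
  have h := intervalIntegral.integral_eq_sub_of_hasDerivAt (a := 0) (b := 1) (fun t _ ↦ hd t)
    ((hc.comp (by fun_prop : Continuous fun t : ℝ ↦ t • x)).clm_apply
      continuous_const |>.intervalIntegrable _ _)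
  rw [segmentMean_eq]
  change f x = f 0 + (∫ t in (0 : ℝ)..1, fderiv ℝ f (t • x)) x
  rw [ContinuousLinearMap.intervalIntegral_apply hint, h]
  simp

end UnitInterval

/-! ### The trajectories of an Euler vector field -/

/-- The Euler condition is applied to linear functions, for which `V l = l(V)`: the components of
`V(x) - x` are `O(‖x‖²)`. -/
theorem IsEulerField.hasFDerivAt_apply {m : ℕ} {V : Space m → Space m} (hV : IsEulerField V)
    (l : Space m →L[ℝ] ℝ) :
    l (V 0) = 0 ∧ HasFDerivAt (fun x ↦ l (V x) - l x) (0 : Space m →L[ℝ] ℝ) 0 := by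
  have h := hV.euler l l.contDiff (map_zero l)
  simp only [ContinuousLinearMap.fderiv] at h
  have h' : (fun x ↦ l (V x) - l x) =O[𝓝 0] fun x ↦ ‖x - 0‖ ^ 2 := by simpa using h
  refine ⟨?_, h'.hasFDerivAt one_lt_two⟩
  simpa using h'.eq_zero_of_norm_pow two_ne_zero

theorem IsEulerField.apply_zero {m : ℕ} {V : Space m → Space m} (hV : IsEulerField V) :
    V 0 = 0 := by
  ext i
  exact (hV.hasFDerivAt_apply (EuclideanSpace.proj i)).1

theorem IsEulerField.fderiv_zero {m : ℕ} {V : Space m → Space m} (hV : IsEulerField V) :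
    fderiv ℝ V 0 = ContinuousLinearMap.id ℝ (Space m) := by
  ext v i
  have h1 := (hV.hasFDerivAt_apply (EuclideanSpace.proj i)).2
  have hd : HasFDerivAt V (fderiv ℝ V 0) 0 :=
    (hV.smooth.differentiable (by simp) 0).hasFDerivAt
  set l : Space m →L[ℝ] ℝ := EuclideanSpace.proj i
  have h2 := (l.hasFDerivAt.comp (0 : Space m) hd).sub (l.hasFDerivAt (x := 0))
  have h3 := congrArg (fun A : Space m →L[ℝ] ℝ ↦ A v) (h2.unique h1)
  exact sub_eq_zero.1 h3

/-- The inverse function theorem, for smooth maps tangent to the identity at `0`. -/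
theorem exists_smooth_inverse {Y : Type} [NormedAddCommGroup Y] [NormedSpace ℝ Y] [CompleteSpace Y]
    {H : Y → Y} (hH : ContDiff ℝ ∞ H) (h0 : H 0 = 0)
    (hd : HasFDerivAt H (ContinuousLinearMap.id ℝ Y) 0) :
    ∃ G : Y → Y, G 0 = 0 ∧ (∀ᶠ z in 𝓝 0, ContDiffAt ℝ ∞ G z) ∧ (∀ᶠ z in 𝓝 0, H (G z) = z) ∧
      ∀ᶠ y in 𝓝 0, G (H y) = y := by
  have hd' : HasFDerivAt H ((ContinuousLinearEquiv.refl ℝ Y : Y ≃L[ℝ] Y) : Y →L[ℝ] Y) 0 := hd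
  set e := hH.contDiffAt.toOpenPartialHomeomorph H hd' (by simp) with he
  have hcoe : ∀ y, e y = H y := fun y ↦ rfl
  have hs : (0 : Y) ∈ e.source := hH.contDiffAt.mem_toOpenPartialHomeomorph_source hd' (by simp)
  have ht : (0 : Y) ∈ e.target := by
    have := e.map_source hs
    rwa [hcoe, h0] at this
  have he0 : e.symm 0 = 0 := by
    have := e.left_inv hs
    rwa [hcoe, h0] at this
  have hcont : Tendsto e.symm (𝓝 0) (𝓝 0) := by
    have := e.continuousAt_symm ht
    rwa [ContinuousAt, he0] at this
  -- Invertible operators form an open set. Hence the inverse map is smooth on a neighbourhood of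
  -- `0` and not only at `0`.
  have hinv : ∀ᶠ y in 𝓝 (0 : Y), ∃ A : Y ≃L[ℝ] Y, (A : Y →L[ℝ] Y) = fderiv ℝ H y := by
    have h1 : ContinuousAt (fderiv ℝ H) 0 :=
      (hH.fderiv_right (m := ∞) (by simp)).continuous.continuousAt
    have h2 : range ((↑) : (Y ≃L[ℝ] Y) → Y →L[ℝ] Y) ∈ 𝓝 (fderiv ℝ H 0) := by
      rw [hd'.fderiv]
      exact ContinuousLinearEquiv.nhds _
    exact h1.eventually h2
  refine ⟨e.symm, he0, ?_, ?_, ?_⟩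
  · filter_upwards [hcont.eventually hinv, e.open_target.mem_nhds ht] with z ⟨A, hA⟩ hz
    refine e.contDiffAt_symm hz (f₀' := A) ?_ hH.contDiffAt
    rw [hA]
    exact (hH.differentiable (by simp) _).hasFDerivAt
  · filter_upwards [e.open_target.mem_nhds ht] with z hz using e.right_inv hz
  · filter_upwards [e.open_source.mem_nhds hs] with y hy using e.left_inv hy

section Trajectories

open unitInterval

variable {E F : Type} [NormedAddCommGroup E] [NormedSpace ℝ E] [NormedAddCommGroup F]
  [NormedSpace ℝ F]

variable (E) in
/-- The linear map sending `y` to the curve `t ↦ (t y(t), y(t))`. -/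
def pairMap : C(I, E) →L[ℝ] C(I, E × E) :=
  LinearMap.mkContinuous
    { toFun := fun y ↦ ⟨fun t ↦ ((t : ℝ) • y t, y t), by fun_prop⟩
      map_add' := fun x y ↦ by ext <;> simp
      map_smul' := fun c x ↦ by
        ext t
        · exact smul_comm _ _ _
        · rfl }
    1
    (fun y ↦ by
      rw [one_mul, ContinuousMap.norm_le _ (norm_nonneg y)]
      intro t
      refine max_le ?_ (y.norm_coe_le_norm t)
      change ‖(t : ℝ) • y t‖ ≤ ‖y‖
      rw [norm_smul, Real.norm_of_nonneg t.2.1]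
      exact (mul_le_of_le_one_left (norm_nonneg _) t.2.2).trans (y.norm_coe_le_norm t))

theorem pairMap_apply (y : C(I, E)) (t : I) : pairMap E y t = ((t : ℝ) • y t, y t) := rfl

variable (E) in
/-- The linear map sending `y` to the curve `t ↦ ∫_t^1 y`. -/
def tailIntegral : C(I, E) →L[ℝ] C(I, E) :=
  LinearMap.mkContinuous
    { toFun := fun y ↦ ⟨fun t ↦ ∫ s in (t : ℝ)..1, IccExtend zero_le_one y s, by
        have h := intervalIntegral.continuous_primitive (μ := volume)
          (fun a b ↦ (y.continuous.Icc_extend' (h := zero_le_one)).intervalIntegrable a b) 1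
        have h2 : (fun t : I ↦ ∫ s in (t : ℝ)..1, IccExtend zero_le_one y s) =
            fun t : I ↦ -∫ s in (1 : ℝ)..t, IccExtend zero_le_one y s := by
          ext t
          rw [intervalIntegral.integral_symm]
        rw [h2]
        exact (h.comp continuous_subtype_val).neg⟩
      map_add' := fun x y ↦ by
        ext t
        exact intervalIntegral.integral_add (x.continuous.Icc_extend'.intervalIntegrable _ _)
          (y.continuous.Icc_extend'.intervalIntegrable _ _)
      map_smul' := fun c x ↦ by
        ext t
        exact intervalIntegral.integral_smul c _ }
    1
    (fun y ↦ by
      rw [one_mul, ContinuousMap.norm_le _ (norm_nonneg y)]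
      intro t
      have := intervalIntegral.norm_integral_le_of_norm_le_const (a := t) (b := 1) (C := ‖y‖)
        (f := IccExtend zero_le_one y) fun s _ ↦ y.norm_coe_le_norm _
      refine this.trans (mul_le_of_le_one_right (norm_nonneg y) ?_)
      rw [abs_of_nonneg (sub_nonneg.2 t.2.2)]
      linarith [t.2.1])

/-- The curve `t ↦ l y(l t)`. -/
def rescale (l : I) : C(I, E) →ₗ[ℝ] C(I, E) where
  toFun y := ⟨fun t ↦ (l : ℝ) • y (l * t), by fun_prop⟩
  map_add' x y := by ext; simp
  map_smul' c x := by
    ext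
    exact smul_comm _ _ _

theorem rescale_apply (l : I) (y : C(I, E)) (t : I) : rescale l y t = (l : ℝ) • y (l * t) := rfl

theorem norm_rescale_le (l : I) (y : C(I, E)) : ‖rescale l y‖ ≤ ‖y‖ := by
  rw [ContinuousMap.norm_le _ (norm_nonneg y)]
  intro t
  rw [rescale_apply, norm_smul, Real.norm_of_nonneg l.2.1]
  exact (mul_le_of_le_one_left (norm_nonneg _) l.2.2).trans (y.norm_coe_le_norm _)

/-- Substitution in the integral of a rescaled curve. -/
theorem integral_extend_mul (y : C(I, F)) (l : I) {a : ℝ} (ha : a ∈ I) {z : C(I, F)}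
    (hz : ∀ t, z t = (l : ℝ) • y (l * t)) :
    ∫ s in a..1, IccExtend zero_le_one z s =
      ∫ s in (l * a : ℝ)..l, IccExtend zero_le_one y s := by
  have h := intervalIntegral.smul_integral_comp_mul_left (a := a) (b := 1)
    (IccExtend zero_le_one y) (l : ℝ)
  rw [mul_one] at h
  rw [← h, ← intervalIntegral.integral_smul]
  refine intervalIntegral.integral_congr fun s hs ↦ ?_
  rw [uIcc_of_le ha.2] at hs
  have hs' : s ∈ I := ⟨ha.1.trans hs.1, hs.2⟩
  have h1 : IccExtend zero_le_one z s = z ⟨s, hs'⟩ := IccExtend_of_mem _ _ hs'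
  have h2 : IccExtend zero_le_one y (l * s) = y (l * ⟨s, hs'⟩) :=
    IccExtend_of_mem _ _ (unitInterval.mul_mem l.2 hs')
  rw [h1, hz, ← h2]

end Trajectories

/-! ### The desingularized equation of the trajectories. -/

section Straighten

open unitInterval

variable {E : Type} [NormedAddCommGroup E] [NormedSpace ℝ E]

/-- The map `(a, b) ↦ Q(a)(b, b)`. -/
def quadField {Q : E → E →L[ℝ] E →L[ℝ] E} (hQ : ContDiff ℝ ∞ Q) : C(E × E, E) :=
  ⟨fun p ↦ Q p.1 p.2 p.2, ((hQ.continuous.comp continuous_fst).clm_apply continuous_snd).clm_apply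
    continuous_snd⟩

theorem contDiff_quadField {Q : E → E →L[ℝ] E →L[ℝ] E} (hQ : ContDiff ℝ ∞ Q) :
    ContDiff ℝ ∞ (quadField hQ) :=
  ((hQ.comp contDiff_fst).clm_apply contDiff_snd).clm_apply contDiff_snd

theorem fderiv_quadField_zero {Q : E → E →L[ℝ] E →L[ℝ] E} (hQ : ContDiff ℝ ∞ Q) :
    fderiv ℝ (quadField hQ) 0 = 0 := by
  have h1 : DifferentiableAt ℝ (fun p : E × E ↦ Q p.1 p.2) 0 :=
    ((hQ.comp contDiff_fst).clm_apply contDiff_snd).differentiable (by simp) 0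
  have h2 := h1.hasFDerivAt.clm_apply (hasFDerivAt_snd (𝕜 := ℝ) (E := E) (F := E) (p := 0))
  have h3 : HasFDerivAt (quadField hQ) _ 0 := h2
  rw [h3.fderiv]
  ext <;> simp

/-- The right-hand side of the equation `y' = Q(t y)(y, y)`. -/
def curveField {Q : E → E →L[ℝ] E →L[ℝ] E} (hQ : ContDiff ℝ ∞ Q) (y : C(I, E)) : C(I, E) :=
  nemytskii (quadField hQ) (pairMap E y)

theorem curveField_apply {Q : E → E →L[ℝ] E →L[ℝ] E} (hQ : ContDiff ℝ ∞ Q) (y : C(I, E)) (t : I) :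
    curveField hQ y t = Q ((t : ℝ) • y t) (y t) (y t) := rfl

/-- The solutions of `y' = Q(t y)(y, y)` with `y(1) = x` are the curves which this map sends to the
constant curve `x`. -/
def straighten {Q : E → E →L[ℝ] E →L[ℝ] E} (hQ : ContDiff ℝ ∞ Q) (y : C(I, E)) : C(I, E) :=
  y + tailIntegral E (curveField hQ y)

theorem contDiff_straighten {Q : E → E →L[ℝ] E →L[ℝ] E} (hQ : ContDiff ℝ ∞ Q) :
    ContDiff ℝ ∞ (straighten hQ) :=
  contDiff_id.add ((tailIntegral E).contDiff.comp
    ((contDiff_nemytskii (contDiff_quadField hQ)).comp (pairMap E).contDiff))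

theorem straighten_zero {Q : E → E →L[ℝ] E →L[ℝ] E} (hQ : ContDiff ℝ ∞ Q) :
    straighten hQ 0 = 0 := by
  have : curveField hQ 0 = 0 := by
    ext t
    simp [curveField_apply]
  rw [straighten, this, map_zero, add_zero]

/-- The right-hand side is quadratic in `y`, so the integral term has vanishing derivative at the
zero curve. -/
theorem hasFDerivAt_straighten_zero {Q : E → E →L[ℝ] E →L[ℝ] E} (hQ : ContDiff ℝ ∞ Q) :
    HasFDerivAt (straighten hQ) (ContinuousLinearMap.id ℝ C(I, E)) 0 := by
  have hk := contDiff_quadField hQ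
  have hk' : Continuous (fderiv ℝ (quadField hQ)) := (hk.fderiv_right (m := ∞) (by simp)).continuous
  have h1 := hasFDerivAt_nemytskii (X := I) (f := quadField hQ) (f' := ⟨_, hk'⟩)
    (fun g ↦ (hk.differentiable (by simp) g).hasFDerivAt) (pairMap E 0)
  have h2 : nemytskii ⟨fderiv ℝ (quadField hQ), hk'⟩ (pairMap E 0) = 0 := by
    ext1 t
    rw [map_zero]
    exact fderiv_quadField_zero hQ
  rw [h2, map_zero] at h1
  have h3 := (hasFDerivAt_id (𝕜 := ℝ) (0 : C(I, E))).add
    ((tailIntegral E).hasFDerivAt.comp _ (h1.comp _ (pairMap E).hasFDerivAt))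
  rw [ContinuousLinearMap.zero_comp, ContinuousLinearMap.comp_zero, add_zero] at h3
  exact h3

theorem add_integral_eq_of_straighten {Q : E → E →L[ℝ] E →L[ℝ] E} (hQ : ContDiff ℝ ∞ Q)
    {y : C(I, E)} {x : E} (hy : straighten hQ y = ContinuousMap.const I x) (t : I) :
    y t + ∫ s in (t : ℝ)..1, IccExtend zero_le_one (curveField hQ y) s = x :=
  congrArg (fun f : C(I, E) ↦ f t) hy

/-- The equation `y' = Q(ty)(y, y)` is invariant under `y ↦ l y(l ·)`: an initial piece of a
trajectory, reparametrized, is the trajectory to its own end point `l y(l)`. -/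
theorem straighten_rescale {Q : E → E →L[ℝ] E →L[ℝ] E} (hQ : ContDiff ℝ ∞ Q)
    {y : C(I, E)} {x : E} (hy : straighten hQ y = ContinuousMap.const I x) (l : I) :
    straighten hQ (rescale l y) = ContinuousMap.const I ((l : ℝ) • y l) := by
  ext1 t
  change rescale l y t + ∫ s in (t : ℝ)..1, IccExtend zero_le_one (curveField hQ (rescale l y)) s =
    (l : ℝ) • y l
  rw [integral_extend_mul ((l : ℝ) • curveField hQ y) l t.2 fun s ↦ ?_]
  · have h1 := add_integral_eq_of_straighten hQ hy l
    have h2 := add_integral_eq_of_straighten hQ hy (l * t)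
    have hi : ∀ a b : ℝ, IntervalIntegrable (IccExtend zero_le_one (curveField hQ y)) volume a b :=
      fun a b ↦ (curveField hQ y).continuous.Icc_extend'.intervalIntegrable a b
    have h3 : ∫ s in (l * t : ℝ)..l, IccExtend zero_le_one ((l : ℝ) • curveField hQ y) s =
        (l : ℝ) • ∫ s in (l * t : ℝ)..l, IccExtend zero_le_one (curveField hQ y) s :=
      intervalIntegral.integral_smul _ _
    have h4 := intervalIntegral.integral_add_adjacent_intervals (hi (l * t) l) (hi l 1)
    rw [h3, rescale_apply, ← smul_add]
    congr 1
    rw [Icc.coe_mul, ← h4, ← add_assoc] at h2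
    exact add_right_cancel (h2.trans h1.symm)
  · simp only [curveField_apply, rescale_apply, ContinuousMap.smul_apply, map_smul,
      Icc.coe_mul, smul_apply]
    rw [smul_smul (s : ℝ), mul_comm (s : ℝ)]

end Straighten

/-! ### Construction of the smooth family of trajectories. -/

section Flow

open unitInterval

variable {E : Type} [NormedAddCommGroup E] [NormedSpace ℝ E]

/-- Hadamard's lemma is applied twice, first to `V` and then to the mean of its derivative along
segments, whose value at `0` is the identity. -/
theorem exists_quadratic_remainder [CompleteSpace E] {V : E → E} (hV : ContDiff ℝ ∞ V)
    (h0 : V 0 = 0) (h1 : fderiv ℝ V 0 = ContinuousLinearMap.id ℝ E) :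
    ∃ Q : E → E →L[ℝ] E →L[ℝ] E, ContDiff ℝ ∞ Q ∧ ∀ x, V x = x + Q x x x := by
  have hd : ContDiff ℝ ∞ (fderiv ℝ V) := hV.fderiv_right (by simp)
  have hA := contDiff_segmentMean (f := ⟨fderiv ℝ V, hd.continuous⟩) hd
  have hdA := hA.fderiv_right (m := ∞) (by simp)
  refine ⟨_, contDiff_segmentMean (f := ⟨_, hdA.continuous⟩) hdA, fun x ↦ ?_⟩
  have h2 := eq_add_segmentMean_fderiv hV x
  have h3 := eq_add_segmentMean_fderiv hA x
  rw [h0, zero_add, h3, segmentMean_zero] at h2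
  rw [h2]
  change fderiv ℝ V 0 x + _ = _
  rw [h1]
  rfl

/-- The trajectories `t ↦ t Φ(x)(t)` of `V`, in logarithmic time. They end at `x` and depend
smoothly on `x`. -/
structure IsTrajectoryFamily (V : E → E) (Φ : E → C(I, E)) : Prop where
  smooth : ContDiff ℝ ∞ Φ
  zero : Φ 0 = 0
  rescale : ∀ᶠ x in 𝓝 0, ∀ l : I, Φ ((l : ℝ) • Φ x l) = Residue.rescale l (Φ x)
  curve : ∀ᶠ x in 𝓝 0, Φ x 1 = x ∧ ∃ c c' : ℝ → E, Continuous c' ∧ (∀ t, HasDerivAt c (c' t) t) ∧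
    ∀ t : I, c t = (t : ℝ) • Φ x t ∧ (t : ℝ) • c' t = V (c t)

/-- With `c = t y`, the equation for `y` gives `t c' = t y + t² Q(ty)(y, y) = V(c)`. The curve is
extended beyond the unit interval so that it has two-sided derivatives at the end points. -/
theorem exists_curve [CompleteSpace E] {V : E → E} {Q : E → E →L[ℝ] E →L[ℝ] E}
    (hQ : ContDiff ℝ ∞ Q) (hVQ : ∀ x, V x = x + Q x x x) {y : C(I, E)} {x : E}
    (hy : straighten hQ y = ContinuousMap.const I x) :
    y 1 = x ∧ ∃ c c' : ℝ → E, Continuous c' ∧ (∀ t, HasDerivAt c (c' t) t) ∧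
      ∀ t : I, c t = (t : ℝ) • y t ∧ (t : ℝ) • c' t = V (c t) := by
  have hyt := add_integral_eq_of_straighten hQ hy
  set g : ℝ → E := IccExtend zero_le_one (curveField hQ y) with hg
  have hgc : Continuous g := (curveField hQ y).continuous.Icc_extend'
  set Y : ℝ → E := fun t ↦ x + ∫ s in (1 : ℝ)..t, g s with hY
  have hYd : ∀ t, HasDerivAt Y (g t) t := fun t ↦
    (hgc.integral_hasStrictDerivAt 1 t).hasDerivAt.const_add x
  have hYy : ∀ t : I, Y t = y t := fun t ↦ by
    change x + ∫ s in (1 : ℝ)..t, g s = y t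
    rw [intervalIntegral.integral_symm, ← sub_eq_add_neg, sub_eq_iff_eq_add, hyt t]
  refine ⟨by simpa using hyt 1, fun t ↦ t • Y t, fun t ↦ t • g t + (1 : ℝ) • Y t, ?_, fun t ↦
    (hasDerivAt_id t).smul (hYd t), fun t ↦ ⟨by dsimp only; rw [hYy], ?_⟩⟩
  · have : Continuous Y := continuous_iff_continuousAt.2 fun t ↦ (hYd t).continuousAt
    fun_prop
  · have : g t = curveField hQ y t := IccExtend_of_mem _ _ t.2
    dsimp only
    rw [hVQ, hYy, this, curveField_apply]
    simp [smul_add, smul_smul, add_comm]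

theorem exists_isTrajectoryFamily [CompleteSpace E] [HasContDiffBump E] {V : E → E}
    (hV : ContDiff ℝ ∞ V) (h0 : V 0 = 0) (h1 : fderiv ℝ V 0 = ContinuousLinearMap.id ℝ E) :
    ∃ Φ, IsTrajectoryFamily V Φ := by
  obtain ⟨Q, hQ, hVQ⟩ := exists_quadratic_remainder hV h0 h1
  obtain ⟨G, hG0, hGs, hHG, hGH⟩ := exists_smooth_inverse (contDiff_straighten hQ)
    (straighten_zero hQ) (hasFDerivAt_straighten_zero hQ)
  obtain ⟨r, hr, hrG⟩ := Metric.eventually_nhds_iff_ball.1 hGs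
  -- The local inverse `G` is only known to be smooth on a ball of radius `r`. The bump function
  -- makes the family globally smooth without changing it near `0`.
  let b : ContDiffBump (0 : E) := ⟨r / 4, r / 2, by positivity, by linarith⟩
  let k : E →L[ℝ] C(I, E) := ContinuousLinearMap.const ℝ I
  have hkx : ∀ x, k x = ContinuousMap.const I x := fun x ↦ rfl
  have hk0 : Tendsto k (𝓝 0) (𝓝 0) := by simpa using k.continuous.tendsto 0
  have hkn : ∀ x, ‖k x‖ ≤ ‖x‖ := fun x ↦ by
    rw [ContinuousMap.norm_le _ (norm_nonneg x)]
    exact fun _ ↦ le_rfl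
  have hsm : ContDiff ℝ ∞ fun x ↦ b x • G (k x) := by
    rw [contDiff_iff_contDiffAt]
    intro x
    by_cases hx : x ∈ tsupport b
    · rw [b.tsupport_eq] at hx
      have hx' : ‖x‖ ≤ r / 2 := by simpa using hx
      refine b.contDiff.contDiffAt.smul ((hrG (k x) ?_).comp x k.contDiff.contDiffAt)
      rw [mem_ball_zero_iff]
      linarith [hkn x]
    · have : (fun x ↦ b x • G (k x)) =ᶠ[𝓝 x] fun _ ↦ 0 := by
        filter_upwards [notMem_tsupport_iff_eventuallyEq.1 hx] with z hz
        rw [hz, Pi.zero_apply, zero_smul]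
      exact contDiffAt_const.congr_of_eventuallyEq this
  have heq : ∀ᶠ x in 𝓝 0, b x • G (k x) = G (k x) := by
    filter_upwards [b.eventuallyEq_one] with x hx
    rw [hx, Pi.one_apply, one_smul]
  have hzero : b 0 • G (k 0) = 0 := by rw [map_zero, hG0, smul_zero]
  refine ⟨fun x ↦ b x • G (k x), hsm, hzero, ?_, ?_⟩
  · obtain ⟨ε, hε, hball⟩ := Metric.eventually_nhds_iff_ball.1 heq
    obtain ⟨δ, hδ, hball'⟩ := Metric.eventually_nhds_iff_ball.1 hGH
    have hs : Tendsto (fun x ↦ b x • G (k x)) (𝓝 0) (𝓝 0) := by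
      simpa only [hzero] using hsm.continuous.tendsto 0
    filter_upwards [heq, hk0.eventually hHG, hs.eventually (Metric.ball_mem_nhds 0 hε),
      hs.eventually (Metric.ball_mem_nhds 0 hδ)] with x hx1 hx2 hx3 hx4 l
    rw [hx1] at hx3 hx4 ⊢
    rw [dist_zero_right] at hx3 hx4
    have h2 := straighten_rescale hQ hx2 l
    -- Local uniqueness: the rescaled curve solves the equation for its end point and is small, so
    -- the left inverse property identifies it with the curve of the family.
    rw [hball, hkx, ← h2, hball']
    · rw [mem_ball_zero_iff]
      exact (norm_rescale_le l _).trans_lt hx4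
    · rw [mem_ball_zero_iff, norm_smul, Real.norm_of_nonneg l.2.1]
      exact ((mul_le_of_le_one_left (norm_nonneg _) l.2.2).trans
        (ContinuousMap.norm_coe_le_norm _ _)).trans_lt hx3
  · filter_upwards [heq, hk0.eventually hHG] with x hx1 hx2
    rw [hx1]
    exact exists_curve hQ hVQ hx2

end Flow

/-! ### Integration along the trajectories -/

section Primitive

open unitInterval

variable {E F : Type} [NormedAddCommGroup E] [NormedSpace ℝ E] [NormedAddCommGroup F]
  [NormedSpace ℝ F]

theorem continuous_fderiv_of_smooth {f : E → F} (hf : ContDiff ℝ ∞ f) : Continuous (fderiv ℝ f) :=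
  (hf.fderiv_right (m := ∞) (by simp)).continuous

/-- The function `(a, b) ↦ ∫_0^1 df(t a)(b) dt`. -/
def slopeMap {f : E → F} (hf : ContDiff ℝ ∞ f) : C(E × E, F) :=
  ⟨fun p ↦ segmentMean ⟨fderiv ℝ f, continuous_fderiv_of_smooth hf⟩ p.1 p.2,
    ((contDiff_segmentMean (hf.fderiv_right (m := ∞) (by simp))).continuous.comp
      continuous_fst).clm_apply continuous_snd⟩

theorem contDiff_slopeMap {f : E → F} (hf : ContDiff ℝ ∞ f) : ContDiff ℝ ∞ (slopeMap hf) :=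
  ((contDiff_segmentMean (f := ⟨fderiv ℝ f, continuous_fderiv_of_smooth hf⟩)
    (hf.fderiv_right (m := ∞) (by simp))).comp contDiff_fst).clm_apply contDiff_snd

theorem slopeMap_smul {f : E → F} (hf : ContDiff ℝ ∞ f) (a b : E) (c : ℝ) :
    slopeMap hf (a, c • b) = c • slopeMap hf (a, b) :=
  map_smul (segmentMean ⟨fderiv ℝ f, continuous_fderiv_of_smooth hf⟩ a) c b

/-- Together with linearity in the second argument, this gives `t · slopeMap (t y, y) = f(t y) -
f(0)`. The integrand `(f(c) - f(0)) / t` of the primitive thus extends smoothly over `t = 0`. -/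
theorem slopeMap_self [CompleteSpace F] {f : E → F} (hf : ContDiff ℝ ∞ f) (a : E) :
    slopeMap hf (a, a) = f a - f 0 :=
  eq_sub_of_add_eq' (eq_add_segmentMean_fderiv hf a).symm

theorem slopeMap_eq [CompleteSpace F] {f : E → F} (hf : ContDiff ℝ ∞ f) (a b : E) :
    slopeMap hf (a, b) = ∫ t in (0 : ℝ)..1, fderiv ℝ f (t • a) b := by
  have hint : IntervalIntegrable (fun t : ℝ ↦ fderiv ℝ f (t • a)) volume 0 1 :=
    ((continuous_fderiv_of_smooth hf).comp (by fun_prop)).intervalIntegrable _ _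
  rw [← ContinuousLinearMap.intervalIntegral_apply hint]
  exact congrArg (fun A : E →L[ℝ] F ↦ A b) (segmentMean_eq _ a)

theorem norm_slopeMap_le {f : E → F} (hf : ContDiff ℝ ∞ f) {a b : E} {C : ℝ} (hC : 0 ≤ C)
    (h : ∀ x, ‖x‖ ≤ ‖a‖ → ‖fderiv ℝ f x‖ ≤ C) : ‖slopeMap hf (a, b)‖ ≤ C * ‖b‖ := by
  refine ContinuousLinearMap.le_of_opNorm_le _ ((norm_integralI_le _).trans ?_) b
  rw [ContinuousMap.norm_le _ hC]
  intro t
  refine h _ ?_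
  change ‖(t : ℝ) • a‖ ≤ ‖a‖
  rw [norm_smul, Real.norm_of_nonneg t.2.1]
  exact mul_le_of_le_one_left (norm_nonneg _) t.2.2

/-- The integral of `f - f(0)` along the trajectories, for the logarithmic time. -/
def primitive (Φ : E → C(I, E)) {f : E → F} (hf : ContDiff ℝ ∞ f) (x : E) : F :=
  integralI F (nemytskii (slopeMap hf) (pairMap E (Φ x)))

theorem contDiff_primitive {Φ : E → C(I, E)} (hΦ : ContDiff ℝ ∞ Φ) {f : E → F}
    (hf : ContDiff ℝ ∞ f) : ContDiff ℝ ∞ (primitive Φ hf) :=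
  (integralI F).contDiff.comp ((contDiff_nemytskii (contDiff_slopeMap hf)).comp
    ((pairMap E).contDiff.comp hΦ))

/-- Only first derivatives of `f` enter; this is the sole estimate on which the continuity of the
extended current rests. -/
theorem norm_primitive_le (Φ : E → C(I, E)) {f : E → F} (hf : ContDiff ℝ ∞ f) {x : E} {C : ℝ}
    (hC : 0 ≤ C) (h : ∀ z, ‖z‖ ≤ ‖Φ x‖ → ‖fderiv ℝ f z‖ ≤ C) :
    ‖primitive Φ hf x‖ ≤ C * ‖Φ x‖ := by
  refine (norm_integralI_le _).trans ?_
  rw [ContinuousMap.norm_le _ (by positivity)]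
  intro t
  refine (norm_slopeMap_le hf hC fun z hz ↦ h z (hz.trans ?_)).trans ?_
  · rw [norm_smul, Real.norm_of_nonneg t.2.1]
    exact (mul_le_of_le_one_left (norm_nonneg _) t.2.2).trans ((Φ x).norm_coe_le_norm t)
  · gcongr
    exact (Φ x).norm_coe_le_norm t

/-- A trajectory which ends near `0` stays near `0`, where `f` vanishes. This makes the corrected
formula agree with `u` off the origin. -/
theorem primitive_eventually_eq_zero {Φ : E → C(I, E)} (hΦ : Continuous Φ) (h0 : Φ 0 = 0)
    {f : E → F} (hf : ContDiff ℝ ∞ f) (hf0 : ∀ᶠ x in 𝓝 0, f x = 0) :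
    ∀ᶠ x in 𝓝 0, primitive Φ hf x = 0 := by
  have h1 : ∀ᶠ x in 𝓝 0, fderiv ℝ f x = 0 := by
    filter_upwards [hf0.eventually_nhds] with x hx
    have : f =ᶠ[𝓝 x] fun _ ↦ 0 := hx
    rw [this.fderiv_eq, fderiv_const_apply]
  obtain ⟨ε, hε, hball⟩ := Metric.eventually_nhds_iff_ball.1 h1
  have h2 : Tendsto Φ (𝓝 0) (𝓝 0) := by simpa only [h0] using hΦ.tendsto 0
  filter_upwards [h2.eventually (Metric.ball_mem_nhds 0 hε)] with x hx
  rw [dist_zero_right] at hx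
  have := norm_primitive_le Φ hf (x := x) le_rfl fun z hz ↦ by
    rw [hball z (mem_ball_zero_iff.2 (hz.trans_lt hx)), norm_zero]
  rwa [zero_mul, norm_le_zero_iff] at this

theorem primitive_congr (Φ : E → C(I, E)) {f g : E → F} (hf : ContDiff ℝ ∞ f) (hg : ContDiff ℝ ∞ g)
    (h : f = g) : primitive Φ hf = primitive Φ hg := by
  subst h
  rfl

theorem primitive_add (Φ : E → C(I, E)) [CompleteSpace F] {f g : E → F} (hf : ContDiff ℝ ∞ f)
    (hg : ContDiff ℝ ∞ g) :
    primitive Φ (hf.add hg) = fun x ↦ primitive Φ hf x + primitive Φ hg x := by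
  funext x
  rw [primitive, primitive, primitive, ← map_add]
  congr 1
  ext1 t
  simp only [nemytskii_apply, ContinuousMap.add_apply, pairMap_apply]
  rw [slopeMap_eq, slopeMap_eq, slopeMap_eq, ← intervalIntegral.integral_add]
  · refine intervalIntegral.integral_congr fun s _ ↦ ?_
    change fderiv ℝ (f + g) _ _ = _
    rw [fderiv_add (hf.differentiable (by simp) _) (hg.differentiable (by simp) _)]
    rfl
  · exact (((continuous_fderiv_of_smooth hf).comp (by fun_prop)).clm_apply
      continuous_const).intervalIntegrable _ _
  · exact (((continuous_fderiv_of_smooth hg).comp (by fun_prop)).clm_apply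
      continuous_const).intervalIntegrable _ _

theorem primitive_const_mul (Φ : E → C(I, E)) {f : E → ℂ} (hf : ContDiff ℝ ∞ f) (c : ℂ) :
    primitive Φ (contDiff_const.mul hf : ContDiff ℝ ∞ fun x ↦ c * f x) =
      fun x ↦ c * primitive Φ hf x := by
  funext x
  rw [primitive, primitive, integralI_apply, integralI_apply,
    ← intervalIntegral.integral_const_mul]
  refine intervalIntegral.integral_congr fun t _ ↦ ?_
  simp only [IccExtend, Function.comp_apply, nemytskii_apply, pairMap_apply]
  rw [slopeMap_eq, slopeMap_eq, ← intervalIntegral.integral_const_mul]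
  refine intervalIntegral.integral_congr fun s _ ↦ ?_
  rw [fderiv_const_mul (hf.differentiable (by simp) _)]
  rfl

variable {V : E → E} {Φ : E → C(I, E)}

/-- The primitive of `f` solves `V g = f - f(0)` near `0`. -/
theorem IsTrajectoryFamily.fderiv_primitive [CompleteSpace F] (h : IsTrajectoryFamily V Φ) :
    ∀ᶠ x in 𝓝 0, ∀ (f : E → F) (hf : ContDiff ℝ ∞ f),
      fderiv ℝ (primitive Φ hf) x (V x) = f x - f 0 := by
  filter_upwards [h.rescale, h.curve] with x hr ⟨hx1, c, c', _, hc, hcV⟩ f hf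
  set g : C(I, F) := nemytskii (slopeMap hf) (pairMap E (Φ x)) with hg
  have hc1 : c 1 = x := by simpa [hx1] using (hcV 1).1
  have hc1' : c' 1 = V x := by simpa [hc1] using (hcV 1).2
  -- By the rescaling property, the primitive at `c(l)` integrates over the piece of the same
  -- trajectory up to `l`. Differentiation at `l = 1` then gives the claim.
  have hP : ∀ l ∈ I, primitive Φ hf (c l) = ∫ s in (0 : ℝ)..l, IccExtend zero_le_one g s := by
    intro l hl
    have h1 := integral_extend_mul g ⟨l, hl⟩ (a := 0) ⟨le_rfl, zero_le_one⟩
      (z := nemytskii (slopeMap hf) (pairMap E (Residue.rescale ⟨l, hl⟩ (Φ x)))) fun t ↦ ?_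
    · rw [mul_zero] at h1
      rw [← h1, (hcV ⟨l, hl⟩).1, primitive, integralI_apply, hr]
    · rw [hg, nemytskii_apply, nemytskii_apply, pairMap_apply, pairMap_apply, ← slopeMap_smul,
        Residue.rescale_apply, smul_smul, Icc.coe_mul, mul_comm (t : ℝ)]
  have hd1 : HasDerivAt (fun l ↦ primitive Φ hf (c l)) (fderiv ℝ (primitive Φ hf) x (V x)) 1 := by
    have h1 := ((contDiff_primitive h.smooth hf).differentiable (by simp) (c 1)).hasFDerivAt
    have h2 := h1.comp_hasDerivAt (1 : ℝ) (hc 1)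
    rwa [hc1, hc1'] at h2
  have hd2 : HasDerivAt (fun l : ℝ ↦ ∫ s in (0 : ℝ)..l, IccExtend zero_le_one g s)
      (f x - f 0) 1 := by
    have h1 := ((g.continuous.Icc_extend' (h := zero_le_one)).integral_hasStrictDerivAt 0
      1).hasDerivAt
    have h2 : IccExtend zero_le_one g 1 = f x - f 0 := by
      rw [← slopeMap_self hf]
      have h3 : IccExtend zero_le_one g 1 = g 1 := IccExtend_of_mem _ _ ⟨zero_le_one, le_rfl⟩
      rw [h3, hg, nemytskii_apply, pairMap_apply, hx1, Icc.coe_one, one_smul]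
    rwa [h2] at h1
  -- The formula is only available for `l ≤ 1`, so one-sided derivatives at the end point are
  -- compared.
  have hu := (uniqueDiffOn_Icc (zero_lt_one (α := ℝ))).uniqueDiffWithinAt
    (right_mem_Icc.2 zero_le_one)
  exact hu.eq_deriv _ (hd1.hasDerivWithinAt.congr (fun l hl ↦ (hP l hl).symm)
    (hP 1 (right_mem_Icc.2 zero_le_one)).symm) hd2.hasDerivWithinAt

/-- The primitive of `V f` is `f - f(0)` near `0`. -/
theorem IsTrajectoryFamily.primitive_fderiv [CompleteSpace F] (h : IsTrajectoryFamily V Φ)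
    (hV : ContDiff ℝ ∞ V) (h0 : V 0 = 0) :
    ∀ᶠ x in 𝓝 0, ∀ (f : E → F) (hf : ContDiff ℝ ∞ f),
      primitive Φ ((hf.fderiv_right (m := ∞) (by simp)).clm_apply hV) x = f x - f 0 := by
  filter_upwards [h.curve] with x ⟨hx1, c, c', hcc, hc, hcV⟩ f hf
  have hVf : ContDiff ℝ ∞ fun x ↦ fderiv ℝ f x (V x) :=
    (hf.fderiv_right (m := ∞) (by simp)).clm_apply hV
  have hc1 : c 1 = x := by simpa [hx1] using (hcV 1).1
  have hc0 : c 0 = 0 := by simpa using (hcV 0).1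
  have hd : ∀ t, HasDerivAt (fun t ↦ f (c t)) (fderiv ℝ f (c t) (c' t)) t := fun t ↦
    (hf.differentiable (by simp) (c t)).hasFDerivAt.comp_hasDerivAt t (hc t)
  have hcont : Continuous c := continuous_iff_continuousAt.2 fun t ↦ (hc t).continuousAt
  have hint := intervalIntegral.integral_eq_sub_of_hasDerivAt (a := 0) (b := 1) (fun t _ ↦ hd t)
    ((((continuous_fderiv_of_smooth hf).comp hcont).clm_apply hcc).intervalIntegrable _ _)
  rw [hc1, hc0] at hint
  rw [← hint, primitive, integralI_apply]
  refine intervalIntegral.integral_congr_ae (Eventually.of_forall fun t ht ↦ ?_)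
  rw [uIoc_of_le zero_le_one] at ht
  have htI : t ∈ I := ⟨ht.1.le, ht.2⟩
  obtain ⟨h1, h2⟩ := hcV ⟨t, htI⟩
  have h3 : IccExtend zero_le_one (nemytskii (slopeMap hVf) (pairMap E (Φ x))) t =
      slopeMap hVf (t • Φ x ⟨t, htI⟩, Φ x ⟨t, htI⟩) := IccExtend_of_mem _ _ htI
  rw [h3]
  -- For `t > 0` one may multiply by `t`; then both sides become `V f` at `c(t)`, since `t c' =
  -- V(c)` and `V f` vanishes at `0`.
  refine smul_right_injective F ht.1.ne' ?_
  dsimp only at h1 h2 ⊢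
  rw [← slopeMap_smul, ← h1, slopeMap_self, h0, map_zero, sub_zero, ← h2, map_smul]

end Primitive

/-! ### Continuity of compositions with operators bounded on continuous functions -/

/-- Regularization was carried out in degree `n - 1`. It is transferred to top degree by contracting
with the constant field `e` and testing against multiples of a covector `l` with `l(e) = 1`. -/
theorem exists_tendsto_integral {m : ℕ} {Ω : Opens (Space m)} (u : TopCurrent Ω) :
    ∃ g : ℕ → Space m → ℂ, (∀ j, Continuous (g j)) ∧
      ∀ ψ : TestFun Ω, Tendsto (fun j ↦ ∫ x, ψ x * g j x) atTop (𝓝 (u ψ)) := by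
  set e : Space m := stdBasis 0
  have hc : ContDiff ℝ ∞ fun _ : Space m ↦ e := contDiff_const
  obtain ⟨θ, hθ, h⟩ := exists_tendstoHormander (contract hc u) subset_rfl
  set l : Space m →L[ℝ] ℂ := unitConormal e
  have hl : l e = 1 := by simp [l, e, unitConormal, stdBasis]
  refine ⟨fun j x ↦ topWedge m l (θ j x), fun j ↦ (topWedge m l).continuous.comp (hθ j).continuous,
    fun ψ ↦ ?_⟩
  set α : TestOneForm Ω := smulTest ψ l ⟨fun _ ↦ 1, (contDiff_const : ContDiff ℝ ∞ fun _ : Space m ↦ (1 : ℂ))⟩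
  have hα : ∀ x, α x = ψ x • l := fun x ↦ by
    rw [smulTest_apply, one_mul]
  have h1 : contract hc u α = u ψ := by
    refine congrArg u ?_
    ext x
    change α x e = ψ x
    rw [hα]
    simp [hl]
  have h2 := h.weak α
  rw [h1] at h2
  refine h2.congr fun j ↦ ?_
  rw [currentOfForm_apply (hθ j).continuous.continuousOn]
  simp only [hα, map_smul, smul_apply, smul_eq_mul]

/-- A current composed with an operator on test functions which is bounded for the uniform norms of
the functions and their first derivatives is a current. -/
theorem exists_topCurrent_comp {m : ℕ} {Ω Ω' : Opens (Space m)} (u : TopCurrent Ω')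
    (L : TestFun Ω →ₗ[ℂ] TestFun Ω')
    (hL : ∀ K : Set (Space m), IsCompact K → ∃ K' : Set (Space m), IsCompact K' ∧
      ∃ C : ℝ, 0 ≤ C ∧ ∀ (f : TestFun Ω) (B : ℝ), 0 ≤ B → tsupport f ⊆ K → (∀ x, ‖f x‖ ≤ B) →
        (∀ x, ‖fderiv ℝ f x‖ ≤ B) → (∀ x ∉ K', L f x = 0) ∧ ∀ x, ‖L f x‖ ≤ C * B) :
    ∃ w : TopCurrent Ω, ∀ f, w f = u (L f) := by
  obtain ⟨g, hg, hlim⟩ := exists_tendsto_integral u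
  set T : ℕ → TopCurrent Ω' := fun j ↦
    TestFunction.integralAgainstBilinCLM (ContinuousLinearMap.mul ℂ ℂ) volume (g j) with hT
  have hTapp : ∀ j (ψ : TestFun Ω'), T j ψ = ∫ x, ψ x * g j x := fun j ψ ↦
    TestFunction.integralAgainstBilinCLM_eq_integral
      ((hg j).continuousOn.locallyIntegrableOn Ω'.isOpen.measurableSet)
  -- Against the continuous function `g j`, only the supremum of `L f` on a fixed compact set
  -- matters, and it is controlled by the assumption on `L`.
  have hcont : ∀ (K : Compacts (Space m)) (hK : (K : Set (Space m)) ⊆ Ω) (j : ℕ),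
      ∃ S : 𝓓_{K}(Space m, ℂ) →L[ℂ] ℂ,
        ∀ f, S f = T j (L (TestFunction.ofSupportedInCLM ℂ hK f)) := by
    intro K hK j
    obtain ⟨K', hK', C, hC, hb⟩ := hL K K.isCompact
    refine ⟨ContDiffMapSupportedIn.mkCLMtoNormedSpace ℂ
      (fun f ↦ T j (L (TestFunction.ofSupportedInCLM ℂ hK f))) (fun f f' ↦ by simp only [map_add])
      (fun c f ↦ by simp only [map_smul]) ⟨{0, 1}, C * ∫ x in K', ‖g j x‖, by positivity,
        fun f ↦ ?_⟩, fun f ↦ rfl⟩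
    set B := (({0, 1} : Finset ℕ).sup (ContDiffMapSupportedIn.seminorm ℂ (Space m) ℂ ⊤ K)) f
      with hB
    have hB0 : 0 ≤ B := apply_nonneg _ _
    have hle : ∀ i ∈ ({0, 1} : Finset ℕ), ContDiffMapSupportedIn.seminorm ℂ (Space m) ℂ ⊤ K i f ≤ B :=
      fun i hi ↦ Seminorm.le_def.1 (Finset.le_sup
        (f := ContDiffMapSupportedIn.seminorm ℂ (Space m) ℂ ⊤ K) hi) f
    obtain ⟨h1, h2⟩ := hb (TestFunction.ofSupportedInCLM ℂ hK f) B hB0 f.tsupport_subset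
      (fun x ↦ (ContDiffMapSupportedIn.norm_apply_le_seminorm ℂ).trans (hle 0 (by simp)))
      (fun x ↦ by
        rw [← norm_iteratedFDeriv_one]
        exact (ContDiffMapSupportedIn.norm_iteratedFDeriv_apply_le_seminorm_top ℂ).trans
          (hle 1 (by simp)))
    have h3 : ∫ x, L (TestFunction.ofSupportedInCLM ℂ hK f) x * g j x =
        ∫ x in K', L (TestFunction.ofSupportedInCLM ℂ hK f) x * g j x := by
      rw [setIntegral_eq_integral_of_forall_compl_eq_zero]
      intro x hx
      rw [h1 x hx, zero_mul]
    have hint : IntegrableOn (fun x ↦ C * B * ‖g j x‖) K' :=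
      ((hg j).norm.continuousOn.integrableOn_compact hK').const_mul _
    rw [hTapp, h3]
    refine (norm_integral_le_of_norm_le hint (Eventually.of_forall fun x ↦ ?_)).trans ?_
    · rw [norm_mul]
      gcongr
      exact h2 x
    · rw [integral_const_mul]
      exact le_of_eq (by ring)
  choose S hS using hcont
  have hlimS : ∀ (K : Compacts (Space m)) (hK : (K : Set (Space m)) ⊆ Ω),
      Tendsto (fun j f ↦ S K hK j f) atTop
        (𝓝 fun f ↦ u (L (TestFunction.ofSupportedInCLM ℂ hK f))) := by
    intro K hK
    rw [tendsto_pi_nhds]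
    intro f
    simp only [hS, hTapp]
    exact hlim _
  -- The spaces of functions supported in a fixed compact set are barrelled, so the pointwise limit
  -- is continuous on each of them, hence on all test functions.
  exact ⟨TestFunction.limitCLM ℂ (fun f ↦ u (L f))
    (fun K hK ↦ continuousLinearMapOfTendsto (S K hK) (hlimS K hK)) (fun _ _ _ ↦ rfl), fun _ ↦ rfl⟩

/-! ### The extension of an invariant current -/

/-- A test function on `ℝⁿ` which vanishes near `0`, as a test function on `ℝⁿ ∖ {0}`. -/
def puncture {m : ℕ} (f : TestFun (⊤ : Opens (Space m))) (hf : ∀ᶠ x in 𝓝 0, f x = 0) :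
    TestFun (punctured m) where
  toFun := f
  contDiff' := f.contDiff
  hasCompactSupport' := f.hasCompactSupport
  tsupport_subset' := by
    intro x hx hx0
    have h0 : x = 0 := hx0
    subst h0
    exact notMem_tsupport_iff_eventuallyEq.2 hf hx

theorem eventually_eq_zero_of_punctured {m : ℕ} {F : Type} [NormedAddCommGroup F] [NormedSpace ℝ F]
    (f : 𝓓(punctured m, F)) : ∀ᶠ x in 𝓝 0, f x = 0 :=
  notMem_tsupport_iff_eventuallyEq.1 fun h ↦ f.tsupport_subset h rfl

theorem monoCLM_punctured_apply {m : ℕ} {F : Type} [NormedAddCommGroup F] [NormedSpace ℝ F]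
    [NormedSpace ℂ F] [SMulCommClass ℝ ℂ F] (f : 𝓓(punctured m, F)) (x : Space m) :
    (TestFunction.monoCLM ℂ f : 𝓓((⊤ : Opens (Space m)), F)) x = f x := by
  rw [TestFunction.monoCLM_apply, if_pos ⟨le_rfl, le_top⟩]

section Extension

open unitInterval

variable {m : ℕ}

/-- The operator `f ↦ (1 - χ) f - (V χ) P f`, where `P f` is the primitive of `f` along the
trajectories of `V`. -/
def correction {V : Space m → Space m} (hV : ContDiff ℝ ∞ V) {Φ : Space m → C(I, Space m)}
    (hΦ : ContDiff ℝ ∞ Φ) (χ : TestFun (⊤ : Opens (Space m))) (hχ : ∀ᶠ x in 𝓝 0, χ x = 1) :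
    TestFun (⊤ : Opens (Space m)) →ₗ[ℂ] TestFun (punctured m) where
  toFun f := puncture
    ⟨fun x ↦ (1 - χ x) * f x - fderiv ℝ χ x (V x) * primitive Φ f.contDiff x,
      ((contDiff_const.sub χ.contDiff).mul f.contDiff).sub
        (((χ.contDiff.fderiv_right (m := ∞) (by simp)).clm_apply hV).mul
          (contDiff_primitive hΦ f.contDiff)),
      HasCompactSupport.of_support_subset_isCompact
        (f.hasCompactSupport.isCompact.union χ.hasCompactSupport.isCompact) (by
          intro x hx
          by_contra h
          rw [mem_union, not_or] at h
          refine hx ?_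
          dsimp only
          rw [image_eq_zero_of_notMem_tsupport h.1,
            image_eq_zero_of_notMem_tsupport fun hx' ↦ h.2 (tsupport_fderiv_subset ℝ hx')]
          simp), subset_univ _⟩
    (by
      filter_upwards [hχ, hχ.eventually_nhds] with x h1 h2
      have h3 : (χ : Space m → ℂ) =ᶠ[𝓝 x] fun _ ↦ 1 := h2
      change (1 - χ x) * f x - fderiv ℝ χ x (V x) * primitive Φ f.contDiff x = 0
      rw [h1, h3.fderiv_eq]
      simp)
  map_add' f g := by
    ext x
    change (1 - χ x) * (f x + g x) -
      fderiv ℝ χ x (V x) * primitive Φ (f.contDiff.add g.contDiff) x = _ - _ + (_ - _)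
    rw [primitive_add Φ f.contDiff g.contDiff]
    ring
  map_smul' c f := by
    ext x
    change (1 - χ x) * (c * f x) - fderiv ℝ χ x (V x) *
      primitive Φ (contDiff_const.mul f.contDiff : ContDiff ℝ ∞ fun x ↦ c * f x) x = c * (_ - _)
    rw [primitive_const_mul Φ f.contDiff]
    ring

theorem correction_apply {V : Space m → Space m} (hV : ContDiff ℝ ∞ V)
    {Φ : Space m → C(I, Space m)} (hΦ : ContDiff ℝ ∞ Φ) (χ : TestFun (⊤ : Opens (Space m)))
    (hχ : ∀ᶠ x in 𝓝 0, χ x = 1) (f : TestFun (⊤ : Opens (Space m))) (x : Space m) :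
    correction hV hΦ χ hχ f x =
      (1 - χ x) * f x - fderiv ℝ χ x (V x) * primitive Φ f.contDiff x := rfl

theorem exists_topCurrent_correction {V : Space m → Space m} (hV : ContDiff ℝ ∞ V)
    {Φ : Space m → C(I, Space m)} (hΦ : ContDiff ℝ ∞ Φ) (χ : TestFun (⊤ : Opens (Space m)))
    (hχ : ∀ᶠ x in 𝓝 0, χ x = 1) (u : TopCurrent (punctured m)) :
    ∃ w : TopCurrent (⊤ : Opens (Space m)), ∀ f, w f = u (correction hV hΦ χ hχ f) := by
  refine exists_topCurrent_comp u (correction hV hΦ χ hχ) fun K hK ↦ ?_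
  have hχc := χ.hasCompactSupport.isCompact
  obtain ⟨C₁, hC₁⟩ := (hK.union hχc).exists_bound_of_continuousOn
    (continuous_const.sub χ.continuous : Continuous fun x ↦ 1 - χ x).continuousOn
  obtain ⟨C₂, hC₂⟩ := (hK.union hχc).exists_bound_of_continuousOn
    ((χ.contDiff.fderiv_right (m := ∞) (by simp)).clm_apply hV).continuous.continuousOn
  obtain ⟨C₃, hC₃⟩ := (hK.union hχc).exists_bound_of_continuousOn hΦ.continuous.continuousOn
  have hzero : ∀ f : TestFun (⊤ : Opens (Space m)), tsupport f ⊆ K → ∀ x ∉ K ∪ tsupport χ,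
      correction hV hΦ χ hχ f x = 0 := by
    intro f hf x hx
    rw [mem_union, not_or] at hx
    rw [correction_apply, image_eq_zero_of_notMem_tsupport fun h ↦ hx.1 (hf h),
      image_eq_zero_of_notMem_tsupport fun h ↦ hx.2 (tsupport_fderiv_subset ℝ h)]
    simp
  refine ⟨K ∪ tsupport χ, hK.union hχc, |C₁| + |C₂| * |C₃|, by positivity,
    fun f B hB hf h1 h2 ↦ ⟨hzero f hf, fun x ↦ ?_⟩⟩
  by_cases hx : x ∈ K ∪ tsupport χ
  · have h3 := norm_primitive_le Φ f.contDiff (x := x) hB fun z _ ↦ h2 z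
    have h4 : ‖primitive Φ f.contDiff x‖ ≤ B * |C₃| := h3.trans (by
      gcongr
      exact (hC₃ x hx).trans (le_abs_self _))
    rw [correction_apply]
    calc _ ≤ ‖1 - χ x‖ * ‖f x‖ + ‖fderiv ℝ χ x (V x)‖ * ‖primitive Φ f.contDiff x‖ := by
          rw [← norm_mul, ← norm_mul]
          exact norm_sub_le _ _
      _ ≤ |C₁| * B + |C₂| * (B * |C₃|) := by
          gcongr
          · exact (hC₁ x hx).trans (le_abs_self _)
          · exact h1 x
          · exact (hC₂ x hx).trans (le_abs_self _)
      _ = _ := by ring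
  · rw [hzero f hf x hx, norm_zero]
    positivity

theorem apply_lie_eq_zero {Ω : Opens (Space m)} {V : Space m → Space m} {hV : ContDiff ℝ ∞ V}
    {u : TopCurrent Ω} (hu : lieDer hV u = 0) (ψ : TestFun Ω) :
    u (contractTest Ω hV (dTest Ω ψ)) = 0 :=
  neg_eq_zero.1 (congrArg (fun T : TopCurrent Ω ↦ T ψ) hu)

/-- The difference of the cutoffs vanishes near `0`, so it is a test function on the punctured
space, and the difference of the pairings is `u` applied to its `V`-derivative. -/
theorem residuePairing_eq_of_eventually {V : Space m → Space m} {hV : ContDiff ℝ ∞ V}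
    {u : TopCurrent (punctured m)} (hu : lieDer hV u = 0)
    (χ₁ χ₂ : TestFun (⊤ : Opens (Space m))) (h₁ : ∀ᶠ x in 𝓝 0, χ₁ x = 1)
    (h₂ : ∀ᶠ x in 𝓝 0, χ₂ x = 1) :
    residuePairing hV u χ₁ h₁ = residuePairing hV u χ₂ h₂ := by
  have h0 : ∀ᶠ x in 𝓝 0, (χ₁ - χ₂) x = 0 := by
    filter_upwards [h₁, h₂] with x hx₁ hx₂
    change χ₁ x - χ₂ x = 0
    rw [hx₁, hx₂, sub_self]
  have h := apply_lie_eq_zero hu (puncture (χ₁ - χ₂) h0)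
  have h3 : contractTest (punctured m) hV (dTest (punctured m) (puncture (χ₁ - χ₂) h0)) =
      contractTest (punctured m) hV (dCutoff χ₁ h₁) -
        contractTest (punctured m) hV (dCutoff χ₂ h₂) := by
    ext x
    change (dTest (punctured m) (puncture (χ₁ - χ₂) h0)) x (V x) =
      fderiv ℝ χ₁ x (V x) - fderiv ℝ χ₂ x (V x)
    rw [dTest_apply]
    change fderiv ℝ ((χ₁ : Space m → ℂ) - (χ₂ : Space m → ℂ)) x (V x) = _
    rw [fderiv_sub (χ₁.contDiff.differentiable (by simp) x) (χ₂.contDiff.differentiable (by simp) x)]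
    rfl
  rw [h3, map_sub] at h
  exact sub_eq_zero.1 h

/-- An invariant current with vanishing residue has an invariant extension. -/
theorem exists_invariant_extension {V : Space m → Space m} (hV : IsEulerField V)
    {u : TopCurrent (punctured m)} (hu : lieDer hV.smooth u = 0)
    (hres : ∀ (χ : TestFun (⊤ : Opens (Space m))) (hχ : ∀ᶠ x in 𝓝 0, χ x = 1),
      residuePairing hV.smooth u χ hχ = 0) :
    ∃ w : TopCurrent (⊤ : Opens (Space m)), Extends w u ∧ lieDer hV.smooth w = 0 := by
  obtain ⟨Φ, hΦ⟩ := exists_isTrajectoryFamily hV.smooth hV.apply_zero hV.fderiv_zero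
  obtain ⟨U, hU, hUo, h0U⟩ := eventually_nhds_iff.1 ((hΦ.fderiv_primitive (F := ℂ)).and
    (hΦ.primitive_fderiv (F := ℂ) hV.smooth hV.apply_zero))
  obtain ⟨χ, hχU, hχ1⟩ := exists_cutoff (⊤ : Opens (Space m)) (isCompact_singleton (x := 0)) hUo
    (singleton_subset_iff.2 h0U) (subset_univ _)
  have hχ : ∀ᶠ x in 𝓝 0, χ x = 1 := by rwa [nhdsSet_singleton] at hχ1
  have hχd : Differentiable ℝ (χ : Space m → ℂ) := χ.contDiff.differentiable (by simp)
  obtain ⟨w, hw⟩ := exists_topCurrent_correction hV.smooth hΦ.smooth χ hχ u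
  refine ⟨w, fun φ ↦ ?_, ?_⟩
  · rw [hw]
    set f : TestFun (⊤ : Opens (Space m)) := TestFunction.monoCLM ℂ φ with hf
    have hfφ : ∀ x, f x = φ x := monoCLM_punctured_apply φ
    have hf0 : ∀ᶠ x in 𝓝 0, f x = 0 := by
      filter_upwards [eventually_eq_zero_of_punctured φ] with x hx
      rw [hfφ, hx]
    have hP := contDiff_primitive hΦ.smooth f.contDiff
    set ψ' : TestFun (⊤ : Opens (Space m)) := smulTest χ 1 ⟨primitive Φ f.contDiff, hP⟩
    have hψ' : ∀ x, ψ' x = primitive Φ f.contDiff x * χ x := fun x ↦ by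
      rw [smulTest_apply, smul_eq_mul, mul_one]
    have hψ0 : ∀ᶠ x in 𝓝 0, ψ' x = 0 := by
      filter_upwards [primitive_eventually_eq_zero hΦ.smooth.continuous hΦ.zero f.contDiff hf0]
        with x hx
      rw [hψ', hx, zero_mul]
    -- On the support of `χ` the primitive satisfies `V(Pf) = f`, as `f(0) = 0`. Hence `χ f + (Vχ)
    -- Pf = V(χ Pf)`, and `χ Pf` is an admissible test function since it vanishes near `0`.
    have hcorr : correction hV.smooth hΦ.smooth χ hχ f = φ -
        contractTest (punctured m) hV.smooth (dTest (punctured m) (puncture ψ' hψ0)) := by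
      ext x
      rw [correction_apply]
      change _ = φ x - (dTest (punctured m) (puncture ψ' hψ0)) x (V x)
      rw [dTest_apply]
      have h1 : (puncture ψ' hψ0 : Space m → ℂ) = fun x ↦ primitive Φ f.contDiff x * χ x :=
        funext hψ'
      rw [h1, fderiv_fun_mul (hP.differentiable (by simp) x) (hχd x), hfφ]
      change _ = φ x - (primitive Φ f.contDiff x * fderiv ℝ χ x (V x) +
        χ x * fderiv ℝ (primitive Φ f.contDiff) x (V x))
      have h2 : χ x * fderiv ℝ (primitive Φ f.contDiff) x (V x) = χ x * φ x := by
        by_cases hx : x ∈ tsupport χ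
        · rw [(hU x (hχU hx)).1 f f.contDiff, hf0.self_of_nhds, hfφ, sub_zero]
        · rw [image_eq_zero_of_notMem_tsupport hx, zero_mul, zero_mul]
      rw [h2]
      ring
    rw [hcorr, map_sub, apply_lie_eq_zero hu, sub_zero]
  · ext ψ
    change -(w (contractTest ⊤ hV.smooth (dTest ⊤ ψ))) = 0
    rw [neg_eq_zero, hw]
    set η' : TestFun (⊤ : Opens (Space m)) :=
      smulTest ψ 1 ⟨fun x ↦ 1 - χ x, contDiff_const.sub χ.contDiff⟩
    have hη' : ∀ x, η' x = (1 - χ x) * ψ x := fun x ↦ by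
      rw [smulTest_apply, smul_eq_mul, mul_one]
    have hη0 : ∀ᶠ x in 𝓝 0, η' x = 0 := by
      filter_upwards [hχ] with x hx
      rw [hη', hx, sub_self, zero_mul]
    have hψd : Differentiable ℝ (ψ : Space m → ℂ) := ψ.contDiff.differentiable (by simp)
    -- Since `P(Vψ) = ψ - ψ(0)` on the support of `χ`, the correction of `Vψ` is `V((1 - χ) ψ) +
    -- ψ(0) Vχ`. The current kills the first term by invariance and the second by the vanishing of
    -- the residue.
    have hcorr : correction hV.smooth hΦ.smooth χ hχ
        (contractTest ⊤ hV.smooth (dTest ⊤ ψ)) =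
        contractTest (punctured m) hV.smooth (dTest (punctured m) (puncture η' hη0)) +
          ψ 0 • contractTest (punctured m) hV.smooth (dCutoff χ hχ) := by
      ext x
      rw [correction_apply]
      change _ = (dTest (punctured m) (puncture η' hη0)) x (V x) + ψ 0 * fderiv ℝ χ x (V x)
      have h1 : (puncture η' hη0 : Space m → ℂ) = fun x ↦ (1 - χ x) * ψ x := funext hη'
      rw [dTest_apply, h1, fderiv_fun_mul ((hχd x).const_sub 1) (hψd x), contractTest_apply,
        dTest_apply, fderiv_const_sub]
      change _ = (1 - χ x) * fderiv ℝ ψ x (V x) + ψ x * -fderiv ℝ χ x (V x) + _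
      have h2 : fderiv ℝ χ x (V x) * primitive Φ
          (contractTest ⊤ hV.smooth (dTest ⊤ ψ)).contDiff x =
          fderiv ℝ χ x (V x) * (ψ x - ψ 0) := by
        by_cases hx : x ∈ tsupport χ
        · rw [primitive_congr Φ _ ((ψ.contDiff.fderiv_right (m := ∞) (by simp)).clm_apply hV.smooth)
            (by ext; simp), (hU x (hχU hx)).2 ψ ψ.contDiff]
        · rw [image_eq_zero_of_notMem_tsupport fun h ↦ hx (tsupport_fderiv_subset ℝ h)]
          simp
      rw [h2]
      ring
    rw [hcorr, map_add, map_smul, apply_lie_eq_zero hu]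
    have := hres χ hχ
    change u (contractTest (punctured m) hV.smooth (dCutoff χ hχ)) = 0 at this
    rw [this]
    simp

/-- `χ` itself is a test function on the whole space, so an invariant extension kills `Vχ`, which is
supported off the origin. -/
theorem residuePairing_eq_zero_of_extension {V : Space m → Space m} {hV : ContDiff ℝ ∞ V}
    {u : TopCurrent (punctured m)} {w : TopCurrent (⊤ : Opens (Space m))} (hwu : Extends w u)
    (hw : lieDer hV w = 0) (χ : TestFun (⊤ : Opens (Space m))) (hχ : ∀ᶠ x in 𝓝 0, χ x = 1) :
    residuePairing hV u χ hχ = 0 := by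
  rw [← apply_lie_eq_zero hw χ]
  refine (hwu _).symm.trans (congrArg w ?_)
  ext x
  rw [monoCLM_punctured_apply]
  change fderiv ℝ χ x (V x) = dTest ⊤ χ x (V x)
  rw [dTest_apply]

theorem hasSphereIntegral_contract {V : Space m → Space m} {hV : ContDiff ℝ ∞ V}
    {u : TopCurrent (punctured m)} (hu : lieDer hV u = 0)
    (hdisj : Disjoint (wavefront u) (conormalSphere m))
    (χ : TestFun (⊤ : Opens (Space m))) (hχ : ∀ᶠ x in 𝓝 0, χ x = 1) :
    HasSphereIntegral (contract hV u) (-residuePairing hV u χ hχ) := by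
  refine ⟨hdisj.mono_left (wavefront_contract_subset hV u), fun Γ hΓ hWF hΓd ↦ ⟨?_, fun θ hθ hT ↦ ?_⟩⟩
  · obtain ⟨θ, hθ, hT⟩ := exists_tendstoHormander (contract hV u) hWF
    exact ⟨θ, fun j ↦ (hθ j).contDiffOn, hT⟩
  · exact tendsto_sphereIntegral hΓ hΓd hWF
      (fun k ↦ residuePairing_eq_of_eventually hu _ _ _ hχ) hθ hT

end Extension

end Residue

end

theorem mainTheorem9 (m : ℕ) (V : Residue.Space m → Residue.Space m)
    (hV : Residue.IsEulerField V) (u : Residue.TopCurrent (Residue.punctured m))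
    (hu : Residue.lieDer hV.smooth u = 0) :
    -- the contraction of `u` with `V` is closed on `ℝⁿ ∖ {0}`
    Residue.extDer (Residue.contract hV.smooth u) = 0 ∧
    -- independence of the cutoff
    (∀ (χ₁ χ₂ : Residue.TestFun (⊤ : Opens (Residue.Space m)))
      (h₁ : ∀ᶠ x in 𝓝 0, χ₁ x = 1) (h₂ : ∀ᶠ x in 𝓝 0, χ₂ x = 1),
      Residue.residuePairing hV.smooth u χ₁ h₁ = Residue.residuePairing hV.smooth u χ₂ h₂) ∧
    -- the pairing as an integral over the unit sphere
    (∀ Q : QuadraticForm ℝ (Residue.Space m),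
      (QuadraticMap.associated (R := ℝ) Q).SeparatingLeft →
      Residue.wavefront u ⊆ {p | Q p.1 = 0 ∧ ∃ τ : ℝ, τ < 0 ∧ p.2 = τ • fderiv ℝ Q p.1} →
      ∀ (χ : Residue.TestFun (⊤ : Opens (Residue.Space m))) (hχ : ∀ᶠ x in 𝓝 0, χ x = 1),
        Residue.HasSphereIntegral (Residue.contract hV.smooth u)
          (-Residue.residuePairing hV.smooth u χ hχ)) ∧
    -- the pairing as the obstruction to a scale invariant extension
    (∀ (χ : Residue.TestFun (⊤ : Opens (Residue.Space m))) (hχ : ∀ᶠ x in 𝓝 0, χ x = 1),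
      ((∃ w : Residue.TopCurrent (⊤ : Opens (Residue.Space m)),
          Residue.Extends w u ∧ Residue.lieDer hV.smooth w = 0) ↔
        Residue.residuePairing hV.smooth u χ hχ = 0) ∧
      ((∃ w : Residue.TopCurrent (⊤ : Opens (Residue.Space m)),
          Residue.Extends w u ∧ Residue.extDer (Residue.contract hV.smooth w) = 0) ↔
        Residue.residuePairing hV.smooth u χ hχ = 0)) ∧
    -- an extension is scale invariant iff its contraction with `V` is closed
    (∀ w : Residue.TopCurrent (⊤ : Opens (Residue.Space m)), Residue.Extends w u →
      (Residue.lieDer hV.smooth w = 0 ↔ Residue.extDer (Residue.contract hV.smooth w) = 0)) := by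
  -- Both sides send `φ` to `-T(dφ(V))`, by definition.
  have key : ∀ (Ω : TopologicalSpace.Opens (Residue.Space m)) (T : Residue.TopCurrent Ω),
      Residue.extDer (Residue.contract hV.smooth T) = Residue.lieDer hV.smooth T :=
    fun _ _ ↦ rfl
  have hind : ∀ (χ₁ χ₂ : Residue.TestFun (⊤ : Opens (Residue.Space m)))
      (h₁ : ∀ᶠ x in 𝓝 0, χ₁ x = 1) (h₂ : ∀ᶠ x in 𝓝 0, χ₂ x = 1),
      Residue.residuePairing hV.smooth u χ₁ h₁ = Residue.residuePairing hV.smooth u χ₂ h₂ :=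
    Residue.residuePairing_eq_of_eventually hu
  have hext : ∀ (χ : Residue.TestFun (⊤ : Opens (Residue.Space m))) (hχ : ∀ᶠ x in 𝓝 0, χ x = 1),
      (∃ w : Residue.TopCurrent (⊤ : Opens (Residue.Space m)),
        Residue.Extends w u ∧ Residue.lieDer hV.smooth w = 0) ↔
      Residue.residuePairing hV.smooth u χ hχ = 0 := fun χ hχ ↦
    ⟨fun ⟨_, hwu, hw⟩ ↦ Residue.residuePairing_eq_zero_of_extension hwu hw χ hχ, fun h ↦
      Residue.exists_invariant_extension hV hu fun χ' hχ' ↦ (hind χ' χ hχ' hχ).trans h⟩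
  refine ⟨(key _ u).trans hu, hind, fun Q _ hQ χ hχ ↦ ?_, fun χ hχ ↦ ⟨hext χ hχ, ?_⟩,
    fun w _ ↦ by rw [key]⟩
  · exact Residue.hasSphereIntegral_contract hu (Residue.disjoint_conormalSphere hQ) χ hχ
  · simp only [key]
    exact hext χ hχ
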